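/- Let $m \ge p$ be integers, let $\Xi = (\xi_{ij}) \in \mathbb{C}^{m \times p}$, and let $Z = (z_{ij})$ be an $m \times p$ random complex matrix with $Z \sim \mathbb{C}N_{m\times p}(\Xi, I_m \otimes I_p)$, that is, the entries $z_{ij}$ are independent and $z_{ij}$ has density $\pi^{-1} e^{-|z - \xi_{ij}|^2}$ with respect to Lebesgue measure on $\mathbb{C}$. Write $Z^*Z = U L U^*$ with $U$ a $p \times p$ unitary matrix and $L = \mathrm{Diag}(\ell_1, \dots, \ell_p)$, $\ell_1 \ge \ell_2 \ge \dots \ge \ell_p$ (almost surely $\ell_1 > \dots > \ell_p > 0$). Let $h_1, \dots, h_p$ be real-valued differentiable functions on $\mathbb{R}^p_{>} = \{(\ell_1, \dots, \ell_p) : \ell_1 > \dots > \ell_p > 0\}$, put $H(L) = \mathrm{Diag}(h_1(L), \dots, h_p(L))$, and consider the estimator $$\widehat{\Xi}_H = Z\,[I_p + U H(L) U^*]$$ of $\Xi$. Assume that the random variable $$B = \sum_{k=1}^p \Bigl\{ 2(m-p+1) h_k(L) + 2 \ell_k \frac{\partial h_k}{\partial \ell_k}(L) + 4 \sum_{b >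 k} \frac{\ell_k h_k(L) - \ell_b h_b(L)}{\ell_k - \ell_b} + \ell_k h_k(L)^2 \Bigr\}$$ is integrable. Then the loss $\mathrm{Tr}\{(\widehat{\Xi}_H - \Xi)^*(\widehat{\Xi}_H - \Xi)\}$ is integrable, and the risk of $\widehat{\Xi}_H$ is $$\mathbb{E}\bigl[\mathrm{Tr}\{(\widehat{\Xi}_H - \Xi)^*(\widehat{\Xi}_H - \Xi)\}\bigr] = mp + \mathbb{E}[B].$$ -/

import Mathlib

open MeasureTheory ProbabilityTheory
open scoped Matrix

noncomputable section

/-- The univariate complex normal distribution `ℂN(ξ, v)` with mean `ξ` and variance `v > 0`: its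
density with respect to Lebesgue measure on `ℂ` is `z ↦ π⁻¹ v⁻¹ exp (-|z - ξ|² / v)`. -/
def complexNormal (ξ : ℂ) (v : ℝ) : Measure ℂ :=
  volume.withDensity fun z =>
    ENNReal.ofReal (Real.pi⁻¹ * v⁻¹ * Real.exp (-(‖z - ξ‖ ^ 2 / v)))

/-- `Z ∼ ℂN_{m × p}(Ξ, I_m ⊗ I_p)` under `P`: the entries of the random matrix `Z` are
independent and the entry `Z i j` has the distribution `ℂN(Ξ i j, 1)`. -/
structure IsStdComplexNormalMatrix {Ω : Type*} [MeasurableSpace Ω] {m p : ℕ}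
    (Z : Ω → Matrix (Fin m) (Fin p) ℂ) (Ξ : Matrix (Fin m) (Fin p) ℂ) (P : Measure Ω) :
    Prop where
  hasLaw : ∀ i j, HasLaw (fun ω => Z ω i j) (complexNormal (Ξ i j) 1) P
  indep : iIndepFun (fun (ij : Fin m × Fin p) ω => Z ω ij.1 ij.2) P

/-- The set `ℝ^p_>` of vectors with `ℓ₁ > ℓ₂ > ⋯ > ℓ_p > 0`. -/
def strictlyOrderedPositive (p : ℕ) : Set (Fin p → ℝ) :=
  {l | StrictAnti l ∧ ∀ k, 0 < l k}

/-- The real vector `a` as a complex diagonal matrix. -/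
def realDiag {p : ℕ} (a : Fin p → ℝ) : Matrix (Fin p) (Fin p) ℂ :=
  Matrix.diagonal fun k => (a k : ℂ)

/-- `W = U L U*` with `U` unitary and `L = Diag(ℓ₁, …, ℓ_p)` real, with the `ℓ_k` in decreasing
order. -/
structure IsOrderedEigendecomposition {p : ℕ} (W U : Matrix (Fin p) (Fin p) ℂ)
    (l : Fin p → ℝ) : Prop where
  unitary : U ∈ Matrix.unitaryGroup (Fin p) ℂ
  antitone : Antitone l
  eq : W = U * realDiag l * Uᴴ

/-- The estimate `Z [I + U H(L) U*]`, where `H(L) = Diag(h₁(L), …, h_p(L))`. -/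
def invariantEstimate {m p : ℕ} (h : Fin p → (Fin p → ℝ) → ℝ) (Z : Matrix (Fin m) (Fin p) ℂ)
    (U : Matrix (Fin p) (Fin p) ℂ) (l : Fin p → ℝ) : Matrix (Fin m) (Fin p) ℂ :=
  Z * (1 + U * realDiag (fun k => h k l) * Uᴴ)

/-- The loss `Tr {(Ξ̂ - Ξ)* (Ξ̂ - Ξ)}` (the trace is a real number). -/
def traceLoss {m p : ℕ} (Ξhat Ξ : Matrix (Fin m) (Fin p) ℂ) : ℝ :=
  (((Ξhat - Ξ)ᴴ * (Ξhat - Ξ)).trace).re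

/-- The risk of a random matrix `Ξhat` as an estimator of `Ξ`: its expected loss. -/
def traceRisk {Ω : Type*} [MeasurableSpace Ω] {m p : ℕ} (P : Measure Ω)
    (Ξhat : Ω → Matrix (Fin m) (Fin p) ℂ) (Ξ : Matrix (Fin m) (Fin p) ℂ) : ℝ :=
  ∫ ω, traceLoss (Ξhat ω) Ξ ∂P

/-- The partial derivative `∂g/∂ℓ_k` at `l`. -/
def partialDeriv {p : ℕ} (g : (Fin p → ℝ) → ℝ) (k : Fin p) (l : Fin p → ℝ) : ℝ :=
  lineDeriv ℝ g l (Pi.single k 1)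

/-- `∑_k {2(m-p+1) h_k + 2 ℓ_k ∂h_k/∂ℓ_k + 4 ∑_{b>k} (ℓ_k h_k - ℓ_b h_b)/(ℓ_k - ℓ_b) + ℓ_k h_k²}`,
with all functions evaluated at `l`. -/
def riskIntegrand (m : ℕ) {p : ℕ} (h : Fin p → (Fin p → ℝ) → ℝ) (l : Fin p → ℝ) : ℝ :=
  ∑ k, (2 * ((m : ℝ) - p + 1) * h k l + 2 * l k * partialDeriv (h k) k l
    + 4 * ∑ b ∈ Finset.Ioi k, (l k * h k l - l b * h b l) / (l k - l b)
    + l k * h k l ^ 2)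

end

/-!
Write `l` for the ordered eigenvalues of `Z* Z`, `P_k` for its eigenprojections, and
`V_h(Z) = Z ∑ h_k(l) P_k`, so that the estimate is `Z + V_h(Z)`. Almost every `Z` lies in the open
set of regular matrices (`l` strictly decreasing and positive), where `l` and the `P_k` are
differentiable; there the divergence of `V_h` is the part of the risk integrand `B` that is linear
in `h`, and `|V_h|² = ∑ l_k h_k²` (`exists_hasFDerivAt_invariantField_trace`,
`reInner_invariantField_self`). With the Gaussian density `φ` of `Z` and the error
`W = Z - Ξ + V_h(Z)`, the divergence of `φ W` is therefore `φ (f - |W|²)`, where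
`f = 2 m p + B - |Z - Ξ|²`. If its integral vanishes, then `E |W|² = E f`, which is the claim
because `E |Z - Ξ|² = m p`.

The difficulty is that the `h_k` may be arbitrarily large near the boundary of the set of regular
matrices, and only `B` is assumed integrable, not its parts. The divergence theorem is applied to
`w² φ W` for cutoffs `w` supported in compact sets of regular matrices. It gives
`∫ w² φ |W|² = ∫ w² φ f + 2 ∫ w φ Dw(W)`, and the last integral is bounded by
`(∫ φ |∇w|²)^(1/2) (∫ w² φ |W|²)^(1/2)`. The left side is quadratic in `W`, so it absorbs this
error: if the energies `∫ φ |∇w|²` tend to `0`, then `|W|²` is integrable by Fatou's lemma, and the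
error disappears in the limit (`integrable_and_integral_eq_of_cutoff`).

Cutoffs of vanishing energy exist because the boundary has capacity zero. They are made from the
barrier `t = ∑_{k < b} log (l_k - l_b) + ∑ log l_k`, which tends to `-∞` at the boundary. It is
subharmonic: the Laplacian of `t` is `4 (m - p) ∑ 1 / l_k + 4 ∑ l_k (∑_{j ≠ k} 1 / (l_k - l_j))²`,
where the identity `∑ a / ((a - b) (a - c)) = 0` has cancelled the mixed terms
(`fieldDivergence_logBarrierGrad`). Testing the divergence theorem on the gradient of `t` times the
cutoff itself then bounds the energy (`IsBarrier.integral_energy_le`, `IsBarrier.exists_cutoff`).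
This part is carried out for a general barrier on an open subset of a finite-dimensional space.
-/

-- The choice of a norm on matrices is immaterial; it gives a meaning to derivatives.
attribute [local instance] Matrix.normedAddCommGroup Matrix.normedSpace

/-! ### Eigenprojections and the Hoffman–Wielandt inequality -/

section Spectral

variable {p : ℕ}

/-- The orthogonal projection `u_k u_k*` onto the line spanned by the `k`-th column of `U`. -/
noncomputable def eigenProj (U : Matrix (Fin p) (Fin p) ℂ) (k : Fin p) :
    Matrix (Fin p) (Fin p) ℂ := U * Matrix.single k k 1 * Uᴴ

/-- The spectral function `U Diag(a) U*`, written through the eigenprojections. -/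
noncomputable def spectralSum (U : Matrix (Fin p) (Fin p) ℂ) (a : Fin p → ℝ) :
    Matrix (Fin p) (Fin p) ℂ := ∑ k, a k • eigenProj U k

lemma mul_realDiag_mul_conjTranspose (U : Matrix (Fin p) (Fin p) ℂ) (a : Fin p → ℝ) :
    U * realDiag a * Uᴴ = spectralSum U a := by
  have : realDiag a = ∑ k, a k • Matrix.single k k (1 : ℂ) := by
    ext i j
    simp [realDiag, Matrix.sum_apply, Matrix.single_apply, Matrix.diagonal_apply, ite_and]
  rw [this, spectralSum, Finset.mul_sum, Finset.sum_mul]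
  simp only [eigenProj, Matrix.mul_smul, Matrix.smul_mul]

lemma eigenProj_conjTranspose (U : Matrix (Fin p) (Fin p) ℂ) (k : Fin p) :
    (eigenProj U k)ᴴ = eigenProj U k := by
  simp [eigenProj, Matrix.mul_assoc]

lemma eigenProj_mul {U : Matrix (Fin p) (Fin p) ℂ} (hU : U ∈ Matrix.unitaryGroup (Fin p) ℂ)
    (j k : Fin p) : eigenProj U j * eigenProj U k = if j = k then eigenProj U k else 0 := by
  have h : Uᴴ * U = 1 := Matrix.mem_unitaryGroup_iff'.1 hU
  have : eigenProj U j * eigenProj U k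
      = U * (Matrix.single j j 1 * (Uᴴ * U) * Matrix.single k k 1) * Uᴴ := by
    simp only [eigenProj, Matrix.mul_assoc]
  rw [this, h, Matrix.mul_one]
  split_ifs with hjk
  · subst hjk; simp [eigenProj]
  · rw [Matrix.single_mul_single_of_ne (h := hjk)]; simp

lemma sum_eigenProj {U : Matrix (Fin p) (Fin p) ℂ} (hU : U ∈ Matrix.unitaryGroup (Fin p) ℂ) :
    ∑ k, eigenProj U k = 1 := by
  have h : U * Uᴴ = 1 := Matrix.mem_unitaryGroup_iff.1 hU
  have : realDiag (fun _ : Fin p => 1) = 1 := by simp [realDiag]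
  have h2 := mul_realDiag_mul_conjTranspose U (fun _ => 1)
  rw [this, Matrix.mul_one, h] at h2
  simp [h2, spectralSum]

lemma trace_eigenProj {U : Matrix (Fin p) (Fin p) ℂ} (hU : U ∈ Matrix.unitaryGroup (Fin p) ℂ)
    (k : Fin p) : (eigenProj U k).trace = 1 := by
  have h : Uᴴ * U = 1 := Matrix.mem_unitaryGroup_iff'.1 hU
  rw [eigenProj, Matrix.trace_mul_comm, ← Matrix.mul_assoc, h]
  simp

lemma spectralSum_mul_eigenProj {U : Matrix (Fin p) (Fin p) ℂ}
    (hU : U ∈ Matrix.unitaryGroup (Fin p) ℂ) (a : Fin p → ℝ) (k : Fin p) :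
    spectralSum U a * eigenProj U k = a k • eigenProj U k := by
  simp [spectralSum, Finset.sum_mul, eigenProj_mul hU]

lemma eigenProj_mul_spectralSum {U : Matrix (Fin p) (Fin p) ℂ}
    (hU : U ∈ Matrix.unitaryGroup (Fin p) ℂ) (a : Fin p → ℝ) (k : Fin p) :
    eigenProj U k * spectralSum U a = a k • eigenProj U k := by
  simp [spectralSum, Finset.mul_sum, eigenProj_mul hU]

lemma spectralSum_mul_spectralSum {U : Matrix (Fin p) (Fin p) ℂ}
    (hU : U ∈ Matrix.unitaryGroup (Fin p) ℂ) (a b : Fin p → ℝ) :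
    spectralSum U a * spectralSum U b = spectralSum U (fun k => a k * b k) := by
  conv_lhs => rw [spectralSum, Finset.sum_mul]
  simp only [Matrix.smul_mul, eigenProj_mul_spectralSum hU, smul_smul]
  rfl

lemma trace_spectralSum {U : Matrix (Fin p) (Fin p) ℂ}
    (hU : U ∈ Matrix.unitaryGroup (Fin p) ℂ) (a : Fin p → ℝ) :
    (spectralSum U a).trace = ((∑ k, a k : ℝ) : ℂ) := by
  simp [spectralSum, Matrix.trace_sum, trace_eigenProj hU]

lemma spectralSum_conjTranspose (U : Matrix (Fin p) (Fin p) ℂ) (a : Fin p → ℝ) :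
    (spectralSum U a)ᴴ = spectralSum U a := by
  simp [spectralSum, Matrix.conjTranspose_sum, eigenProj_conjTranspose]

lemma IsOrderedEigendecomposition.eq_spectralSum {W U : Matrix (Fin p) (Fin p) ℂ} {l : Fin p → ℝ}
    (h : IsOrderedEigendecomposition W U l) : W = spectralSum U l := by
  rw [← mul_realDiag_mul_conjTranspose]; exact h.eq

lemma IsOrderedEigendecomposition.isHermitian {W U : Matrix (Fin p) (Fin p) ℂ} {l : Fin p → ℝ}
    (h : IsOrderedEigendecomposition W U l) : W.IsHermitian := by
  rw [h.eq_spectralSum]; exact spectralSum_conjTranspose U l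

/-- A perturbation identity without remainder. Dividing by `l' k - l j` gives the continuity and
then the derivative of the eigenprojections, and for `j = k` the derivative of the eigenvalues. -/
lemma smul_eigenProj_mul_eigenProj {W U W' U' : Matrix (Fin p) (Fin p) ℂ} {l l' : Fin p → ℝ}
    (h : IsOrderedEigendecomposition W U l) (h' : IsOrderedEigendecomposition W' U' l')
    (j k : Fin p) :
    (l' k - l j) • (eigenProj U j * eigenProj U' k)
      = eigenProj U j * (W' - W) * eigenProj U' k := by
  rw [mul_sub, sub_mul, mul_assoc, h'.eq_spectralSum, spectralSum_mul_eigenProj h'.unitary,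
    h.eq_spectralSum, eigenProj_mul_spectralSum h.unitary]
  rw [sub_smul, Matrix.mul_smul, Matrix.smul_mul]

lemma trace_eigenProj_mul_eigenProj (U U' : Matrix (Fin p) (Fin p) ℂ) (j k : Fin p) :
    (eigenProj U j * eigenProj U' k).trace = ((‖(Uᴴ * U') j k‖ ^ 2 : ℝ) : ℂ) := by
  have : (eigenProj U j * eigenProj U' k).trace
      = (Matrix.single j j 1 * (Uᴴ * U') * Matrix.single k k 1 * (Uᴴ * U')ᴴ).trace := by
    simp only [eigenProj, Matrix.conjTranspose_mul, Matrix.conjTranspose_conjTranspose]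
    rw [Matrix.mul_assoc, Matrix.mul_assoc, Matrix.trace_mul_comm]
    simp only [Matrix.mul_assoc]
  rw [this]
  simp only [Matrix.single_mul_mul_single, Matrix.trace_single_mul]
  simp only [one_mul, mul_one, Matrix.conjTranspose_apply]
  push_cast
  exact Complex.mul_conj' _

lemma doublyStochastic_normSq {V : Matrix (Fin p) (Fin p) ℂ}
    (hV : V ∈ Matrix.unitaryGroup (Fin p) ℂ) :
    (Matrix.of fun j k => ‖V j k‖ ^ 2) ∈ doublyStochastic ℝ (Fin p) := by
  rw [mem_doublyStochastic_iff_sum]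
  refine ⟨fun i j => by simp, fun i => ?_, fun j => ?_⟩
  · have h := congrFun (congrFun (Matrix.mem_unitaryGroup_iff.1 hV) i) i
    rw [Matrix.mul_apply] at h
    simp only [Matrix.star_apply, Matrix.one_apply_eq, RCLike.star_def, Complex.mul_conj'] at h
    simp only [Matrix.of_apply]
    exact_mod_cast h
  · have h := congrFun (congrFun (Matrix.mem_unitaryGroup_iff'.1 hV) j) j
    rw [Matrix.mul_apply] at h
    simp only [Matrix.star_apply, Matrix.one_apply_eq, RCLike.star_def, Complex.conj_mul'] at h
    simp only [Matrix.of_apply]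
    exact_mod_cast h

/-- By Birkhoff's theorem a linear functional of a doubly stochastic matrix is largest at a
permutation matrix, where the bound is the rearrangement inequality. -/
lemma sum_mul_le_of_doublyStochastic {D : Matrix (Fin p) (Fin p) ℝ}
    (hD : D ∈ doublyStochastic ℝ (Fin p)) {a b : Fin p → ℝ} (ha : Antitone a) (hb : Antitone b) :
    ∑ j, ∑ k, a j * b k * D j k ≤ ∑ k, a k * b k := by
  let f : Matrix (Fin p) (Fin p) ℝ →ₗ[ℝ] ℝ :=
    { toFun := fun D => ∑ j, ∑ k, a j * b k * D j k
      map_add' := by intro x y; simp [mul_add, Finset.sum_add_distrib]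
      map_smul' := by
        intro c x
        simp only [Matrix.smul_apply, smul_eq_mul, RingHom.id_apply, Finset.mul_sum]
        refine Finset.sum_congr rfl fun _ _ => Finset.sum_congr rfl fun _ _ => by ring }
  have hD' : D ∈ convexHull ℝ {x | ∃ σ : Equiv.Perm (Fin p), Equiv.Perm.permMatrix ℝ σ = x} := by
    rw [← doublyStochastic_eq_convexHull_permMatrix]; exact hD
  obtain ⟨y, ⟨σ, rfl⟩, hy⟩ := ConvexOn.exists_ge_of_mem_convexHull
    (f.convexOn (convex_convexHull ℝ
      {x | ∃ σ : Equiv.Perm (Fin p), Equiv.Perm.permMatrix ℝ σ = x})) (subset_convexHull ℝ _) hD'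
  refine hy.trans ?_
  have : f (Equiv.Perm.permMatrix ℝ σ) = ∑ j, a j * b (σ j) := by
    change ∑ j, ∑ k, a j * b k * Equiv.Perm.permMatrix ℝ σ j k = _
    simp [Equiv.Perm.permMatrix, PEquiv.toMatrix_apply]
  rw [this]
  exact (ha.monovary hb).sum_mul_comp_perm_le_sum_mul (σ := σ)

/-- **Hoffman–Wielandt inequality**: the ordered eigenvalues of a Hermitian matrix are
`1`-Lipschitz for the Frobenius norm. -/
lemma sum_sq_eigenvalues_sub_le {W U W' U' : Matrix (Fin p) (Fin p) ℂ} {l l' : Fin p → ℝ}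
    (h : IsOrderedEigendecomposition W U l) (h' : IsOrderedEigendecomposition W' U' l') :
    ∑ k, (l' k - l k) ^ 2 ≤ ((W' - W) * (W' - W)).trace.re := by
  have hV : Uᴴ * U' ∈ Matrix.unitaryGroup (Fin p) ℂ :=
    mul_mem (Unitary.star_mem h.unitary) h'.unitary
  have hmix : (W * W').trace = ((∑ j, ∑ k, l j * l' k * ‖(Uᴴ * U') j k‖ ^ 2 : ℝ) : ℂ) := by
    rw [h.eq_spectralSum, h'.eq_spectralSum]
    rw [spectralSum, spectralSum, Finset.sum_mul_sum]
    simp only [Matrix.trace_sum, Matrix.smul_mul, Matrix.mul_smul, Matrix.trace_smul,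
      trace_eigenProj_mul_eigenProj, Complex.ofReal_sum]
    refine Finset.sum_congr rfl fun _ _ => Finset.sum_congr rfl fun _ _ => ?_
    simp only [Complex.real_smul]; push_cast; ring
  have hW : (W * W).trace = ((∑ k, l k * l k : ℝ) : ℂ) := by
    conv_lhs => rw [h.eq_spectralSum]
    rw [spectralSum_mul_spectralSum h.unitary, trace_spectralSum h.unitary]
  have hW' : (W' * W').trace = ((∑ k, l' k * l' k : ℝ) : ℂ) := by
    conv_lhs => rw [h'.eq_spectralSum]
    rw [spectralSum_mul_spectralSum h'.unitary, trace_spectralSum h'.unitary]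
  have hle := sum_mul_le_of_doublyStochastic (doublyStochastic_normSq hV) h.antitone h'.antitone
  simp only [Matrix.of_apply] at hle
  rw [sub_mul, mul_sub, mul_sub, Matrix.trace_sub, Matrix.trace_sub, Matrix.trace_sub,
    Matrix.trace_mul_comm W' W, hmix, hW, hW', ← Complex.ofReal_sub, ← Complex.ofReal_sub,
    ← Complex.ofReal_sub, Complex.ofReal_re]
  have : ∑ k, (l' k - l k) ^ 2
      = ∑ k, l' k * l' k + ∑ k, l k * l k - 2 * ∑ k, l k * l' k := by
    rw [Finset.mul_sum, ← Finset.sum_add_distrib, ← Finset.sum_sub_distrib]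
    exact Finset.sum_congr rfl fun _ _ => by ring
  rw [this]
  linarith

lemma Matrix.IsHermitian.exists_isOrderedEigendecomposition {W : Matrix (Fin p) (Fin p) ℂ}
    (hW : W.IsHermitian) : ∃ U l, IsOrderedEigendecomposition W U l := by
  let V : Matrix (Fin p) (Fin p) ℂ := hW.eigenvectorUnitary
  have hV : V ∈ Matrix.unitaryGroup (Fin p) ℂ := hW.eigenvectorUnitary.2
  let σ := Tuple.sort (fun k => - hW.eigenvalues k)
  refine ⟨V.submatrix id σ, hW.eigenvalues ∘ σ, ?_, ?_, ?_⟩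
  · rw [Matrix.mem_unitaryGroup_iff']
    have : star (V.submatrix id σ) * V.submatrix id σ = (Vᴴ * V).submatrix σ σ := by
      rw [Matrix.star_eq_conjTranspose, Matrix.conjTranspose_submatrix]
      exact Matrix.submatrix_mul_equiv (e₂ := Equiv.refl _) ..
    rw [this, ← Matrix.star_eq_conjTranspose, Matrix.mem_unitaryGroup_iff'.1 hV]
    exact Matrix.submatrix_one_equiv σ
  · intro i j hij
    have := Tuple.monotone_sort (fun k => - hW.eigenvalues k) hij
    simpa using this
  · have h := hW.spectral_theorem
    have h2 : W = V * realDiag hW.eigenvalues * Vᴴ := h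
    have h3 : realDiag (hW.eigenvalues ∘ σ) = (realDiag hW.eigenvalues).submatrix σ σ := by
      simp only [realDiag]
      rw [Matrix.submatrix_diagonal_equiv]; rfl
    refine h2.trans ?_
    rw [h3, Matrix.conjTranspose_submatrix, Matrix.submatrix_mul_equiv, Matrix.submatrix_mul_equiv]
    simp

end Spectral

/-! ### Differentiability of the spectral data at a simple spectrum -/

section Perturbation

open Filter Topology Asymptotics

/-- Product rule for a bilinear expression whose second factor vanishes at the point: the first
factor need only be continuous. -/
lemma hasFDerivWithinAt_bilinear_of_eq_zero {E F G H : Type*}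
    [NormedAddCommGroup E] [NormedSpace ℝ E] [NormedAddCommGroup F] [NormedSpace ℝ F]
    [NormedAddCommGroup G] [NormedSpace ℝ G] [NormedAddCommGroup H] [NormedSpace ℝ H]
    (B : F →L[ℝ] G →L[ℝ] H) {f : E → F} {g : E → G} {g' : E →L[ℝ] G} {s : Set E} {x : E}
    (hf : ContinuousWithinAt f s x) (hg : HasFDerivWithinAt g g' s x) (hgx : g x = 0) :
    HasFDerivWithinAt (fun y => B (f y) (g y)) ((B (f x)).comp g') s x := by
  have h1 : HasFDerivWithinAt (fun y => B (f x) (g y)) ((B (f x)).comp g') s x :=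
    (B (f x)).hasFDerivAt.comp_hasFDerivWithinAt x hg
  have hgO : g =O[𝓝[s] x] fun y => y - x := by
    have := hg.isBigO_sub
    simpa [hgx] using this
  have h2 : HasFDerivWithinAt (fun y => B (f y - f x) (g y)) (0 : E →L[ℝ] H) s x := by
    refine .of_isLittleO ?_
    simp only [hgx, map_zero, sub_zero, zero_apply]
    have hO : (fun y => B (f y - f x) (g y)) =O[𝓝[s] x] fun y => ‖f y - f x‖ * ‖g y‖ :=
      IsBigO.of_bound ‖B‖ (.of_forall fun y => by
        rw [Real.norm_of_nonneg (by positivity), ← mul_assoc]; exact B.le_opNorm₂ _ _)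
    refine hO.trans_isLittleO ?_
    have ho : (fun y => ‖f y - f x‖) =o[𝓝[s] x] fun _ => (1 : ℝ) := by
      refine (isLittleO_one_iff ℝ).2 ?_
      have := (hf.sub (continuousWithinAt_const (b := f x))).norm
      simpa [ContinuousWithinAt] using this
    simpa using (ho.mul_isBigO hgO.norm_norm).norm_right
  convert h1.add h2 using 1
  · ext y; simp
  · simp

/-- Matrix multiplication as a continuous real-bilinear map. -/
noncomputable def matMul (a b c : ℕ) : Matrix (Fin a) (Fin b) ℂ →L[ℝ]
    Matrix (Fin b) (Fin c) ℂ →L[ℝ] Matrix (Fin a) (Fin c) ℂ :=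
  LinearMap.toContinuousBilinearMap (LinearMap.mk₂ ℝ (fun X Y => X * Y) Matrix.add_mul
    (fun _ _ _ => Matrix.smul_mul _ _ _) Matrix.mul_add fun _ _ _ => Matrix.mul_smul _ _ _)

@[simp] lemma matMul_apply {a b c : ℕ} (X : Matrix (Fin a) (Fin b) ℂ)
    (Y : Matrix (Fin b) (Fin c) ℂ) : matMul a b c X Y = X * Y := rfl

lemma exists_norm_bilinear_le {E F G : Type*}
    [NormedAddCommGroup E] [NormedSpace ℝ E] [NormedAddCommGroup F] [NormedSpace ℝ F]
    [NormedAddCommGroup G] [NormedSpace ℝ G] (B : E →L[ℝ] F →L[ℝ] G) :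
    ∃ C, 0 ≤ C ∧ ∀ x y, ‖B x y‖ ≤ C * ‖x‖ * ‖y‖ :=
  ⟨‖B‖, norm_nonneg B, B.le_opNorm₂⟩

lemma exists_norm_mul_le (a b c : ℕ) : ∃ C, 0 ≤ C ∧ ∀ (X : Matrix (Fin a) (Fin b) ℂ)
    (Y : Matrix (Fin b) (Fin c) ℂ), ‖X * Y‖ ≤ C * ‖X‖ * ‖Y‖ :=
  exists_norm_bilinear_le (matMul a b c)

variable {p : ℕ}

open Classical in
/-- A unitary matrix of eigenvectors of `W`, the eigenvalues being in decreasing order (and `0` if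
`W` is not Hermitian). -/
noncomputable def eigVec (W : Matrix (Fin p) (Fin p) ℂ) : Matrix (Fin p) (Fin p) ℂ :=
  if h : W.IsHermitian then h.exists_isOrderedEigendecomposition.choose else 0

open Classical in
/-- The eigenvalues of the Hermitian matrix `W` in decreasing order (and `0` if `W` is not
Hermitian). -/
noncomputable def eigVal (W : Matrix (Fin p) (Fin p) ℂ) : Fin p → ℝ :=
  if h : W.IsHermitian then h.exists_isOrderedEigendecomposition.choose_spec.choose else 0

lemma Matrix.IsHermitian.isOrderedEigendecomposition {W : Matrix (Fin p) (Fin p) ℂ}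
    (h : W.IsHermitian) : IsOrderedEigendecomposition W (eigVec W) (eigVal W) := by
  rw [eigVec, eigVal, dif_pos h, dif_pos h]
  exact h.exists_isOrderedEigendecomposition.choose_spec.choose_spec

/-- The ordered eigenvalues do not depend on the decomposition. -/
lemma IsOrderedEigendecomposition.eigVal_eq {W U : Matrix (Fin p) (Fin p) ℂ} {l : Fin p → ℝ}
    (h : IsOrderedEigendecomposition W U l) : eigVal W = l := by
  have := sum_sq_eigenvalues_sub_le h h.isHermitian.isOrderedEigendecomposition
  simp only [sub_self, mul_zero, Matrix.trace_zero, Complex.zero_re] at this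
  have h0 := (Finset.sum_eq_zero_iff_of_nonneg (fun k _ => sq_nonneg _)).1
    (le_antisymm this (Finset.sum_nonneg fun k _ => sq_nonneg (eigVal W k - l k)))
  ext k
  simpa [sub_eq_zero] using h0 k (Finset.mem_univ k)

/-- The projection on the eigenspace of the `k`-th eigenvalue. Only for a simple eigenvalue is it
independent of the choice of eigenvectors. -/
noncomputable abbrev specProj (W : Matrix (Fin p) (Fin p) ℂ) (k : Fin p) :
    Matrix (Fin p) (Fin p) ℂ := eigenProj (eigVec W) k

lemma eigenProj_sub_eigenProj {U U' : Matrix (Fin p) (Fin p) ℂ}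
    (hU : U ∈ Matrix.unitaryGroup (Fin p) ℂ) (hU' : U' ∈ Matrix.unitaryGroup (Fin p) ℂ)
    (k : Fin p) : eigenProj U' k - eigenProj U k
      = ∑ j ∈ Finset.univ.erase k,
        (eigenProj U j * eigenProj U' k - eigenProj U k * eigenProj U' j) := by
  have h1 : eigenProj U' k = ∑ j, eigenProj U j * eigenProj U' k := by
    rw [← Finset.sum_mul, sum_eigenProj hU, one_mul]
  have h2 : eigenProj U k = ∑ j, eigenProj U k * eigenProj U' j := by
    rw [← Finset.mul_sum, sum_eigenProj hU', mul_one]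
  conv_lhs => rw [h1, h2]
  rw [← Finset.sum_sub_distrib, ← Finset.add_sum_erase _ _ (Finset.mem_univ k)]
  simp

lemma IsOrderedEigendecomposition.eigenProj_eq {W U U' : Matrix (Fin p) (Fin p) ℂ}
    {l l' : Fin p → ℝ}
    (h : IsOrderedEigendecomposition W U l) (h' : IsOrderedEigendecomposition W U' l')
    (hl : Function.Injective l) : eigenProj U' = eigenProj U := by
  have hll : l' = l := h'.eigVal_eq.symm.trans h.eigVal_eq
  subst hll
  have h0 : ∀ j k, j ≠ k → eigenProj U j * eigenProj U' k = 0 := by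
    intro j k hjk
    have := smul_eigenProj_mul_eigenProj h h' j k
    rw [sub_self, Matrix.mul_zero, Matrix.zero_mul, smul_eq_zero] at this
    exact this.resolve_left (sub_ne_zero.2 fun e => hjk (hl e).symm)
  ext1 k
  rw [← sub_eq_zero, eigenProj_sub_eigenProj h.unitary h'.unitary]
  refine Finset.sum_eq_zero fun j hj => ?_
  rw [h0 j k (Finset.ne_of_mem_erase hj), h0 k j (Finset.ne_of_mem_erase hj).symm, sub_zero]

lemma norm_eigenProj_le {U : Matrix (Fin p) (Fin p) ℂ} (hU : U ∈ Matrix.unitaryGroup (Fin p) ℂ)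
    (k : Fin p) : ‖eigenProj U k‖ ≤ 1 := by
  rw [Matrix.norm_le_iff zero_le_one]
  intro i j
  have : eigenProj U k i j = U i k * star (U j k) := by
    simp [eigenProj, Matrix.mul_apply, Matrix.single_apply, Finset.sum_ite_eq, ite_and]
  rw [this, norm_mul, norm_star]
  exact mul_le_one₀ (entry_norm_bound_of_unitary hU _ _) (norm_nonneg _)
    (entry_norm_bound_of_unitary hU _ _)

/-- Since `W` ranges over Hermitian matrices only, continuity and derivatives are taken within
this set. -/
lemma continuousOn_eigVal :
    ContinuousOn (eigVal : Matrix (Fin p) (Fin p) ℂ → Fin p → ℝ) {W | W.IsHermitian} := by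
  intro W hW
  refine continuousWithinAt_pi.2 fun k => ?_
  rw [ContinuousWithinAt, tendsto_iff_norm_sub_tendsto_zero]
  have hc : Tendsto (fun W' : Matrix (Fin p) (Fin p) ℂ =>
      √(((W' - W) * (W' - W)).trace.re)) (𝓝[{W | W.IsHermitian}] W) (𝓝 0) := by
    have : Continuous fun W' : Matrix (Fin p) (Fin p) ℂ => √(((W' - W) * (W' - W)).trace.re) := by
      fun_prop
    have h := (this.tendsto W).mono_left (nhdsWithin_le_nhds (s := {W | W.IsHermitian}))
    simpa using h
  refine squeeze_zero' (.of_forall fun _ => norm_nonneg _) ?_ hc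
  filter_upwards [self_mem_nhdsWithin] with W' hW'
  refine Real.abs_le_sqrt ?_
  refine le_trans ?_ (sum_sq_eigenvalues_sub_le
    (Matrix.IsHermitian.isOrderedEigendecomposition hW)
    (Matrix.IsHermitian.isOrderedEigendecomposition hW'))
  exact Finset.single_le_sum (f := fun k => (eigVal W' k - eigVal W k) ^ 2)
    (fun _ _ => sq_nonneg _) (Finset.mem_univ k)

variable {W : Matrix (Fin p) (Fin p) ℂ}

lemma continuousWithinAt_specProj (hW : W.IsHermitian) (hl : Function.Injective (eigVal W))
    (k : Fin p) :
    ContinuousWithinAt (fun W' => specProj W' k) {W | W.IsHermitian} W := by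
  set S : Set (Matrix (Fin p) (Fin p) ℂ) := {W | W.IsHermitian}
  obtain ⟨C, hC, hbound⟩ := exists_norm_mul_le p p p
  have key : ∀ i j : Fin p, i ≠ j → Tendsto (fun W' => specProj W i * specProj W' j) (𝓝[S] W)
      (𝓝 0) := by
    intro i j hij
    have h1 : Tendsto (fun W' => (eigVal W' j - eigVal W i)⁻¹) (𝓝[S] W)
        (𝓝 (eigVal W j - eigVal W i)⁻¹) := by
      have := (continuousWithinAt_pi.1 (continuousOn_eigVal W hW) j).sub
        (continuousWithinAt_const (b := eigVal W i))
      exact this.inv₀ (sub_ne_zero.2 fun e => hij (hl e).symm)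
    have h2 : Tendsto (fun W' => specProj W i * (W' - W) * specProj W' j) (𝓝[S] W) (𝓝 0) := by
      have hc : Tendsto (fun W' => C * ‖specProj W i * (W' - W)‖) (𝓝[S] W)
          (𝓝 0) := by
        have : Continuous fun W' => C * ‖specProj W i * (W' - W)‖ := by fun_prop
        have h := (this.tendsto W).mono_left (nhdsWithin_le_nhds (s := S))
        simpa using h
      refine squeeze_zero_norm' ?_ hc
      filter_upwards [self_mem_nhdsWithin] with W' hW'
      refine (hbound (specProj W i * (W' - W)) (specProj W' j)).trans
        (mul_le_of_le_one_right (by positivity) ?_)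
      exact norm_eigenProj_le (Matrix.IsHermitian.isOrderedEigendecomposition hW').unitary j
    have h3 := h1.smul h2
    rw [smul_zero] at h3
    refine h3.congr' ?_
    have hne : ∀ᶠ W' in 𝓝[S] W, eigVal W' j ≠ eigVal W i :=
      (continuousWithinAt_pi.1 (continuousOn_eigVal W hW) j).eventually_ne
        fun e => hij (hl e).symm
    filter_upwards [self_mem_nhdsWithin, hne] with W' hW' hne
    rw [← smul_eigenProj_mul_eigenProj hW.isOrderedEigendecomposition
      (Matrix.IsHermitian.isOrderedEigendecomposition hW') i j, smul_smul,
      inv_mul_cancel₀ (sub_ne_zero.2 hne), one_smul]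
  have h0 : Tendsto (fun W' => ∑ j ∈ Finset.univ.erase k,
      (specProj W j * specProj W' k - specProj W k * specProj W' j)) (𝓝[S] W) (𝓝 0) := by
    have : (0 : Matrix (Fin p) (Fin p) ℂ) = ∑ j ∈ Finset.univ.erase k, (0 - 0) := by simp
    rw [this]
    exact tendsto_finsetSum _ fun j hj => (key j k (Finset.ne_of_mem_erase hj)).sub
      (key k j (Finset.ne_of_mem_erase hj).symm)
  rw [ContinuousWithinAt, ← tendsto_sub_nhds_zero_iff]
  refine h0.congr' ?_
  filter_upwards [self_mem_nhdsWithin] with W' hW'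
  exact (eigenProj_sub_eigenProj hW.isOrderedEigendecomposition.unitary
    (Matrix.IsHermitian.isOrderedEigendecomposition hW').unitary k).symm

/-- The derivative `X ↦ tr (P_k X)` of the `k`-th eigenvalue. -/
noncomputable def eigValDeriv (W : Matrix (Fin p) (Fin p) ℂ) (k : Fin p) :
    Matrix (Fin p) (Fin p) ℂ →L[ℝ] ℝ :=
  Complex.reCLM.comp (((Matrix.traceLinearMap (Fin p) ℝ ℂ).toContinuousLinearMap).comp
    (matMul p p p (specProj W k)))

@[simp] lemma eigValDeriv_apply (W : Matrix (Fin p) (Fin p) ℂ) (k : Fin p)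
    (X : Matrix (Fin p) (Fin p) ℂ) : eigValDeriv W k X = (specProj W k * X).trace.re := rfl

/-- The derivative `X ↦ ∑_{j ≠ k} (P_j X P_k + P_k X P_j) / (ℓ_k - ℓ_j)` of the `k`-th
eigenprojection. -/
noncomputable def specProjDeriv (W : Matrix (Fin p) (Fin p) ℂ) (k : Fin p) :
    Matrix (Fin p) (Fin p) ℂ →L[ℝ] Matrix (Fin p) (Fin p) ℂ :=
  ∑ j ∈ Finset.univ.erase k, ((eigVal W k - eigVal W j)⁻¹ •
      ((matMul p p p).flip (specProj W k)).comp (matMul p p p (specProj W j))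
    - (eigVal W j - eigVal W k)⁻¹ •
      ((matMul p p p).flip (specProj W j)).comp (matMul p p p (specProj W k)))

lemma hasFDerivWithinAt_specProj_mul (hW : W.IsHermitian) (hl : Function.Injective (eigVal W))
    (i k : Fin p) :
    HasFDerivWithinAt (fun W' => specProj W i * (W' - W) * specProj W' k)
      (((matMul p p p).flip (specProj W k)).comp (matMul p p p (specProj W i)))
      {W | W.IsHermitian} W := by
  have h : HasFDerivWithinAt (fun W' => specProj W i * (W' - W)) (matMul p p p (specProj W i))
      {W | W.IsHermitian} W :=
    ((matMul p p p (specProj W i)).hasFDerivAt.comp W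
      ((hasFDerivAt_id W).sub_const W)).hasFDerivWithinAt
  exact hasFDerivWithinAt_bilinear_of_eq_zero (matMul p p p).flip
    (continuousWithinAt_specProj hW hl k) h (by simp)

lemma hasFDerivWithinAt_specProj (hW : W.IsHermitian) (hl : Function.Injective (eigVal W))
    (k : Fin p) :
    HasFDerivWithinAt (fun W' => specProj W' k) (specProjDeriv W k) {W | W.IsHermitian} W := by
  set S : Set (Matrix (Fin p) (Fin p) ℂ) := {W | W.IsHermitian}
  have key : ∀ i j : Fin p, i ≠ j → HasFDerivWithinAt (fun W' => specProj W i * specProj W' j)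
      ((eigVal W j - eigVal W i)⁻¹ •
        ((matMul p p p).flip (specProj W j)).comp (matMul p p p (specProj W i))) S W := by
    intro i j hij
    have h1 : ContinuousWithinAt (fun W' => (eigVal W' j - eigVal W i)⁻¹) S W := by
      have := (continuousWithinAt_pi.1 (continuousOn_eigVal W hW) j).sub
        (continuousWithinAt_const (b := eigVal W i))
      exact this.inv₀ (sub_ne_zero.2 fun e => hij (hl e).symm)
    have h3 := hasFDerivWithinAt_bilinear_of_eq_zero (ContinuousLinearMap.lsmul ℝ ℝ) h1
      (hasFDerivWithinAt_specProj_mul hW hl i j) (by simp)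
    have hne : ∀ᶠ W' in 𝓝[S] W, eigVal W' j ≠ eigVal W i :=
      (continuousWithinAt_pi.1 (continuousOn_eigVal W hW) j).eventually_ne
        fun e => hij (hl e).symm
    have hev : ∀ W' ∈ S, eigVal W' j ≠ eigVal W i → specProj W i * specProj W' j
        = (eigVal W' j - eigVal W i)⁻¹ • (specProj W i * (W' - W) * specProj W' j) := by
      intro W' hW' hne
      rw [← smul_eigenProj_mul_eigenProj hW.isOrderedEigendecomposition
        (Matrix.IsHermitian.isOrderedEigendecomposition hW') i j, smul_smul,
        inv_mul_cancel₀ (sub_ne_zero.2 hne), one_smul]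
    refine h3.congr_of_eventuallyEq ?_ (hev W hW fun e => hij (hl e).symm)
    filter_upwards [self_mem_nhdsWithin, hne] with W' hW' hne
    exact hev W' hW' hne
  have hsum : HasFDerivWithinAt (fun W' => specProj W k + ∑ j ∈ Finset.univ.erase k,
      (specProj W j * specProj W' k - specProj W k * specProj W' j)) (specProjDeriv W k) S W := by
    refine HasFDerivWithinAt.const_add _ (HasFDerivWithinAt.fun_sum fun j hj => ?_)
    exact (key j k (Finset.ne_of_mem_erase hj)).sub (key k j (Finset.ne_of_mem_erase hj).symm)
  have hev : ∀ W' ∈ S, specProj W' k = specProj W k + ∑ j ∈ Finset.univ.erase k,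
      (specProj W j * specProj W' k - specProj W k * specProj W' j) := by
    intro W' hW'
    rw [← eigenProj_sub_eigenProj hW.isOrderedEigendecomposition.unitary
      (Matrix.IsHermitian.isOrderedEigendecomposition hW').unitary k]
    abel
  exact hsum.congr hev (hev W hW)

lemma hasFDerivWithinAt_eigVal (hW : W.IsHermitian) (hl : Function.Injective (eigVal W))
    (k : Fin p) :
    HasFDerivWithinAt (fun W' => eigVal W' k) (eigValDeriv W k) {W | W.IsHermitian} W := by
  set S : Set (Matrix (Fin p) (Fin p) ℂ) := {W | W.IsHermitian}
  let τ : Matrix (Fin p) (Fin p) ℂ →L[ℝ] ℝ :=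
    Complex.reCLM.comp (Matrix.traceLinearMap (Fin p) ℝ ℂ).toContinuousLinearMap
  have hu := hW.isOrderedEigendecomposition.unitary
  have h1 : HasFDerivWithinAt (fun W' => τ (specProj W k * (W' - W) * specProj W' k))
      (τ.comp (((matMul p p p).flip (specProj W k)).comp (matMul p p p (specProj W k)))) S W :=
    τ.hasFDerivAt.comp_hasFDerivWithinAt W (hasFDerivWithinAt_specProj_mul hW hl k k)
  -- The overlap `tr (P_k P'_k)` tends to `1`, so one may divide by it.
  have hone : τ (specProj W k * specProj W k) = 1 := by
    change (specProj W k * specProj W k).trace.re = 1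
    rw [eigenProj_mul hu, if_pos rfl, trace_eigenProj hu]; simp
  have hcont : ContinuousWithinAt (fun W' => τ (specProj W k * specProj W' k)) S W :=
    (τ.comp (matMul p p p (specProj W k))).continuous.continuousAt.comp_continuousWithinAt
      (continuousWithinAt_specProj hW hl k)
  have h2 : ContinuousWithinAt (fun W' => (τ (specProj W k * specProj W' k))⁻¹) S W :=
    hcont.inv₀ (by rw [hone]; exact one_ne_zero)
  have h3 := hasFDerivWithinAt_bilinear_of_eq_zero (ContinuousLinearMap.lsmul ℝ ℝ) h2 h1 (by simp)
  have hne : ∀ᶠ W' in 𝓝[S] W, τ (specProj W k * specProj W' k) ≠ 0 :=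
    hcont.eventually_ne (by simp only [hone]; exact one_ne_zero)
  have h4 := h3.const_add (eigVal W k)
  have hev : ∀ W' ∈ S, τ (specProj W k * specProj W' k) ≠ 0 → eigVal W' k = eigVal W k +
      (τ (specProj W k * specProj W' k))⁻¹ • τ (specProj W k * (W' - W) * specProj W' k) := by
    intro W' hW' hne
    rw [← smul_eigenProj_mul_eigenProj hW.isOrderedEigendecomposition
      (Matrix.IsHermitian.isOrderedEigendecomposition hW') k k, map_smul, smul_eq_mul, smul_eq_mul,
      mul_comm (eigVal W' k - eigVal W k), inv_mul_cancel_left₀ hne]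
    ring
  have hd : (ContinuousLinearMap.lsmul ℝ ℝ (τ (specProj W k * specProj W k))⁻¹).comp
      (τ.comp (((matMul p p p).flip (specProj W k)).comp (matMul p p p (specProj W k))))
      = eigValDeriv W k := by
    ext X
    rw [hone]
    simp only [ContinuousLinearMap.comp_apply, ContinuousLinearMap.lsmul_apply,
      eigValDeriv_apply, inv_one, one_smul]
    change (specProj W k * X * specProj W k).trace.re = _
    rw [Matrix.trace_mul_comm, ← Matrix.mul_assoc, eigenProj_mul hu, if_pos rfl]
  rw [← hd]
  refine h4.congr_of_eventuallyEq ?_ (hev W hW (by rw [hone]; exact one_ne_zero))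
  filter_upwards [self_mem_nhdsWithin, hne] with W' hW' hne
  exact hev W' hW' hne

end Perturbation

/-! ### Traces of real-linear maps of complex matrices -/

section RealTrace

variable {m p : ℕ}

lemma trace_real_matrix_eq_sum
    (T : Matrix (Fin m) (Fin p) ℂ →ₗ[ℝ] Matrix (Fin m) (Fin p) ℂ) :
    LinearMap.trace ℝ _ T = ∑ i, ∑ j, ((T (Matrix.single i j 1) i j).re
      + (T (Matrix.single i j Complex.I) i j).im) := by
  rw [LinearMap.trace_eq_matrix_trace ℝ
    (Complex.basisOneI.smulTower (Matrix.stdBasis ℂ (Fin m) (Fin p))), Matrix.trace,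
    Fintype.sum_prod_type, Fin.sum_univ_two, Fintype.sum_prod_type, Fintype.sum_prod_type,
    ← Finset.sum_add_distrib]
  refine Finset.sum_congr rfl fun i _ => ?_
  rw [← Finset.sum_add_distrib]
  refine Finset.sum_congr rfl fun j _ => ?_
  have hrepr : ∀ (X : Matrix (Fin m) (Fin p) ℂ),
      (Matrix.stdBasis ℂ (Fin m) (Fin p)).repr X (i, j) = X i j := fun X => rfl
  simp [LinearMap.toMatrix_apply, Module.Basis.smulTower_repr, Module.Basis.smulTower_apply,
    Matrix.stdBasis_eq_single, hrepr]

/-- The real trace of a map of complex matrices. The defining sum makes sense for an arbitrary map,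
so that it can be evaluated term by term on an explicit formula. -/
noncomputable def realTrace (T : Matrix (Fin m) (Fin p) ℂ → Matrix (Fin m) (Fin p) ℂ) : ℝ :=
  ∑ i, ∑ j, ((T (Matrix.single i j 1) i j).re + (T (Matrix.single i j Complex.I) i j).im)

lemma realTrace_add (S T : Matrix (Fin m) (Fin p) ℂ → Matrix (Fin m) (Fin p) ℂ) :
    realTrace (fun X => S X + T X) = realTrace S + realTrace T := by
  simp only [realTrace, ← Finset.sum_add_distrib]
  refine Finset.sum_congr rfl fun _ _ => Finset.sum_congr rfl fun _ _ => ?_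
  simp only [Matrix.add_apply, Complex.add_re, Complex.add_im]
  ring

lemma realTrace_smul (c : ℝ) (T : Matrix (Fin m) (Fin p) ℂ → Matrix (Fin m) (Fin p) ℂ) :
    realTrace (fun X => c • T X) = c * realTrace T := by
  simp only [realTrace, Finset.mul_sum]
  refine Finset.sum_congr rfl fun _ _ => Finset.sum_congr rfl fun _ _ => ?_
  simp only [Matrix.smul_apply, Complex.smul_re, Complex.smul_im, smul_eq_mul]
  ring

lemma realTrace_sub (S T : Matrix (Fin m) (Fin p) ℂ → Matrix (Fin m) (Fin p) ℂ) :
    realTrace (fun X => S X - T X) = realTrace S - realTrace T := by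
  simp only [realTrace, ← Finset.sum_sub_distrib]
  refine Finset.sum_congr rfl fun _ _ => Finset.sum_congr rfl fun _ _ => ?_
  simp only [Matrix.sub_apply, Complex.sub_re, Complex.sub_im]
  ring

lemma realTrace_sum {ι : Type*} (s : Finset ι)
    (T : ι → Matrix (Fin m) (Fin p) ℂ → Matrix (Fin m) (Fin p) ℂ) :
    realTrace (fun X => ∑ k ∈ s, T k X) = ∑ k ∈ s, realTrace (T k) := by
  classical
  induction s using Finset.induction_on with
  | empty => simp [realTrace]
  | insert a s ha ih =>
    simp only [Finset.sum_insert ha]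
    rw [realTrace_add, ih]

/-- The real trace of `X ↦ A X B` is `2 Re (tr A tr B)`. -/
lemma realTrace_mul_mul (A : Matrix (Fin m) (Fin m) ℂ) (B : Matrix (Fin p) (Fin p) ℂ) :
    realTrace (fun X : Matrix (Fin m) (Fin p) ℂ => A * X * B) = 2 * (A.trace * B.trace).re := by
  have h : ∀ i j (c : ℂ), (A * Matrix.single i j c * B) i j = A i i * c * B j j := by
    intro i j c
    simp [Matrix.mul_apply, Matrix.single_apply, ite_and]
  rw [realTrace, Matrix.trace, Matrix.trace, Finset.sum_mul_sum, Complex.re_sum, Finset.mul_sum]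
  refine Finset.sum_congr rfl fun i _ => ?_
  rw [Complex.re_sum, Finset.mul_sum]
  refine Finset.sum_congr rfl fun j _ => ?_
  rw [h, h]
  simp
  ring

/-- A conjugate-linear map such as `X ↦ A X* B` has real trace zero. -/
lemma realTrace_mul_conjTranspose_mul (A B : Matrix (Fin m) (Fin p) ℂ) :
    realTrace (fun X : Matrix (Fin m) (Fin p) ℂ => A * Xᴴ * B) = 0 := by
  have h : ∀ i j (c : ℂ), (A * (Matrix.single i j c)ᴴ * B) i j = A i j * star c * B i j := by
    intro i j c
    simp [Matrix.mul_apply, Matrix.single_apply, ite_and]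
  rw [realTrace]
  refine Finset.sum_eq_zero fun i _ => Finset.sum_eq_zero fun j _ => ?_
  rw [h, h]
  simp

lemma realTrace_apply_smul (f : Matrix (Fin m) (Fin p) ℂ →ₗ[ℝ] ℝ) (C : Matrix (Fin m) (Fin p) ℂ) :
    realTrace (fun X => f X • C) = f C := by
  have h := trace_real_matrix_eq_sum (f.smulRight C)
  rw [LinearMap.trace_smulRight] at h
  rw [h]
  rfl

end RealTrace

/-! ### Unitarily invariant fields and their divergence -/

section Field

open Filter Topology

variable {m p : ℕ}

/-- The ordered eigenvalues of `Z* Z`. -/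
noncomputable def gramEig (Z : Matrix (Fin m) (Fin p) ℂ) : Fin p → ℝ := eigVal (Zᴴ * Z)

/-- The eigenprojections of `Z* Z`. -/
noncomputable def gramProj (Z : Matrix (Fin m) (Fin p) ℂ) (k : Fin p) :
    Matrix (Fin p) (Fin p) ℂ := specProj (Zᴴ * Z) k

/-- The matrices `Z` for which the eigenvalues of `Z* Z` are distinct and positive. -/
def regularSet (m p : ℕ) : Set (Matrix (Fin m) (Fin p) ℂ) :=
  {Z | gramEig Z ∈ strictlyOrderedPositive p}

/-- The vector field `Z ↦ Z U H(L) U*`. -/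
noncomputable def invariantField (h : Fin p → (Fin p → ℝ) → ℝ) (Z : Matrix (Fin m) (Fin p) ℂ) :
    Matrix (Fin m) (Fin p) ℂ := Z * ∑ k, h k (gramEig Z) • gramProj Z k

/-- The divergence of `invariantField h` as a function of the eigenvalues. -/
noncomputable def fieldDivergence (m : ℕ) (h : Fin p → (Fin p → ℝ) → ℝ) (l : Fin p → ℝ) : ℝ :=
  ∑ k, (2 * ((m : ℝ) - p + 1) * h k l + 2 * l k * partialDeriv (h k) k l
    + 4 * ∑ b ∈ Finset.Ioi k, (l k * h k l - l b * h b l) / (l k - l b))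

/-- The real inner product `Re tr (X* Y)` of matrices. -/
noncomputable def reInner (X Y : Matrix (Fin m) (Fin p) ℂ) : ℝ := (Xᴴ * Y).trace.re

lemma gram_isOrderedEigendecomposition (Z : Matrix (Fin m) (Fin p) ℂ) :
    IsOrderedEigendecomposition (Zᴴ * Z) (eigVec (Zᴴ * Z)) (gramEig Z) :=
  (Matrix.isHermitian_conjTranspose_mul_self Z).isOrderedEigendecomposition

lemma isOpen_strictlyOrderedPositive : IsOpen (strictlyOrderedPositive p) := by
  have : strictlyOrderedPositive p = (⋂ i, ⋂ j, {l : Fin p → ℝ | i < j → l j < l i})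
      ∩ ⋂ k, {l : Fin p → ℝ | 0 < l k} := by
    ext l
    simp only [strictlyOrderedPositive, StrictAnti, Set.mem_ofPred_eq, Set.mem_inter_iff,
      Set.mem_iInter]
  rw [this]
  refine IsOpen.inter (isOpen_iInter_of_finite fun i => isOpen_iInter_of_finite fun j => ?_)
    (isOpen_iInter_of_finite fun k => isOpen_lt continuous_const (continuous_apply k))
  by_cases hij : i < j
  · simpa [hij] using isOpen_lt (continuous_apply j) (continuous_apply i)
  · simp [hij]

lemma continuous_gramEig :
    Continuous (gramEig : Matrix (Fin m) (Fin p) ℂ → Fin p → ℝ) := by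
  have hg : Continuous fun Z : Matrix (Fin m) (Fin p) ℂ => Zᴴ * Z := by fun_prop
  exact continuousOn_eigVal.comp_continuous hg fun Z =>
    Matrix.isHermitian_conjTranspose_mul_self Z

lemma isOpen_regularSet : IsOpen (regularSet m p) :=
  isOpen_strictlyOrderedPositive.preimage continuous_gramEig

lemma gramEig_injective {Z : Matrix (Fin m) (Fin p) ℂ} (hZ : Z ∈ regularSet m p) :
    Function.Injective (eigVal (Zᴴ * Z)) := hZ.1.injective

/-- Conjugate transposition as a continuous real-linear map. -/
noncomputable def conjTransposeCLM (m p : ℕ) :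
    Matrix (Fin m) (Fin p) ℂ →L[ℝ] Matrix (Fin p) (Fin m) ℂ :=
  LinearMap.toContinuousLinearMap
    { toFun := fun X => Xᴴ
      map_add' := Matrix.conjTranspose_add
      map_smul' := fun c X => by simp [Matrix.conjTranspose_smul] }

@[simp] lemma conjTransposeCLM_apply (X : Matrix (Fin m) (Fin p) ℂ) :
    conjTransposeCLM m p X = Xᴴ := rfl

/-- The derivative `X ↦ X* Z + Z* X` of `Z ↦ Z* Z`. -/
noncomputable def gramDeriv (Z : Matrix (Fin m) (Fin p) ℂ) :
    Matrix (Fin m) (Fin p) ℂ →L[ℝ] Matrix (Fin p) (Fin p) ℂ :=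
  LinearMap.toContinuousLinearMap
    { toFun := fun X => Xᴴ * Z + Zᴴ * X
      map_add' := fun X Y => by
        rw [Matrix.conjTranspose_add, Matrix.add_mul, Matrix.mul_add]; abel
      map_smul' := fun c X => by simp [Matrix.conjTranspose_smul] }

@[simp] lemma gramDeriv_apply (Z X : Matrix (Fin m) (Fin p) ℂ) :
    gramDeriv Z X = Xᴴ * Z + Zᴴ * X := rfl

lemma hasFDerivAt_gram (Z : Matrix (Fin m) (Fin p) ℂ) :
    HasFDerivAt (fun Z : Matrix (Fin m) (Fin p) ℂ => Zᴴ * Z) (gramDeriv Z) Z := by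
  have h := (matMul p m p).hasFDerivAt_of_bilinear
    (conjTransposeCLM m p).hasFDerivAt (hasFDerivAt_id Z)
  refine h.congr_fderiv ?_
  ext1 X
  exact add_comm _ _

/-- The derivative `X ↦ 2 Re tr (P_k Z* X)` of the `k`-th eigenvalue of `Z* Z`. -/
noncomputable def gramEigDeriv (Z : Matrix (Fin m) (Fin p) ℂ) (k : Fin p) :
    Matrix (Fin m) (Fin p) ℂ →L[ℝ] ℝ := (eigValDeriv (Zᴴ * Z) k).comp (gramDeriv Z)

lemma gramProj_conjTranspose (Z : Matrix (Fin m) (Fin p) ℂ) (k : Fin p) :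
    (gramProj Z k)ᴴ = gramProj Z k := eigenProj_conjTranspose _ _

lemma gramEigDeriv_apply (Z X : Matrix (Fin m) (Fin p) ℂ) (k : Fin p) :
    gramEigDeriv Z k X = 2 * (gramProj Z k * Zᴴ * X).trace.re := by
  change (gramProj Z k * (Xᴴ * Z + Zᴴ * X)).trace.re = _
  have h : (gramProj Z k * (Xᴴ * Z)).trace = star (gramProj Z k * Zᴴ * X).trace := by
    rw [← Matrix.trace_conjTranspose, Matrix.conjTranspose_mul, Matrix.conjTranspose_mul,
      Matrix.conjTranspose_conjTranspose, gramProj_conjTranspose, Matrix.trace_mul_comm,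
      Matrix.mul_assoc]
  rw [Matrix.mul_add, Matrix.trace_add, h, ← Matrix.mul_assoc]
  simp
  ring

lemma hasFDerivAt_gramEig {Z : Matrix (Fin m) (Fin p) ℂ} (hZ : Z ∈ regularSet m p) :
    HasFDerivAt gramEig (ContinuousLinearMap.pi (gramEigDeriv Z)) Z := by
  refine hasFDerivAt_pi.2 fun k => ?_
  have := (hasFDerivWithinAt_eigVal (Matrix.isHermitian_conjTranspose_mul_self Z)
    (gramEig_injective hZ) k).comp (f := fun Z : Matrix (Fin m) (Fin p) ℂ => Zᴴ * Z)
    (s := Set.univ) Z (hasFDerivAt_gram Z).hasFDerivWithinAt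
    fun Y _ => Matrix.isHermitian_conjTranspose_mul_self Y
  exact hasFDerivWithinAt_univ.1 this

lemma hasFDerivAt_gramProj {Z : Matrix (Fin m) (Fin p) ℂ} (hZ : Z ∈ regularSet m p)
    (k : Fin p) : HasFDerivAt (fun Z => gramProj Z k)
      ((specProjDeriv (Zᴴ * Z) k).comp (gramDeriv Z)) Z := by
  have := (hasFDerivWithinAt_specProj (Matrix.isHermitian_conjTranspose_mul_self Z)
    (gramEig_injective hZ) k).comp (f := fun Z : Matrix (Fin m) (Fin p) ℂ => Zᴴ * Z)
    (s := Set.univ) Z (hasFDerivAt_gram Z).hasFDerivWithinAt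
    fun Y _ => Matrix.isHermitian_conjTranspose_mul_self Y
  exact hasFDerivWithinAt_univ.1 this

lemma fderiv_eq_sum_partialDeriv {f : (Fin p → ℝ) → ℝ} {l : Fin p → ℝ}
    (hf : DifferentiableAt ℝ f l) (v : Fin p → ℝ) :
    fderiv ℝ f l v = ∑ i, v i * partialDeriv f i l := by
  conv_lhs => rw [pi_eq_sum_univ' v]
  rw [map_sum]
  refine Finset.sum_congr rfl fun i _ => ?_
  rw [map_smul, partialDeriv, hf.lineDeriv_eq_fderiv, smul_eq_mul]

lemma gram_mul_gramProj (Z : Matrix (Fin m) (Fin p) ℂ) (k : Fin p) :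
    Zᴴ * Z * gramProj Z k = gramEig Z k • gramProj Z k := by
  conv_lhs => rw [(gram_isOrderedEigendecomposition Z).eq_spectralSum]
  exact spectralSum_mul_eigenProj (gram_isOrderedEigendecomposition Z).unitary _ _

lemma gramProj_mul (Z : Matrix (Fin m) (Fin p) ℂ) (j k : Fin p) :
    gramProj Z j * gramProj Z k = if j = k then gramProj Z k else 0 :=
  eigenProj_mul (gram_isOrderedEigendecomposition Z).unitary j k

lemma trace_gramProj (Z : Matrix (Fin m) (Fin p) ℂ) (k : Fin p) :
    (gramProj Z k).trace = 1 := trace_eigenProj (gram_isOrderedEigendecomposition Z).unitary k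

lemma trace_mul_gramProj_mul (Z : Matrix (Fin m) (Fin p) ℂ) (k : Fin p) :
    (Z * gramProj Z k * Zᴴ).trace = gramEig Z k := by
  rw [Matrix.trace_mul_comm, ← Matrix.mul_assoc, gram_mul_gramProj, Matrix.trace_smul,
    trace_gramProj]
  simp

lemma gramEigDeriv_mul_gramProj (Z : Matrix (Fin m) (Fin p) ℂ) (i k : Fin p) :
    gramEigDeriv Z i (Z * gramProj Z k) = if i = k then 2 * gramEig Z k else 0 := by
  rw [gramEigDeriv_apply, Matrix.mul_assoc, ← Matrix.mul_assoc Zᴴ, gram_mul_gramProj,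
    Matrix.mul_smul, gramProj_mul]
  split_ifs with h
  · simp [trace_gramProj]
  · simp

lemma gramEigDeriv_invariantField (h : Fin p → (Fin p → ℝ) → ℝ) (Z : Matrix (Fin m) (Fin p) ℂ)
    (k : Fin p) :
    gramEigDeriv Z k (invariantField h Z) = 2 * gramEig Z k * h k (gramEig Z) := by
  rw [invariantField, Matrix.mul_sum, map_sum]
  simp only [Matrix.mul_smul, map_smul, gramEigDeriv_mul_gramProj]
  simp
  ring

/-- The field with `h_k = 2 ∂_k f` is the gradient of the invariant function `f(L)`. -/
lemma reInner_invariantField (h : Fin p → (Fin p → ℝ) → ℝ) (Z X : Matrix (Fin m) (Fin p) ℂ) :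
    reInner (invariantField h Z) X = ∑ k, h k (gramEig Z) * (gramEigDeriv Z k X / 2) := by
  rw [reInner, invariantField, Matrix.conjTranspose_mul, Matrix.conjTranspose_sum,
    Matrix.sum_mul, Matrix.sum_mul, Matrix.trace_sum, Complex.re_sum]
  refine Finset.sum_congr rfl fun k _ => ?_
  rw [gramEigDeriv_apply, Matrix.conjTranspose_smul, gramProj_conjTranspose]
  simp

lemma reInner_invariantField_self (h : Fin p → (Fin p → ℝ) → ℝ) (Z : Matrix (Fin m) (Fin p) ℂ) :
    reInner (invariantField h Z) (invariantField h Z)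
      = ∑ k, gramEig Z k * h k (gramEig Z) ^ 2 := by
  rw [reInner_invariantField]
  refine Finset.sum_congr rfl fun k _ => ?_
  rw [gramEigDeriv_invariantField]
  ring

lemma clm_sum_apply {ι E F : Type*} [NormedAddCommGroup E] [NormedSpace ℝ E]
    [NormedAddCommGroup F] [NormedSpace ℝ F] (s : Finset ι) (f : ι → E →L[ℝ] F) (x : E) :
    (∑ i ∈ s, f i) x = ∑ i ∈ s, f i x := by simp

lemma exists_hasFDerivAt_sum_smul {ι E F : Type*} [Fintype ι]
    [NormedAddCommGroup E] [NormedSpace ℝ E] [NormedAddCommGroup F] [NormedSpace ℝ F]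
    {a : ι → E → ℝ} {a' : ι → E →L[ℝ] ℝ} {Q : ι → E → F} {Q' : ι → E →L[ℝ] F} {x : E}
    (ha : ∀ k, HasFDerivAt (a k) (a' k) x) (hQ : ∀ k, HasFDerivAt (Q k) (Q' k) x) :
    ∃ T : E →L[ℝ] F, HasFDerivAt (fun y => ∑ k, a k y • Q k y) T x ∧
      ∀ X, T X = ∑ k, (a k x • Q' k X + a' k X • Q k x) :=
  ⟨_, HasFDerivAt.fun_sum fun k _ => (ha k).smul (hQ k), fun X => by simp⟩

lemma exists_hasFDerivAt_bilinear {E F G H : Type*}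
    [NormedAddCommGroup E] [NormedSpace ℝ E] [NormedAddCommGroup F] [NormedSpace ℝ F]
    [NormedAddCommGroup G] [NormedSpace ℝ G] [NormedAddCommGroup H] [NormedSpace ℝ H]
    (B : F →L[ℝ] G →L[ℝ] H) {f : E → F} {g : E → G} {f' : E →L[ℝ] F} {g' : E →L[ℝ] G} {x : E}
    (hf : HasFDerivAt f f' x) (hg : HasFDerivAt g g' x) :
    ∃ T : E →L[ℝ] H, HasFDerivAt (fun y => B (f y) (g y)) T x ∧
      ∀ X, T X = B (f' X) (g x) + B (f x) (g' X) :=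
  ⟨_, B.hasFDerivAt_of_bilinear hf hg, fun X => by simp [add_comm]⟩

lemma specProjDeriv_apply (W X : Matrix (Fin p) (Fin p) ℂ) (k : Fin p) :
    specProjDeriv W k X = ∑ j ∈ Finset.univ.erase k,
      ((eigVal W k - eigVal W j)⁻¹ • (specProj W j * X * specProj W k)
      - (eigVal W j - eigVal W k)⁻¹ • (specProj W k * X * specProj W j)) := by
  exact clm_sum_apply _ _ _

lemma exists_hasFDerivAt_invariantField {h : Fin p → (Fin p → ℝ) → ℝ}
    {Z : Matrix (Fin m) (Fin p) ℂ}
    (hZ : Z ∈ regularSet m p) (hh : ∀ k, DifferentiableAt ℝ (h k) (gramEig Z)) :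
    ∃ T : Matrix (Fin m) (Fin p) ℂ →L[ℝ] Matrix (Fin m) (Fin p) ℂ,
      HasFDerivAt (invariantField h) T Z ∧
      ∀ X, T X = X * (∑ k, h k (gramEig Z) • gramProj Z k) + Z *
        ∑ k, (h k (gramEig Z) • specProjDeriv (Zᴴ * Z) k (Xᴴ * Z + Zᴴ * X) +
        (∑ i, gramEigDeriv Z i X * partialDeriv (h k) i (gramEig Z)) • gramProj Z k) := by
  obtain ⟨S, hS, hS'⟩ := exists_hasFDerivAt_sum_smul
    (fun k => (hh k).hasFDerivAt.comp Z (hasFDerivAt_gramEig hZ))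
    (fun k => hasFDerivAt_gramProj hZ k)
  obtain ⟨T, hT, hT'⟩ := exists_hasFDerivAt_bilinear (matMul m p p) (hasFDerivAt_id Z) hS
  refine ⟨T, hT, fun X => (hT' X).trans ?_⟩
  refine congrArg₂ (· + ·) rfl (congrArg (Z * ·) ((hS' X).trans ?_))
  refine Finset.sum_congr rfl fun k _ => congrArg₂ (· + ·) rfl (congrArg (· • _) ?_)
  exact fderiv_eq_sum_partialDeriv (hh k) _

/-- The divergence of the field `Z ↦ Z U H(L) U*`, before symmetrization. -/
lemma realTrace_fderiv_invariantField {h : Fin p → (Fin p → ℝ) → ℝ}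
    {Z : Matrix (Fin m) (Fin p) ℂ} {T : Matrix (Fin m) (Fin p) ℂ → Matrix (Fin m) (Fin p) ℂ}
    (hT : ∀ X, T X = X * (∑ k, h k (gramEig Z) • gramProj Z k) + Z *
        ∑ k, (h k (gramEig Z) • specProjDeriv (Zᴴ * Z) k (Xᴴ * Z + Zᴴ * X) +
        (∑ i, gramEigDeriv Z i X * partialDeriv (h k) i (gramEig Z)) • gramProj Z k)) :
    realTrace T = 2 * m * ∑ k, h k (gramEig Z)
      + ∑ k, (∑ j ∈ Finset.univ.erase k, 2 * h k (gramEig Z) * (gramEig Z j + gramEig Z k)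
          / (gramEig Z k - gramEig Z j)
        + 2 * gramEig Z k * partialDeriv (h k) k (gramEig Z)) := by
  have hexp : T = fun X : Matrix (Fin m) (Fin p) ℂ => (1 : Matrix (Fin m) (Fin m) ℂ) * X *
        (∑ k, h k (gramEig Z) • gramProj Z k)
      + ∑ k, (h k (gramEig Z) • (∑ j ∈ Finset.univ.erase k,
        ((gramEig Z k - gramEig Z j)⁻¹ • (Z * gramProj Z j * Xᴴ * (Z * gramProj Z k)
            + (Z * gramProj Z j * Zᴴ) * X * gramProj Z k)
        - (gramEig Z j - gramEig Z k)⁻¹ • (Z * gramProj Z k * Xᴴ * (Z * gramProj Z j)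
            + (Z * gramProj Z k * Zᴴ) * X * gramProj Z j)))
        + ∑ i, partialDeriv (h k) i (gramEig Z) •
            (gramEigDeriv Z i X • (Z * gramProj Z k))) := by
    funext X
    rw [hT, Matrix.one_mul]
    refine congrArg₂ (· + ·) rfl ((Matrix.mul_sum _ _ _).trans (Finset.sum_congr rfl fun k _ => ?_))
    rw [Matrix.mul_add, Matrix.mul_smul, Matrix.mul_smul, specProjDeriv_apply, Matrix.mul_sum]
    refine congrArg₂ (· + ·) (congrArg _ (Finset.sum_congr rfl fun j _ => ?_)) ?_
    · rw [Matrix.mul_sub, Matrix.mul_smul, Matrix.mul_smul]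
      change _ • (Z * (gramProj Z j * _ * gramProj Z k)) -
        _ • (Z * (gramProj Z k * _ * gramProj Z j)) = _
      simp only [Matrix.mul_add, Matrix.add_mul, Matrix.mul_assoc]
      rfl
    · rw [Finset.sum_smul]
      refine Finset.sum_congr rfl fun i _ => ?_
      rw [smul_smul, mul_comm]
  have htr : ∀ j, ((Z * gramProj Z j * Zᴴ).trace * (1 : ℂ)).re = gramEig Z j := by
    intro j; rw [trace_mul_gramProj_mul]; simp
  rw [hexp]
  simp only [realTrace_add, realTrace_sum, realTrace_smul, realTrace_sub,
    realTrace_mul_conjTranspose_mul, realTrace_mul_mul, trace_gramProj, htr]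
  congr 1
  · simp only [Matrix.trace_one, Matrix.trace_sum, Matrix.trace_smul, trace_gramProj,
      Fintype.card_fin]
    have : (∑ k, h k (gramEig Z) • (1 : ℂ)) = ((∑ k, h k (gramEig Z) : ℝ) : ℂ) := by simp
    rw [this, ← Complex.ofReal_natCast, ← Complex.ofReal_mul, Complex.ofReal_re]
    ring
  · refine Finset.sum_congr rfl fun k _ => congrArg₂ (· + ·) ?_ ?_
    · rw [Finset.mul_sum]
      refine Finset.sum_congr rfl fun j _ => ?_
      rw [← neg_sub (gramEig Z k), inv_neg]
      ring
    · have : ∀ i, realTrace (fun X => gramEigDeriv Z i X • (Z * gramProj Z k))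
          = if i = k then 2 * gramEig Z k else 0 := fun i =>
        (realTrace_apply_smul (gramEigDeriv Z i).toLinearMap _).trans
          (gramEigDeriv_mul_gramProj Z i k)
      simp only [this]
      simp
      ring

lemma sum_sum_erase_eq {n : ℕ} (f : Fin n → Fin n → ℝ) :
    ∑ k, ∑ j ∈ Finset.univ.erase k, f k j = ∑ k, ∑ b ∈ Finset.Ioi k, (f k b + f b k) := by
  have h := Finset.sum_sum_Ioi_add_eq_sum_sum_off_diag (fun j i => f i j)
  simp only [← Finset.compl_singleton] at *
  rw [h]

/-- Symmetrization of the sum over pairs of eigenvalues in the divergence. -/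
lemma fieldDivergence_eq {h : Fin p → (Fin p → ℝ) → ℝ} {l : Fin p → ℝ}
    (hl : Function.Injective l) :
    fieldDivergence m h l = 2 * m * ∑ k, h k l
      + ∑ k, (∑ j ∈ Finset.univ.erase k, 2 * h k l * (l j + l k) / (l k - l j)
        + 2 * l k * partialDeriv (h k) k l) := by
  have h1 : ∑ k, 4 * ∑ b ∈ Finset.Ioi k, (l k * h k l - l b * h b l) / (l k - l b)
      = ∑ k, ∑ j ∈ Finset.univ.erase k, 4 * (l k * h k l / (l k - l j)) := by
    rw [sum_sum_erase_eq]
    refine Finset.sum_congr rfl fun k _ => ?_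
    rw [Finset.mul_sum]
    refine Finset.sum_congr rfl fun b hb => ?_
    rw [← neg_sub (l k) (l b), div_neg]
    ring
  have h2 : ∀ k, ∑ j ∈ Finset.univ.erase k, 2 * h k l * (l j + l k) / (l k - l j)
      = ∑ j ∈ Finset.univ.erase k, 4 * (l k * h k l / (l k - l j)) - 2 * ((p : ℝ) - 1) * h k l := by
    intro k
    have hc : ∑ j ∈ Finset.univ.erase k, 2 * h k l = 2 * ((p : ℝ) - 1) * h k l := by
      have : 1 ≤ p := by have := k.2; omega
      rw [Finset.sum_const, Finset.card_erase_of_mem (Finset.mem_univ k), Finset.card_univ,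
        Fintype.card_fin, nsmul_eq_mul, Nat.cast_sub this]
      push_cast
      ring
    rw [← hc, ← Finset.sum_sub_distrib]
    refine Finset.sum_congr rfl fun j hj => ?_
    have : l k - l j ≠ 0 := sub_ne_zero.2 fun e => Finset.ne_of_mem_erase hj (hl e).symm
    field_simp
    ring
  rw [fieldDivergence, Finset.sum_add_distrib, h1, Finset.mul_sum, ← Finset.sum_add_distrib,
    ← Finset.sum_add_distrib]
  refine Finset.sum_congr rfl fun k _ => ?_
  rw [h2]
  ring

/-- The field `Z U H(L) U*` is differentiable at regular points, with divergence
`fieldDivergence m h L`. -/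
lemma exists_hasFDerivAt_invariantField_trace {h : Fin p → (Fin p → ℝ) → ℝ}
    {Z : Matrix (Fin m) (Fin p) ℂ}
    (hZ : Z ∈ regularSet m p) (hh : ∀ k, DifferentiableAt ℝ (h k) (gramEig Z)) :
    ∃ T : Matrix (Fin m) (Fin p) ℂ →L[ℝ] Matrix (Fin m) (Fin p) ℂ,
      HasFDerivAt (invariantField h) T Z ∧
      LinearMap.trace ℝ _ T.toLinearMap = fieldDivergence m h (gramEig Z) := by
  obtain ⟨T, hT, hT'⟩ := exists_hasFDerivAt_invariantField hZ hh
  refine ⟨T, hT, ?_⟩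
  rw [fieldDivergence_eq hZ.1.injective, ← realTrace_fderiv_invariantField hT']
  exact trace_real_matrix_eq_sum _

end Field

/-! ### The divergence theorem for compactly supported differentiable fields -/

section Divergence

open Set Topology

/-- The box divergence theorem on a cube whose interior contains the support: the boundary terms
vanish. -/
lemma integral_sum_fderiv_eq_zero {n : ℕ} {f : (Fin n → ℝ) → (Fin n → ℝ)}
    {f' : (Fin n → ℝ) → (Fin n → ℝ) →L[ℝ] (Fin n → ℝ)}
    (hf : ∀ x, HasFDerivAt f (f' x) x) (hc : HasCompactSupport f)
    (hi : Integrable fun x => ∑ i, f' x (Pi.single i 1) i) :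
    ∫ x, ∑ i, f' x (Pi.single i 1) i = 0 := by
  cases n with
  | zero => simp
  | succ n =>
    obtain ⟨R, hR⟩ := hc.isCompact.isBounded.subset_closedBall (0 : Fin (n + 1) → ℝ)
    set a : Fin (n + 1) → ℝ := fun _ => -(|R| + 1)
    set b : Fin (n + 1) → ℝ := fun _ => |R| + 1
    have hRabs := le_abs_self R
    have habs := abs_nonneg R
    have hle : a ≤ b := fun i => by simp only [a, b]; linarith
    have hsupp : ∀ x i, |R| < |x i| → x ∉ tsupport f := by
      intro x i hx hxs
      have h1 := hR hxs
      rw [mem_closedBall_zero_iff] at h1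
      have h2 := norm_le_pi_norm x i
      rw [Real.norm_eq_abs] at h2
      linarith
    have hzero : ∀ x i, |R| < |x i| → f x = 0 := fun x i hx =>
      image_eq_zero_of_notMem_tsupport (hsupp x i hx)
    have hzero' : ∀ x, x ∉ Icc a b → ∑ i, f' x (Pi.single i 1) i = 0 := by
      intro x hx
      have : ∃ i, |R| < |x i| := by
        by_contra hcon
        push Not at hcon
        refine hx ⟨fun i => ?_, fun i => ?_⟩
        · have := (abs_le.1 (hcon i)).1
          simp only [a]; linarith
        · have := (abs_le.1 (hcon i)).2
          simp only [b]; linarith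
      obtain ⟨i, hi⟩ := this
      have hev : f =ᶠ[𝓝 x] fun _ => 0 :=
        notMem_tsupport_iff_eventuallyEq.1 (hsupp x i hi)
      have : f' x = 0 := (hf x).unique ((hasFDerivAt_const 0 x).congr_of_eventuallyEq hev)
      simp [this]
    have h := integral_divergence_of_hasFDerivAt_off_countable a b hle f f' ∅ countable_empty
      (fun x _ => (hf x).continuousAt.continuousWithinAt) (fun x _ => hf x) hi.integrableOn
    rw [setIntegral_eq_integral_of_forall_compl_eq_zero hzero'] at h
    rw [h]
    refine Finset.sum_eq_zero fun i _ => ?_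
    have hb : ∀ x, f (Fin.insertNth i (b i) x) i = 0 := fun x => by
      rw [hzero _ i (by
        simp only [Fin.insertNth_apply_same, b]
        rw [abs_of_pos (by linarith : (0 : ℝ) < |R| + 1)]
        linarith)]
      rfl
    have ha : ∀ x, f (Fin.insertNth i (a i) x) i = 0 := fun x => by
      rw [hzero _ i (by
        simp only [Fin.insertNth_apply_same, a]
        rw [abs_neg, abs_of_pos (by linarith : (0 : ℝ) < |R| + 1)]
        linarith)]
      rfl
    simp [ha, hb]

variable {E : Type*} [NormedAddCommGroup E] [NormedSpace ℝ E] [FiniteDimensional ℝ E]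
  [MeasurableSpace E] [BorelSpace E] (μ : Measure E) [μ.IsAddHaarMeasure]

/-- The integral of the divergence of a compactly supported differentiable field vanishes; only the
divergence, not each partial derivative, has to be integrable. -/
theorem integral_trace_fderiv_eq_zero {V : E → E} {V' : E → E →L[ℝ] E}
    (hV : ∀ x, HasFDerivAt V (V' x) x) (hc : HasCompactSupport V)
    (hi : Integrable (fun x => LinearMap.trace ℝ E (V' x).toLinearMap) μ) :
    ∫ x, LinearMap.trace ℝ E (V' x).toLinearMap ∂μ = 0 := by
  -- The trace is invariant under linear equivalence, and Haar measures agree up to a factor.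
  let e : E ≃L[ℝ] (Fin (Module.finrank ℝ E) → ℝ) :=
    ContinuousLinearEquiv.ofFinrankEq (by simp)
  let f : (Fin (Module.finrank ℝ E) → ℝ) → (Fin (Module.finrank ℝ E) → ℝ) :=
    fun y => e (V (e.symm y))
  let f' : (Fin (Module.finrank ℝ E) → ℝ) → (Fin (Module.finrank ℝ E) → ℝ) →L[ℝ]
      (Fin (Module.finrank ℝ E) → ℝ) :=
    fun y => (e : E →L[ℝ] _).comp ((V' (e.symm y)).comp (e.symm : _ →L[ℝ] E))
  have hf : ∀ y, HasFDerivAt f (f' y) y := by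
    intro y
    have h1 : HasFDerivAt (fun y => V (e.symm y))
        ((V' (e.symm y)).comp (e.symm : _ →L[ℝ] E)) y := (hV (e.symm y)).comp y e.symm.hasFDerivAt
    exact e.hasFDerivAt.comp y h1
  have hfc : HasCompactSupport f :=
    (hc.comp_homeomorph e.symm.toHomeomorph).comp_left (g := e) (map_zero e)
  have htr : ∀ y, ∑ i, f' y (Pi.single i 1) i
      = LinearMap.trace ℝ E (V' (e.symm y)).toLinearMap := by
    intro y
    have h1 : LinearMap.trace ℝ _ (f' y).toLinearMap
        = LinearMap.trace ℝ E (V' (e.symm y)).toLinearMap :=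
      LinearMap.trace_conj' (V' (e.symm y)).toLinearMap e.toLinearEquiv
    rw [← h1, LinearMap.trace_eq_matrix_trace ℝ (Pi.basisFun ℝ _), Matrix.trace]
    refine Finset.sum_congr rfl fun i _ => ?_
    simp
  have hemb : MeasurableEmbedding e := e.toHomeomorph.measurableEmbedding
  have : (μ.map e).IsAddHaarMeasure := e.isAddHaarMeasure_map μ
  have hmap : ∀ g : E → ℝ, ∫ x, g x ∂μ = ∫ y, g (e.symm y) ∂(μ.map e) := by
    intro g
    rw [hemb.integral_map]
    simp
  have hmapi : Integrable (fun y => ∑ i, f' y (Pi.single i 1) i) (μ.map e) := by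
    rw [hemb.integrable_map_iff]
    refine hi.congr (.of_forall fun x => ?_)
    simp [htr]
  obtain ⟨c, hc0, hctop, hvol⟩ : ∃ c : ENNReal, c ≠ 0 ∧ c ≠ ⊤ ∧
      (volume : Measure (Fin (Module.finrank ℝ E) → ℝ)) = c • μ.map e :=
    ⟨_, (Measure.addHaarScalarFactor_pos_of_isAddHaarMeasure _ _).ne' |> ENNReal.coe_ne_zero.2,
      ENNReal.coe_ne_top, Measure.isAddLeftInvariant_eq_smul _ _⟩
  have hvi : Integrable (fun y => ∑ i, f' y (Pi.single i 1) i) := by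
    rw [hvol]; exact hmapi.smul_measure hctop
  have h0 := integral_sum_fderiv_eq_zero hf hfc hvi
  rw [hvol, integral_smul_measure, smul_eq_zero] at h0
  rw [hmap]
  simp only [htr] at h0
  exact h0.resolve_left (ENNReal.toReal_ne_zero.2 ⟨hc0, hctop⟩)

/-- The divergence theorem on an open set, for a field vanishing off a compact subset. -/
theorem setIntegral_trace_fderiv_eq_zero {V : E → E} {V' : E → E →L[ℝ] E} {G C : Set E}
    (hG : IsOpen G) (hC : IsCompact C) (hCG : C ⊆ G)
    (hV : ∀ x ∈ G, HasFDerivAt V (V' x) x) (hV0 : ∀ x ∈ G, x ∉ C → V x = 0)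
    (hi : IntegrableOn (fun x => LinearMap.trace ℝ E (V' x).toLinearMap) G μ) :
    ∫ x in G, LinearMap.trace ℝ E (V' x).toLinearMap ∂μ = 0 := by
  have hW : ∀ x, HasFDerivAt (C.indicator V) (G.indicator V' x) x := by
    intro x
    by_cases hx : x ∈ G
    · rw [indicator_of_mem hx]
      refine (hV x hx).congr_of_eventuallyEq ?_
      filter_upwards [hG.mem_nhds hx] with y hy
      by_cases hyC : y ∈ C
      · rw [indicator_of_mem hyC]
      · rw [indicator_of_notMem hyC, hV0 y hy hyC]
    · rw [indicator_of_notMem hx]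
      refine (hasFDerivAt_const (0 : E) x).congr_of_eventuallyEq ?_
      filter_upwards [hC.isClosed.isOpen_compl.mem_nhds fun h => hx (hCG h)] with y hy
      exact indicator_of_notMem hy _
  have heq : (fun x => LinearMap.trace ℝ E (G.indicator V' x).toLinearMap)
      = G.indicator fun x => LinearMap.trace ℝ E (V' x).toLinearMap := by
    funext x
    by_cases hx : x ∈ G
    · simp [indicator_of_mem hx]
    · simp [indicator_of_notMem hx]
  have h := integral_trace_fderiv_eq_zero μ hW
    (HasCompactSupport.intro hC fun x hx => indicator_of_notMem hx _)
    (by rw [heq]; exact hi.integrable_indicator hG.measurableSet)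
  rwa [heq, integral_indicator hG.measurableSet] at h

end Divergence

/-! ### Almost every matrix is regular -/

section NullSet

open Polynomial
open scoped ComplexOrder

variable {m p : ℕ}

lemma gramEig_nonneg (Z : Matrix (Fin m) (Fin p) ℂ) (k : Fin p) : 0 ≤ gramEig Z k := by
  have h := trace_mul_gramProj_mul Z k
  have h2 : Z * gramProj Z k * Zᴴ = (Z * gramProj Z k) * (Z * gramProj Z k)ᴴ := by
    have hP : gramProj Z k * gramProj Z k = gramProj Z k := by rw [gramProj_mul, if_pos rfl]
    rw [Matrix.conjTranspose_mul, gramProj_conjTranspose, Matrix.mul_assoc, Matrix.mul_assoc,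
      ← Matrix.mul_assoc (gramProj Z k) (gramProj Z k), hP]
  rw [h2] at h
  have h3 := (Matrix.posSemidef_self_mul_conjTranspose (Z * gramProj Z k)).trace_nonneg
  rw [h] at h3
  exact_mod_cast h3

lemma antitone_gramEig (Z : Matrix (Fin m) (Fin p) ℂ) : Antitone (gramEig Z) :=
  (gram_isOrderedEigendecomposition Z).antitone

lemma mem_regularSet_iff {Z : Matrix (Fin m) (Fin p) ℂ} :
    Z ∈ regularSet m p ↔ Function.Injective (gramEig Z) ∧ ∀ k, gramEig Z k ≠ 0 :=
  ⟨fun h => ⟨h.1.injective, fun k => (h.2 k).ne'⟩, fun h =>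
    ⟨(antitone_gramEig Z).strictAnti_of_injective h.1,
      fun k => lt_of_le_of_ne (gramEig_nonneg Z k) (h.2 k).symm⟩⟩

lemma trace_gram_pow (Z : Matrix (Fin m) (Fin p) ℂ) (n : ℕ) :
    ((Zᴴ * Z) ^ n).trace = ∑ k, (gramEig Z k : ℂ) ^ n := by
  have hU := (gram_isOrderedEigendecomposition Z).unitary
  have h : (Zᴴ * Z) ^ n = spectralSum (eigVec (Zᴴ * Z)) (fun k => gramEig Z k ^ n) := by
    induction n with
    | zero => simp [spectralSum, sum_eigenProj hU]
    | succ n ih =>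
      rw [pow_succ, ih]
      refine (congrArg (spectralSum (eigVec (Zᴴ * Z)) (fun k => gramEig Z k ^ n) * ·)
        (gram_isOrderedEigendecomposition Z).eq_spectralSum).trans ?_
      refine (spectralSum_mul_spectralSum hU _ _).trans ?_
      simp only [pow_succ]
  rw [h, trace_spectralSum hU]
  push_cast
  rfl

lemma det_gram (Z : Matrix (Fin m) (Fin p) ℂ) :
    (Zᴴ * Z).det = ∏ k, (gramEig Z k : ℂ) := by
  have h := gram_isOrderedEigendecomposition Z
  have hU : (eigVec (Zᴴ * Z)).det * (eigVec (Zᴴ * Z))ᴴ.det = 1 := by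
    rw [← Matrix.det_mul, ← Matrix.star_eq_conjTranspose, Matrix.mem_unitaryGroup_iff.1 h.unitary,
      Matrix.det_one]
  conv_lhs => rw [h.eq]
  rw [Matrix.det_mul, Matrix.det_mul, mul_right_comm, hU, one_mul, realDiag, Matrix.det_diagonal]

/-- The discriminant of the characteristic polynomial of `Z* Z` (as the Hankel determinant of its
power sums) times its determinant: it vanishes exactly at the matrices that are not regular, and is
polynomial in the entries and their conjugates. -/
lemma det_mul_det_ne_zero_iff (Z : Matrix (Fin m) (Fin p) ℂ) :
    (Matrix.of fun i j : Fin p => ((Zᴴ * Z) ^ (i.val + j.val)).trace).det * (Zᴴ * Z).det ≠ 0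
      ↔ Z ∈ regularSet m p := by
  have h : (Matrix.of fun i j : Fin p => ((Zᴴ * Z) ^ (i.val + j.val)).trace)
      = (Matrix.vandermonde fun k => (gramEig Z k : ℂ))ᵀ
        * Matrix.vandermonde fun k => (gramEig Z k : ℂ) := by
    ext i j
    rw [Matrix.of_apply, trace_gram_pow]
    simp [Matrix.mul_apply, Matrix.vandermonde_apply, pow_add]
  rw [h, Matrix.det_mul, Matrix.det_transpose, det_gram, mul_ne_zero_iff, mul_self_ne_zero,
    Matrix.det_vandermonde_ne_zero_iff, Finset.prod_ne_zero_iff, mem_regularSet_iff]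
  refine and_congr ?_ ?_
  · exact ⟨fun h a b hab => h (congrArg _ hab), fun h a b hab => h (Complex.ofReal_injective hab)⟩
  · simp

lemma smul_mem_regularSet {Z : Matrix (Fin m) (Fin p) ℂ} (hZ : Z ∈ regularSet m p) {c : ℝ}
    (hc : c ≠ 0) : c • Z ∈ regularSet m p := by
  have hpos : 0 < c * c := mul_self_pos.2 hc
  have h := gram_isOrderedEigendecomposition Z
  have h2 : IsOrderedEigendecomposition ((c • Z)ᴴ * (c • Z)) (eigVec (Zᴴ * Z))
      (fun k => (c * c) * gramEig Z k) := by
    refine ⟨h.unitary, fun i j hij => mul_le_mul_of_nonneg_left (h.antitone hij) hpos.le, ?_⟩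
    rw [mul_realDiag_mul_conjTranspose, spectralSum]
    simp only [mul_smul, ← Finset.smul_sum]
    have : Zᴴ * Z = ∑ k, gramEig Z k • eigenProj (eigVec (Zᴴ * Z)) k := h.eq_spectralSum
    rw [← this, Matrix.conjTranspose_smul, Matrix.smul_mul, Matrix.mul_smul]
    simp
  change gramEig (c • Z) ∈ strictlyOrderedPositive p
  rw [gramEig, h2.eigVal_eq]
  exact ⟨fun i j hij => mul_lt_mul_of_pos_left (hZ.1 hij) hpos, fun k => mul_pos hpos (hZ.2 k)⟩

lemma exists_mem_regularSet (hpm : p ≤ m) :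
    ∃ Z : Matrix (Fin m) (Fin p) ℂ, Z ∈ regularSet m p := by
  let c : Fin p → ℝ := fun j => (p : ℝ) - j
  have hc : ∀ j, 0 < c j := fun j => by
    have : (j : ℝ) < p := by exact_mod_cast j.2
    simp only [c]; linarith
  have hanti : ∀ i j, i < j → c j < c i := fun i j hij => by
    have : ((i : ℕ) : ℝ) < (j : ℕ) := by exact_mod_cast hij
    simp only [c]; linarith
  let Z : Matrix (Fin m) (Fin p) ℂ := Matrix.of fun i j =>
    if i = Fin.castLE hpm j then (c j : ℂ) else 0
  have hstrict : StrictAnti fun k => c k * c k := fun i j hij =>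
    mul_self_lt_mul_self (hc j).le (hanti i j hij)
  have h : IsOrderedEigendecomposition (Zᴴ * Z) 1 (fun k => c k * c k) := by
    refine ⟨one_mem _, hstrict.antitone, ?_⟩
    ext i j
    simp only [Matrix.mul_apply, Matrix.conjTranspose_apply, Matrix.one_mul,
      Matrix.conjTranspose_one, realDiag, Matrix.diagonal_apply, Z, Matrix.of_apply]
    simp only [mul_ite, mul_zero, Finset.sum_ite_eq', Finset.mem_univ, if_true]
    by_cases hij : i = j
    · subst hij; simp
    · have : Fin.castLE hpm j ≠ Fin.castLE hpm i := fun e =>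
        hij (Fin.castLE_injective hpm e).symm
      simp [hij, this]
  refine ⟨Z, ?_⟩
  change gramEig Z ∈ strictlyOrderedPositive p
  rw [gramEig, h.eigVal_eq]
  exact ⟨hstrict, fun k => mul_pos (hc k) (hc k)⟩

/-- Along a real line the function of `det_mul_det_ne_zero_iff` is a polynomial in the parameter, and
it does not vanish identically on a line through a regular matrix. -/
lemma finite_setOf_notMem_regularSet {Z₀ : Matrix (Fin m) (Fin p) ℂ} (h₀ : Z₀ ∈ regularSet m p)
    (Z : Matrix (Fin m) (Fin p) ℂ) : {t : ℝ | Z₀ + t • Z ∉ regularSet m p}.Finite := by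
  let A : Matrix (Fin p) (Fin m) ℂ[X] := Z₀ᴴ.map C + (X : ℂ[X]) • Zᴴ.map C
  let B : Matrix (Fin m) (Fin p) ℂ[X] := Z₀.map C + (X : ℂ[X]) • Z.map C
  let q : ℂ[X] := (Matrix.of fun i j : Fin p => ((A * B) ^ (i.val + j.val)).trace).det * (A * B).det
  have hA : ∀ t : ℝ, A.map (evalRingHom (t : ℂ)) = (Z₀ + t • Z)ᴴ := by
    intro t
    ext i j
    simp [A]
    ring
  have hB : ∀ t : ℝ, B.map (evalRingHom (t : ℂ)) = Z₀ + t • Z := by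
    intro t
    ext i j
    simp [B]
    ring
  have hAB : ∀ t : ℝ, (evalRingHom (t : ℂ)).mapMatrix (A * B)
      = (Z₀ + t • Z)ᴴ * (Z₀ + t • Z) := by
    intro t
    rw [RingHom.mapMatrix_apply, Matrix.map_mul, hA, hB]
  have heval : ∀ t : ℝ, q.eval (t : ℂ) ≠ 0 ↔ Z₀ + t • Z ∈ regularSet m p := by
    intro t
    rw [← det_mul_det_ne_zero_iff, ← coe_evalRingHom]
    simp only [q]
    rw [map_mul, RingHom.map_det, RingHom.map_det, hAB]
    have : (evalRingHom (t : ℂ)).mapMatrix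
        (Matrix.of fun i j : Fin p => ((A * B) ^ (i.val + j.val)).trace)
        = Matrix.of fun i j : Fin p =>
          (((Z₀ + t • Z)ᴴ * (Z₀ + t • Z)) ^ (i.val + j.val)).trace := by
      ext i j
      rw [RingHom.mapMatrix_apply, Matrix.map_apply, Matrix.of_apply, Matrix.of_apply,
        AddMonoidHom.map_trace, ← hAB, ← map_pow]
      rfl
    rw [this]
  have hq : q ≠ 0 := by
    intro hq
    have := (heval 0).2 (by simpa using h₀)
    rw [hq] at this
    simp at this
  have hfin : {z : ℂ | q.eval z = 0}.Finite := by
    refine (q.roots.toFinset.finite_toSet).subset fun z hz => ?_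
    simpa [hq] using hz
  refine (hfin.preimage (Complex.ofReal_injective.injOn)).subset fun t ht => ?_
  by_contra hcon
  exact ht ((heval t).1 hcon)

/-- An open set is conull if every line in the direction `x₀` leaves it only finitely often. -/
lemma ae_mem_of_finite_line {E : Type*} [NormedAddCommGroup E] [NormedSpace ℝ E]
    [FiniteDimensional ℝ E] [MeasurableSpace E] [BorelSpace E] (μ : Measure E)
    [μ.IsAddHaarMeasure] {G : Set E} (hG : IsOpen G) (x₀ : E)
    (h : ∀ x, {s : ℝ | x + s • x₀ ∉ G}.Finite) : ∀ᵐ x ∂μ, x ∈ G := by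
  refine ae_mem_of_ae_add_linearMap_mem (LinearMap.toSpanSingleton ℝ _ x₀) volume μ
    hG.measurableSet fun x => ?_
  rw [ae_iff]
  exact (h x).measure_zero _

/-- Lines in the direction of a regular matrix: `Z + s Z₀` is regular exactly when `Z₀ + s⁻¹ Z`
is. -/
lemma finite_setOf_add_smul_notMem_regularSet {Z₀ : Matrix (Fin m) (Fin p) ℂ}
    (h₀ : Z₀ ∈ regularSet m p) (Z : Matrix (Fin m) (Fin p) ℂ) :
    {s : ℝ | Z + s • Z₀ ∉ regularSet m p}.Finite := by
  have hfin := (finite_setOf_notMem_regularSet h₀ Z).image (·⁻¹)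
  refine (hfin.insert 0).subset fun s hs => ?_
  by_cases hs0 : s = 0
  · exact Or.inl hs0
  refine Or.inr ⟨s⁻¹, fun h => hs ?_, inv_inv s⟩
  have := smul_mem_regularSet h hs0
  rwa [smul_add, smul_smul, mul_inv_cancel₀ hs0, one_smul, add_comm] at this

end NullSet

/-! ### Removing a cutoff from an integral identity with a quadratic term -/

section Cutoff

open Filter Topology

/-- Suppose `∫ w² (f - q) + c = 0` for cutoffs `w → 1`, where the error `c` is controlled by
`w √(κ q)` with `∫ κ → 0`. Since `q ≥ 0` enters with a sign, it absorbs half of the error; hence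
`∫ w² q` stays bounded, `q` is integrable, and then the error disappears in the limit. -/
theorem integrable_and_integral_eq_of_cutoff {α : Type*} [MeasurableSpace α] {ν : Measure α}
    {q f : α → ℝ} {w c κ : ℕ → α → ℝ} (hq0 : ∀ᵐ x ∂ν, 0 ≤ q x) (hq : AEStronglyMeasurable q ν)
    (hf : Integrable f ν) (hw : ∀ n, AEStronglyMeasurable (w n) ν)
    (hw01 : ∀ n, ∀ᵐ x ∂ν, 0 ≤ w n x ∧ w n x ≤ 1)
    (hw1 : ∀ᵐ x ∂ν, Tendsto (fun n => w n x) atTop (𝓝 1))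
    (hwq : ∀ n, Integrable (fun x => w n x ^ 2 * q x) ν)
    (hc : ∀ n, AEStronglyMeasurable (c n) ν)
    (hcb : ∀ n, ∀ᵐ x ∂ν, c n x ^ 2 ≤ 4 * w n x ^ 2 * κ n x * q x)
    (hκ0 : ∀ n, ∀ᵐ x ∂ν, 0 ≤ κ n x) (hκ : ∀ n, Integrable (κ n) ν)
    (hκlim : Tendsto (fun n => ∫ x, κ n x ∂ν) atTop (𝓝 0))
    (h0 : ∀ n, ∫ x, (w n x ^ 2 * (f x - q x) + c n x) ∂ν = 0) :
    Integrable q ν ∧ ∫ x, q x ∂ν = ∫ x, f x ∂ν := by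
  -- Young's inequality with a free parameter `η`: `η = 1 / 2` gives the bound, `η → 0` the limit.
  have hcη : ∀ n (η : ℝ), 0 < η → ∀ᵐ x ∂ν, |c n x| ≤ η * (w n x ^ 2 * q x) + η⁻¹ * κ n x := by
    intro n η hη
    filter_upwards [hcb n, hκ0 n, hq0] with x hx hk hqx
    refine abs_le_of_sq_le_sq (hx.trans ?_) (by positivity)
    have : (η * (w n x ^ 2 * q x) + η⁻¹ * κ n x) ^ 2
        = (η * (w n x ^ 2 * q x) - η⁻¹ * κ n x) ^ 2 + 4 * w n x ^ 2 * κ n x * q x := by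
      field_simp
      ring
    rw [this]
    exact le_add_of_nonneg_left (sq_nonneg _)
  have hci : ∀ n, Integrable (c n) ν := fun n =>
    ((((hwq n).const_mul 1).add ((hκ n).const_mul (1 : ℝ)⁻¹))).mono' (hc n)
      (by simpa only [Real.norm_eq_abs, Pi.add_apply] using hcη n 1 one_pos)
  have hwf : ∀ n, Integrable (fun x => w n x ^ 2 * f x) ν := fun n =>
    hf.mono ((hw n).pow 2 |>.mul hf.1) (by
      filter_upwards [hw01 n] with x hx
      rw [norm_mul, norm_pow]
      refine mul_le_of_le_one_left (norm_nonneg _) (pow_le_one₀ (norm_nonneg _) ?_)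
      rw [Real.norm_eq_abs, abs_of_nonneg hx.1]
      exact hx.2)
  have hsplit : ∀ n, ∫ x, w n x ^ 2 * q x ∂ν = ∫ x, w n x ^ 2 * f x ∂ν + ∫ x, c n x ∂ν := by
    intro n
    have h1 := h0 n
    have h2 : (fun x => w n x ^ 2 * (f x - q x) + c n x)
        = fun x => (w n x ^ 2 * f x - w n x ^ 2 * q x) + c n x := by
      funext x; ring
    have h3 := integral_add (f := fun x => w n x ^ 2 * f x - w n x ^ 2 * q x)
      ((hwf n).sub (hwq n)) (hci n)
    have h4 := integral_sub (hwf n) (hwq n)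
    rw [h2] at h1
    linarith
  have hcint : ∀ n (η : ℝ), 0 < η →
      |∫ x, c n x ∂ν| ≤ η * ∫ x, w n x ^ 2 * q x ∂ν + η⁻¹ * ∫ x, κ n x ∂ν := by
    intro n η hη
    rw [← integral_const_mul, ← integral_const_mul,
      ← integral_add ((hwq n).const_mul _) ((hκ n).const_mul _)]
    exact (abs_integral_le_integral_abs).trans (integral_mono_ae (hci n).abs
      (((hwq n).const_mul _).add ((hκ n).const_mul _)) (hcη n η hη))
  obtain ⟨K, hK⟩ := hκlim.bddAbove_range
  have hK' : ∀ n, ∫ x, κ n x ∂ν ≤ K := fun n => hK ⟨n, rfl⟩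
  have hbound : ∀ n, ∫ x, w n x ^ 2 * q x ∂ν ≤ 2 * ∫ x, |f x| ∂ν + 4 * K := by
    intro n
    have h1 : ∫ x, w n x ^ 2 * f x ∂ν ≤ ∫ x, |f x| ∂ν := by
      refine integral_mono_ae (hwf n) hf.abs ?_
      filter_upwards [hw01 n] with x hx
      have : w n x ^ 2 ≤ 1 := pow_le_one₀ hx.1 hx.2
      calc w n x ^ 2 * f x ≤ w n x ^ 2 * |f x| :=
            mul_le_mul_of_nonneg_left (le_abs_self _) (sq_nonneg _)
        _ ≤ |f x| := mul_le_of_le_one_left (abs_nonneg _) this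
    have h2 := (le_abs_self _).trans (hcint n (1 / 2) (by norm_num))
    have h3 := hsplit n
    have h4 := hK' n
    norm_num at h2
    linarith
  have hqi : Integrable q ν := by
    refine ⟨hq, ?_⟩
    rw [hasFiniteIntegral_iff_ofReal hq0]
    have hlim : ∀ᵐ x ∂ν, liminf (fun n => ENNReal.ofReal (w n x ^ 2 * q x)) atTop
        = ENNReal.ofReal (q x) := by
      filter_upwards [hw1] with x hx
      refine Tendsto.liminf_eq (ENNReal.tendsto_ofReal ?_)
      simpa using (hx.pow 2).mul_const (q x)
    rw [← lintegral_congr_ae hlim]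
    refine (lintegral_liminf_le' fun n => (hwq n).1.aemeasurable.ennreal_ofReal).trans_lt ?_
    refine lt_of_le_of_lt (b := ENNReal.ofReal (2 * ∫ x, |f x| ∂ν + 4 * K)) ?_
      ENNReal.ofReal_lt_top
    refine liminf_le_of_frequently_le' (Frequently.of_forall fun n => ?_)
    rw [← ofReal_integral_eq_lintegral_ofReal (hwq n)
      (by filter_upwards [hq0] with x hx; exact mul_nonneg (sq_nonneg _) hx)]
    exact ENNReal.ofReal_le_ofReal (hbound n)
  refine ⟨hqi, ?_⟩
  have hdom : ∀ {g : α → ℝ}, Integrable g ν →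
      Tendsto (fun n => ∫ x, w n x ^ 2 * g x ∂ν) atTop (𝓝 (∫ x, g x ∂ν)) := by
    intro g hg
    refine tendsto_integral_of_dominated_convergence (fun x => |g x|)
      (fun n => ((hw n).pow 2).mul hg.1) hg.abs (fun n => ?_) ?_
    · filter_upwards [hw01 n] with x hx
      rw [norm_mul, norm_pow, Real.norm_eq_abs, Real.norm_eq_abs, abs_of_nonneg hx.1]
      exact mul_le_of_le_one_left (abs_nonneg _) (pow_le_one₀ hx.1 hx.2)
    · filter_upwards [hw1] with x hx
      simpa using (hx.pow 2).mul_const (g x)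
  have hlimc : Tendsto (fun n => ∫ x, c n x ∂ν) atTop (𝓝 (∫ x, q x ∂ν - ∫ x, f x ∂ν)) := by
    have := (hdom hqi).sub (hdom hf)
    refine this.congr fun n => ?_
    rw [hsplit n]
    ring
  have hle : ∀ η : ℝ, 0 < η → |∫ x, q x ∂ν - ∫ x, f x ∂ν| ≤ η * ∫ x, q x ∂ν := by
    intro η hη
    have h2 := ((hdom hqi).const_mul η).add (hκlim.const_mul η⁻¹)
    rw [mul_zero, add_zero] at h2
    exact le_of_tendsto_of_tendsto' hlimc.abs h2 fun n => hcint n η hη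
  have hzero : |∫ x, q x ∂ν - ∫ x, f x ∂ν| ≤ 0 := by
    have h3 : Tendsto (fun η : ℝ => η * ∫ x, q x ∂ν) (𝓝[>] 0) (𝓝 0) := by
      have : Tendsto (fun η : ℝ => η * ∫ x, q x ∂ν) (𝓝 0) (𝓝 (0 * ∫ x, q x ∂ν)) :=
        tendsto_id.mul_const _
      rw [zero_mul] at this
      exact this.mono_left nhdsWithin_le_nhds
    exact ge_of_tendsto h3 (by filter_upwards [self_mem_nhdsWithin] with η hη using hle η hη)
  exact sub_eq_zero.1 (abs_eq_zero.1 (le_antisymm hzero (abs_nonneg _)))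

end Cutoff

/-! ### Barriers on open sets and the energy of their cutoffs -/

section Barrier

open Filter Topology Set
open Real (smoothTransition)

lemma hasDerivAt_smoothTransition (x : ℝ) :
    HasDerivAt smoothTransition (deriv smoothTransition x) x :=
  ((Real.smoothTransition.contDiff (n := 1)).differentiable (by simp) x).hasDerivAt

lemma continuous_deriv_smoothTransition : Continuous (deriv smoothTransition) :=
  (Real.smoothTransition.contDiff (n := 1)).continuous_deriv (by simp)

lemma deriv_smoothTransition_of_nonpos {x : ℝ} (hx : x ≤ 0) : deriv smoothTransition x = 0 := by
  refine IsLocalMin.deriv_eq_zero (Eventually.of_forall fun y => ?_)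
  rw [Real.smoothTransition.zero_of_nonpos hx]
  exact Real.smoothTransition.nonneg y

lemma deriv_smoothTransition_of_one_le {x : ℝ} (hx : 1 ≤ x) : deriv smoothTransition x = 0 := by
  refine IsLocalMax.deriv_eq_zero (Eventually.of_forall fun y => ?_)
  rw [Real.smoothTransition.one_of_one_le hx]
  exact Real.smoothTransition.le_one y

lemma deriv_smoothTransition_nonneg (x : ℝ) : 0 ≤ deriv smoothTransition x :=
  Real.smoothTransition.monotone.deriv_nonneg

lemma exists_deriv_smoothTransition_le : ∃ M : ℝ, 0 < M ∧ ∀ x, deriv smoothTransition x ≤ M := by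
  obtain ⟨M, hM⟩ := (isCompact_Icc (a := (0 : ℝ)) (b := 1)).bddAbove_image
    continuous_deriv_smoothTransition.continuousOn
  refine ⟨max M 1, by positivity, fun x => ?_⟩
  by_cases hx : x ∈ Icc (0 : ℝ) 1
  · exact (hM ⟨x, hx, rfl⟩).trans (le_max_left _ _)
  · have : deriv smoothTransition x = 0 := by
      rcases lt_or_ge x 0 with h | h
      · exact deriv_smoothTransition_of_nonpos h.le
      · exact deriv_smoothTransition_of_one_le (le_of_not_ge fun h' => hx ⟨h, h'⟩)
    rw [this]
    positivity

variable {E : Type*} [NormedAddCommGroup E] [NormedSpace ℝ E]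

/-- Product rule for the divergence of `s V`. -/
lemma exists_hasFDerivAt_smul_trace [FiniteDimensional ℝ E] {s : E → ℝ} {s' : E →L[ℝ] ℝ}
    {V : E → E} {T : E →L[ℝ] E} {x : E} (hs : HasFDerivAt s s' x) (hV : HasFDerivAt V T x) :
    ∃ S : E →L[ℝ] E, HasFDerivAt (fun y => s y • V y) S x ∧
      LinearMap.trace ℝ E S.toLinearMap
        = s x * LinearMap.trace ℝ E T.toLinearMap + s' (V x) := by
  refine ⟨_, hs.smul hV, ?_⟩
  have : (s x • T + s'.smulRight (V x)).toLinearMap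
      = s x • T.toLinearMap + s'.toLinearMap.smulRight (V x) := rfl
  rw [this, map_add, map_smul, LinearMap.trace_smulRight]
  rfl

/-- The data of a barrier on `G`: functions `r ≥ 0` and `t` such that `r` is large or `t` is very
negative near the boundary of `G` and at infinity, with gradients of square length at most `4 r`
and `e` with respect to the quadratic form `Q`, and a vector field `V` with divergence `d ≥ 0`,
along which `r` and `t` have derivatives `a` and `e`. In the application `V` is the gradient of `t`,
so that `d` is the Laplacian of `t` and `e` is the squared length of its gradient. -/
structure IsBarrier (G : Set E) (Q : E → ℝ) (r t : E → ℝ) (r' t' : E → E →L[ℝ] ℝ) (V : E → E)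
    (e d : E → ℝ) (a : ℝ) : Prop where
  exists_isCompact : ∀ M : ℝ, ∃ C, IsCompact C ∧ C ⊆ G ∧ ∀ x ∈ G, r x ≤ M → -M ≤ t x → x ∈ C
  hasFDerivAt_r : ∀ x ∈ G, HasFDerivAt r (r' x) x
  hasFDerivAt_t : ∀ x ∈ G, HasFDerivAt t (t' x) x
  hasFDerivAt_V : ∀ x ∈ G, ∃ T : E →L[ℝ] E,
    HasFDerivAt V T x ∧ LinearMap.trace ℝ E T.toLinearMap = d x
  deriv_r_V : ∀ x ∈ G, r' x (V x) = a
  deriv_t_V : ∀ x ∈ G, t' x (V x) = e x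
  nonneg_r : ∀ x ∈ G, 0 ≤ r x
  nonneg_a : 0 ≤ a
  nonneg_e : ∀ x ∈ G, 0 ≤ e x
  nonneg_d : ∀ x ∈ G, 0 ≤ d x
  continuous_r : Continuous r
  continuousOn_e : ContinuousOn e G
  continuousOn_d : ContinuousOn d G
  sq_deriv_r_le : ∀ x ∈ G, ∀ X, r' x X ^ 2 ≤ 4 * r x * Q X
  sq_deriv_t_le : ∀ x ∈ G, ∀ X, t' x X ^ 2 ≤ e x * Q X

/-- The cutoff that vanishes where `r ≥ n²` and where `t ≤ -k²`. -/
noncomputable def barrierCutoff (r t : E → ℝ) (n k : ℝ) (x : E) : ℝ :=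
  smoothTransition (n - r x / n) * smoothTransition (k + t x / k)

/-- The part of the energy density of the cutoff that comes from `t`. -/
noncomputable def barrierEnergy (r t e : E → ℝ) (n k : ℝ) (x : E) : ℝ :=
  smoothTransition (n - r x / n) * (deriv smoothTransition (k + t x / k) / k) * e x

/-- The derivative of the cutoff. -/
noncomputable def barrierCutoffDeriv (r t : E → ℝ) (r' t' : E → E →L[ℝ] ℝ) (n k : ℝ) (x : E) :
    E →L[ℝ] ℝ :=
  (smoothTransition (n - r x / n) * (deriv smoothTransition (k + t x / k) / k)) • t' x
    - (smoothTransition (k + t x / k) * (deriv smoothTransition (n - r x / n) / n)) • r' x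

lemma integrableOn_of_forall_notMem_eq_zero {E : Type*} [TopologicalSpace E] [T2Space E]
    [MeasurableSpace E] [BorelSpace E]
    {μ : Measure E} [IsFiniteMeasureOnCompacts μ]
    {G C : Set E} (hC : IsCompact C) (hCG : C ⊆ G) (hG : IsOpen G) {f : E → ℝ}
    (hf : ContinuousOn f G) (h0 : ∀ x ∈ G, x ∉ C → f x = 0) : IntegrableOn f G μ :=
  IntegrableOn.of_forall_sdiff_eq_zero ((hf.mono hCG).integrableOn_compact hC) hG.measurableSet
    fun x hx => h0 x hx.1 hx.2

namespace IsBarrier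

variable {G : Set E} {Q : E → ℝ} {r t : E → ℝ} {r' t' : E → E →L[ℝ] ℝ} {V : E → E} {e d : E → ℝ}
  {a : ℝ}

lemma continuousOn_t (hB : IsBarrier G Q r t r' t' V e d a) : ContinuousOn t G :=
  fun x hx => (hB.hasFDerivAt_t x hx).continuousAt.continuousWithinAt

lemma continuousOn_cutoff (hB : IsBarrier G Q r t r' t' V e d a) (n k : ℝ) :
    ContinuousOn (barrierCutoff r t n k) G :=
  (Real.smoothTransition.continuous.comp_continuousOn
    (continuousOn_const.sub (hB.continuous_r.continuousOn.div_const _))).mul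
    (Real.smoothTransition.continuous.comp_continuousOn
      (continuousOn_const.add (hB.continuousOn_t.div_const _)))

lemma continuousOn_energy (hB : IsBarrier G Q r t r' t' V e d a) (n k : ℝ) :
    ContinuousOn (barrierEnergy r t e n k) G :=
  ((Real.smoothTransition.continuous.comp_continuousOn
    (continuousOn_const.sub (hB.continuous_r.continuousOn.div_const _))).mul
    ((continuous_deriv_smoothTransition.comp_continuousOn
      (continuousOn_const.add (hB.continuousOn_t.div_const _))).div_const _)).mul hB.continuousOn_e

lemma exists_isCompact_cutoff (hB : IsBarrier G Q r t r' t' V e d a) {n k : ℝ} (hn : 0 < n)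
    (hk : 0 < k) : ∃ C, IsCompact C ∧ C ⊆ G ∧ ∀ x ∈ G, x ∉ C →
      n - r x / n ≤ 0 ∨ k + t x / k ≤ 0 := by
  obtain ⟨C, hC, hCG, h⟩ := hB.exists_isCompact (max (n * n) (k * k))
  refine ⟨C, hC, hCG, fun x hx hxC => ?_⟩
  by_contra! hcon
  refine hxC (h x hx (le_max_of_le_left ?_) ?_)
  · have := hcon.1
    rw [sub_pos, div_lt_iff₀ hn] at this
    exact this.le
  · have h2 : 0 < (k + t x / k) * k := mul_pos hcon.2 hk
    rw [add_mul, div_mul_cancel₀ _ hk.ne'] at h2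
    have := le_max_right (n * n) (k * k)
    linarith

lemma hasFDerivAt_cutoff (hB : IsBarrier G Q r t r' t' V e d a) (n k : ℝ) {x : E} (hx : x ∈ G) :
    HasFDerivAt (barrierCutoff r t n k) (barrierCutoffDeriv r t r' t' n k x) x := by
  have h1 := (hasDerivAt_smoothTransition (n - r x / n)).comp_hasFDerivAt x
    (((hB.hasFDerivAt_r x hx).mul_const n⁻¹).const_sub n)
  have h2 := (hasDerivAt_smoothTransition (k + t x / k)).comp_hasFDerivAt x
    (((hB.hasFDerivAt_t x hx).mul_const k⁻¹).const_add k)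
  refine (h1.mul h2).congr_fderiv ?_
  ext X
  simp only [barrierCutoffDeriv, Function.comp_apply, add_apply,
    sub_apply, smul_apply, neg_apply,
    smul_eq_mul, ← div_eq_mul_inv]
  ring

lemma cutoffDeriv_V (hB : IsBarrier G Q r t r' t' V e d a) (n k : ℝ) {x : E} (hx : x ∈ G) :
    barrierCutoffDeriv r t r' t' n k x (V x) = barrierEnergy r t e n k x
      - smoothTransition (k + t x / k) * (deriv smoothTransition (n - r x / n) / n) * a := by
  simp only [barrierCutoffDeriv, barrierEnergy, sub_apply,
    smul_apply, smul_eq_mul, hB.deriv_r_V x hx, hB.deriv_t_V x hx]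

lemma energy_nonneg (hB : IsBarrier G Q r t r' t' V e d a) {n k : ℝ} (hk : 0 < k) {x : E}
    (hx : x ∈ G) : 0 ≤ barrierEnergy r t e n k x :=
  mul_nonneg (mul_nonneg (Real.smoothTransition.nonneg _)
    (div_nonneg (deriv_smoothTransition_nonneg _) hk.le)) (hB.nonneg_e x hx)

lemma sq_cutoffDeriv_le (hB : IsBarrier G Q r t r' t' V e d a) {n k M : ℝ} (hn : 0 < n)
    (hk : 0 < k) (hM : ∀ x, deriv smoothTransition x ≤ M) (hQ : ∀ X, 0 ≤ Q X) {x : E} (hx : x ∈ G)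
    (X : E) : barrierCutoffDeriv r t r' t' n k x X ^ 2
      ≤ (8 * (M / n) ^ 2 * r x + 2 * (M / k) * barrierEnergy r t e n k x) * Q X := by
  have hd0 := deriv_smoothTransition_nonneg
  have h1 := hB.sq_deriv_r_le x hx X
  have h2 := hB.sq_deriv_t_le x hx X
  set A := smoothTransition (n - r x / n)
  set B := smoothTransition (k + t x / k)
  set α := deriv smoothTransition (n - r x / n) / n
  set β := deriv smoothTransition (k + t x / k) / k
  have hA0 : 0 ≤ A := Real.smoothTransition.nonneg _
  have hA1 : A ≤ 1 := Real.smoothTransition.le_one _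
  have hB0 : 0 ≤ B := Real.smoothTransition.nonneg _
  have hB1 : B ≤ 1 := Real.smoothTransition.le_one _
  have hα0 : 0 ≤ α := div_nonneg (hd0 _) hn.le
  have hα1 : α ≤ M / n := div_le_div_of_nonneg_right (hM _) hn.le
  have hβ0 : 0 ≤ β := div_nonneg (hd0 _) hk.le
  have hβ1 : β ≤ M / k := div_le_div_of_nonneg_right (hM _) hk.le
  have he := hB.nonneg_e x hx
  have hr := hB.nonneg_r x hx
  have hQX := hQ X
  have hBα : (B * α) ^ 2 ≤ (M / n) ^ 2 :=
    pow_le_pow_left₀ (mul_nonneg hB0 hα0) ((mul_le_of_le_one_left hα0 hB1).trans hα1) 2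
  have hAβ : (A * β) ^ 2 ≤ M / k * (A * β) := by
    rw [pow_two]
    exact mul_le_mul_of_nonneg_right ((mul_le_of_le_one_left hβ0 hA1).trans hβ1)
      (mul_nonneg hA0 hβ0)
  have hMAβ := (sq_nonneg _).trans hAβ
  change ((A * β) * t' x X - (B * α) * r' x X) ^ 2
    ≤ (8 * (M / n) ^ 2 * r x + 2 * (M / k) * (A * β * e x)) * Q X
  calc ((A * β) * t' x X - (B * α) * r' x X) ^ 2
      ≤ 2 * ((A * β) ^ 2 * t' x X ^ 2) + 2 * ((B * α) ^ 2 * r' x X ^ 2) := by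
        have := sq_nonneg ((A * β) * t' x X + (B * α) * r' x X)
        linarith
    _ ≤ 2 * ((M / k * (A * β)) * (e x * Q X)) + 2 * ((M / n) ^ 2 * (4 * r x * Q X)) := by
        gcongr
    _ = _ := by ring

variable [FiniteDimensional ℝ E] [MeasurableSpace E] [BorelSpace E] {μ : Measure E}
  [μ.IsAddHaarMeasure]

/-- Testing the divergence theorem on the field `V` times the cutoff bounds the energy of the
cutoff in the direction of `t`, uniformly in the parameter `k` of the cutoff in `t`. -/
theorem integral_energy_le (hB : IsBarrier G Q r t r' t' V e d a) (hG : IsOpen G)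
    (hμ : ∀ M : ℝ, μ {x | r x ≤ M} < ⊤) {M n k : ℝ} (hM : ∀ x, deriv smoothTransition x ≤ M)
    (hn : 0 < n) (hk : 0 < k) :
    IntegrableOn (barrierEnergy r t e n k) G μ ∧
      ∫ x in G, barrierEnergy r t e n k x ∂μ ≤ M / n * a * μ.real {x | r x ≤ n * n} := by
  obtain ⟨C, hC, hCG, hC0⟩ := hB.exists_isCompact_cutoff hn hk
  have hT : ∀ x, ∃ T : E →L[ℝ] E, x ∈ G →
      HasFDerivAt (fun y => barrierCutoff r t n k y • V y) T x ∧
      LinearMap.trace ℝ E T.toLinearMap = barrierCutoff r t n k x * d x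
        + (barrierEnergy r t e n k x
          - smoothTransition (k + t x / k) * (deriv smoothTransition (n - r x / n) / n) * a) := by
    intro x
    by_cases hx : x ∈ G
    · obtain ⟨T, hT, hTd⟩ := hB.hasFDerivAt_V x hx
      obtain ⟨S, hS, hSt⟩ := exists_hasFDerivAt_smul_trace (hB.hasFDerivAt_cutoff n k hx) hT
      exact ⟨S, fun _ => ⟨hS, by rw [hSt, hTd, hB.cutoffDeriv_V n k hx]⟩⟩
    · exact ⟨0, fun h => absurd h hx⟩
  choose T hT using hT
  set b : E → ℝ := fun x =>
    smoothTransition (k + t x / k) * (deriv smoothTransition (n - r x / n) / n) * a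
  have hbc : ContinuousOn b G :=
    ((Real.smoothTransition.continuous.comp_continuousOn
      (continuousOn_const.add (hB.continuousOn_t.div_const _))).mul
    ((continuous_deriv_smoothTransition.comp_continuousOn
      (continuousOn_const.sub (hB.continuous_r.continuousOn.div_const _))).div_const _)).mul_const a
  have hi1 : IntegrableOn (barrierEnergy r t e n k) G μ := by
    refine integrableOn_of_forall_notMem_eq_zero hC hCG hG (hB.continuousOn_energy n k)
      fun x hx hxC => ?_
    rcases hC0 x hx hxC with h | h
    · simp [barrierEnergy, Real.smoothTransition.zero_of_nonpos h]
    · simp [barrierEnergy, deriv_smoothTransition_of_nonpos h]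
  have hi2 : IntegrableOn b G μ := by
    refine integrableOn_of_forall_notMem_eq_zero hC hCG hG hbc fun x hx hxC => ?_
    rcases hC0 x hx hxC with h | h
    · simp [b, deriv_smoothTransition_of_nonpos h]
    · simp [b, Real.smoothTransition.zero_of_nonpos h]
  have hi3 : IntegrableOn (fun x => barrierCutoff r t n k x * d x) G μ := by
    refine integrableOn_of_forall_notMem_eq_zero hC hCG hG
      ((hB.continuousOn_cutoff n k).mul hB.continuousOn_d) fun x hx hxC => ?_
    rcases hC0 x hx hxC with h | h <;>
    simp [barrierCutoff, Real.smoothTransition.zero_of_nonpos h]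
  refine ⟨hi1, ?_⟩
  have hi : IntegrableOn (fun x => LinearMap.trace ℝ E (T x).toLinearMap) G μ :=
    (hi3.add (hi1.sub hi2)).congr_fun (fun x hx => (hT x hx).2.symm) hG.measurableSet
  have h0 := setIntegral_trace_fderiv_eq_zero (μ := μ) hG hC hCG (fun x hx => (hT x hx).1)
    (fun x hx hxC => by
      rcases hC0 x hx hxC with h | h <;>
      simp [barrierCutoff, Real.smoothTransition.zero_of_nonpos h]) hi
  rw [setIntegral_congr_fun hG.measurableSet (fun x hx => (hT x hx).2)] at h0
  have e1 := integral_add (μ := μ.restrict G) hi3 (hi1.sub hi2)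
  have e2 := integral_sub (μ := μ.restrict G) hi1 hi2
  have h3 : 0 ≤ ∫ x in G, barrierCutoff r t n k x * d x ∂μ :=
    setIntegral_nonneg hG.measurableSet fun x hx =>
      mul_nonneg (mul_nonneg (Real.smoothTransition.nonneg _) (Real.smoothTransition.nonneg _))
        (hB.nonneg_d x hx)
  have hM0 : 0 ≤ M := (deriv_smoothTransition_nonneg 0).trans (hM 0)
  set S := {x | r x ≤ n * n}
  have hS : MeasurableSet S := (isClosed_le hB.continuous_r continuous_const).measurableSet
  have hi4 : Integrable (S.indicator fun _ => M / n * a) μ :=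
    (integrable_indicator_iff hS).2 (integrableOn_const (hμ _).ne)
  have h4 : ∫ x in G, b x ∂μ ≤ M / n * a * μ.real S := by
    calc ∫ x in G, b x ∂μ ≤ ∫ x in G, S.indicator (fun _ => M / n * a) x ∂μ := by
          refine setIntegral_mono_on hi2 hi4.integrableOn hG.measurableSet fun x hx => ?_
          by_cases hxS : x ∈ S
          · rw [indicator_of_mem hxS]
            refine mul_le_mul_of_nonneg_right ?_ hB.nonneg_a
            refine (mul_le_of_le_one_left (div_nonneg (deriv_smoothTransition_nonneg _) hn.le)
              (Real.smoothTransition.le_one _)).trans ?_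
            exact div_le_div_of_nonneg_right (hM _) hn.le
          · rw [indicator_of_notMem hxS]
            have : n - r x / n ≤ 0 := by
              rw [sub_nonpos, le_div_iff₀ hn]
              exact (not_le.1 hxS).le
            simp [b, deriv_smoothTransition_of_nonpos this]
      _ ≤ ∫ x, S.indicator (fun _ => M / n * a) x ∂μ :=
          setIntegral_le_integral hi4 (Eventually.of_forall fun x =>
            indicator_nonneg (fun _ _ => mul_nonneg (div_nonneg hM0 hn.le) hB.nonneg_a) x)
      _ = M / n * a * μ.real S := by
          rw [integral_indicator hS, setIntegral_const, smul_eq_mul, mul_comm]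
  simp only [Pi.sub_apply] at e1
  linarith

end IsBarrier

end Barrier

/-! ### Cutoffs of small energy and integration by parts without boundary term -/

section Cutoffs

open Filter Topology Set
open Real (smoothTransition)

variable {E : Type*} [NormedAddCommGroup E] [NormedSpace ℝ E] [FiniteDimensional ℝ E]
  [MeasurableSpace E] [BorelSpace E] {μ : Measure E} [μ.IsAddHaarMeasure]

namespace IsBarrier

variable {G : Set E} {Q : E → ℝ} {r t : E → ℝ} {r' t' : E → E →L[ℝ] ℝ} {V : E → E} {e d : E → ℝ}
  {a : ℝ}

/-- If `φ` is a weight for which the function `r` of a barrier is integrable, there are cutoffs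
supported in compact subsets of `G` which tend to `1` and whose energy tends to `0`: the boundary of
`G` has capacity zero. -/
theorem exists_cutoff (hB : IsBarrier G Q r t r' t' V e d a) (hG : IsOpen G)
    (hμ : ∀ M : ℝ, μ {x | r x ≤ M} < ⊤) (hQ : ∀ X, 0 ≤ Q X) {φ : E → ℝ} (hφ : Continuous φ)
    (hφ0 : ∀ x, 0 ≤ φ x) {K : ℝ} (hφK : ∀ x, φ x ≤ K)
    (hr : IntegrableOn (fun x => φ x * r x) G μ) :
    ∃ (w : ℕ → E → ℝ) (w' : ℕ → E → E →L[ℝ] ℝ) (κ : ℕ → E → ℝ),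
      (∀ n, ∀ x ∈ G, HasFDerivAt (w n) (w' n x) x) ∧
      (∀ n, ∃ C, IsCompact C ∧ C ⊆ G ∧ ∀ x ∈ G, x ∉ C → w n x = 0) ∧
      (∀ n x, 0 ≤ w n x ∧ w n x ≤ 1) ∧
      (∀ x, Tendsto (fun n => w n x) atTop (𝓝 1)) ∧
      (∀ n, ∀ x ∈ G, ∀ X, w' n x X ^ 2 ≤ κ n x * Q X) ∧
      (∀ n, ∀ x ∈ G, 0 ≤ κ n x) ∧
      (∀ n, IntegrableOn (fun x => φ x * κ n x) G μ) ∧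
      Tendsto (fun n => ∫ x in G, φ x * κ n x ∂μ) atTop (𝓝 0) := by
  obtain ⟨M, hM0, hM⟩ := exists_deriv_smoothTransition_le
  have hK0 : 0 ≤ K := (hφ0 0).trans (hφK 0)
  have ha := hB.nonneg_a
  -- The parameter of the cutoff in `t` is taken large compared to the energy bound, which depends
  -- only on the parameter of the cutoff in `r`.
  let N : ℕ → ℝ := fun n => (n : ℝ) + 1
  let b : ℕ → ℝ := fun n => M / N n * a * μ.real {x | r x ≤ N n * N n}
  let k : ℕ → ℝ := fun n => N n * (1 + b n)
  have hN : ∀ n, 0 < N n := fun n => by positivity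
  have hb : ∀ n, 0 ≤ b n := fun n =>
    mul_nonneg (mul_nonneg (div_nonneg hM0.le (hN n).le) ha) measureReal_nonneg
  have hNk : ∀ n, N n ≤ k n := fun n => le_mul_of_one_le_right (hN n).le (by linarith [hb n])
  have hk : ∀ n, 0 < k n := fun n => (hN n).trans_le (hNk n)
  have hNlim : Tendsto N atTop atTop := tendsto_atTop_add_const_right _ _ tendsto_natCast_atTop_atTop
  have hklim : Tendsto k atTop atTop := tendsto_atTop_mono hNk hNlim
  have hen := fun n => hB.integral_energy_le hG hμ hM (hN n) (hk n)
  have hφen : ∀ n, IntegrableOn (fun x => φ x * barrierEnergy r t e (N n) (k n) x) G μ := fun n =>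
    (hen n).1.bdd_mul hφ.aestronglyMeasurable (Eventually.of_forall fun x => by
      rw [Real.norm_eq_abs, abs_of_nonneg (hφ0 x)]; exact hφK x)
  have hκeq : ∀ n, (fun x => φ x * (8 * (M / N n) ^ 2 * r x
        + 2 * (M / k n) * barrierEnergy r t e (N n) (k n) x))
      = fun x => 8 * (M / N n) ^ 2 * (φ x * r x)
        + 2 * (M / k n) * (φ x * barrierEnergy r t e (N n) (k n) x) := fun n => by
    funext x; ring
  have hone : ∀ (f : ℕ → ℝ) (x : ℝ), Tendsto f atTop atTop →
      ∀ᶠ n in atTop, 1 ≤ f n + x / f n := by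
    intro f x hf
    have h1 : Tendsto (fun n => x / f n) atTop (𝓝 0) := tendsto_const_nhds.div_atTop hf
    exact (hf.atTop_add h1).eventually_ge_atTop 1
  refine ⟨fun n => barrierCutoff r t (N n) (k n), fun n => barrierCutoffDeriv r t r' t' (N n) (k n),
    fun n x => 8 * (M / N n) ^ 2 * r x + 2 * (M / k n) * barrierEnergy r t e (N n) (k n) x,
    fun n x hx => hB.hasFDerivAt_cutoff _ _ hx, fun n => ?_, fun n x => ⟨?_, ?_⟩, fun x => ?_,
    fun n x hx X => hB.sq_cutoffDeriv_le (hN n) (hk n) hM hQ hx X, fun n x hx => ?_, fun n => ?_, ?_⟩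
  · obtain ⟨C, hC, hCG, hC0⟩ := hB.exists_isCompact_cutoff (hN n) (hk n)
    refine ⟨C, hC, hCG, fun x hx hxC => ?_⟩
    rcases hC0 x hx hxC with h | h <;>
    simp [barrierCutoff, Real.smoothTransition.zero_of_nonpos h]
  · exact mul_nonneg (Real.smoothTransition.nonneg _) (Real.smoothTransition.nonneg _)
  · exact mul_le_one₀ (Real.smoothTransition.le_one _) (Real.smoothTransition.nonneg _)
      (Real.smoothTransition.le_one _)
  · refine tendsto_const_nhds.congr' ?_
    filter_upwards [hone N (-r x) hNlim, hone k (t x) hklim] with n h1 h2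
    rw [neg_div, ← sub_eq_add_neg] at h1
    rw [barrierCutoff, Real.smoothTransition.one_of_one_le h1,
      Real.smoothTransition.one_of_one_le h2, one_mul]
  · have h1 := hB.nonneg_r x hx
    have h2 := hB.energy_nonneg (n := N n) (hk n) hx
    have h3 := hk n
    positivity
  · rw [hκeq n]
    exact (hr.const_mul _).add ((hφen n).const_mul _)
  · have hle : ∀ n, ∫ x in G, φ x * (8 * (M / N n) ^ 2 * r x
        + 2 * (M / k n) * barrierEnergy r t e (N n) (k n) x) ∂μ
        ≤ 8 * (M / N n) ^ 2 * ∫ x in G, φ x * r x ∂μ + 2 * M * K * (N n)⁻¹ := by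
      intro n
      rw [hκeq n, integral_add (hr.const_mul _) ((hφen n).const_mul _), integral_const_mul,
        integral_const_mul]
      refine add_le_add_right ?_ _
      have h1 : ∫ x in G, φ x * barrierEnergy r t e (N n) (k n) x ∂μ ≤ K * b n := by
        calc _ ≤ ∫ x in G, K * barrierEnergy r t e (N n) (k n) x ∂μ :=
              setIntegral_mono_on (hφen n) ((hen n).1.const_mul K) hG.measurableSet fun x hx =>
                mul_le_mul_of_nonneg_right (hφK x) (hB.energy_nonneg (hk n) hx)
          _ ≤ K * b n := by
              rw [integral_const_mul]
              exact mul_le_mul_of_nonneg_left (hen n).2 hK0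
      have h2 : b n / k n ≤ (N n)⁻¹ := by
        rw [div_le_iff₀ (hk n)]
        change b n ≤ (N n)⁻¹ * (N n * (1 + b n))
        rw [inv_mul_cancel_left₀ (hN n).ne']
        linarith
      calc 2 * (M / k n) * ∫ x in G, φ x * barrierEnergy r t e (N n) (k n) x ∂μ
          ≤ 2 * (M / k n) * (K * b n) :=
            mul_le_mul_of_nonneg_left h1 (by have := hk n; positivity)
        _ = 2 * M * K * (b n / k n) := by ring
        _ ≤ 2 * M * K * (N n)⁻¹ := mul_le_mul_of_nonneg_left h2 (by positivity)
    have hinv : Tendsto (fun n => (N n)⁻¹) atTop (𝓝 0) := hNlim.inv_tendsto_atTop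
    have hlim : Tendsto (fun n => 8 * (M / N n) ^ 2 * ∫ x in G, φ x * r x ∂μ
        + 2 * M * K * (N n)⁻¹) atTop (𝓝 0) := by
      have h := (((hinv.const_mul M).pow 2).const_mul 8 |>.mul_const
        (∫ x in G, φ x * r x ∂μ)).add (hinv.const_mul (2 * M * K))
      simpa [div_eq_mul_inv] using h
    refine tendsto_of_tendsto_of_tendsto_of_le_of_le tendsto_const_nhds hlim (fun n => ?_) hle
    refine setIntegral_nonneg hG.measurableSet fun x hx => mul_nonneg (hφ0 x) ?_
    have h1 := hB.nonneg_r x hx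
    have h2 := hB.energy_nonneg (n := N n) (hk n) hx
    have h3 := hk n
    positivity

/-- Integration by parts for a field `W` on an open set that carries a barrier. If the divergence of
`φ W` is `φ (f - Q(W))` with `f` integrable for the weight `φ`, then `Q(W)` is integrable for this
weight as well, with the same integral as `f`. -/
theorem integral_eq_of_divergence_eq (hB : IsBarrier G Q r t r' t' V e d a) (hG : IsOpen G)
    (hμ : ∀ M : ℝ, μ {x | r x ≤ M} < ⊤) (hQ : ∀ X, 0 ≤ Q X) (hQc : Continuous Q)
    {φ : E → ℝ} {φ' : E → E →L[ℝ] ℝ} (hφ : ∀ x, HasFDerivAt φ (φ' x) x)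
    (hφ0 : ∀ x, 0 ≤ φ x) {K : ℝ} (hφK : ∀ x, φ x ≤ K)
    (hr : IntegrableOn (fun x => φ x * r x) G μ) {W : E → E} {D f : E → ℝ}
    (hW : ∀ x ∈ G, ∃ T : E →L[ℝ] E, HasFDerivAt W T x ∧ LinearMap.trace ℝ E T.toLinearMap = D x)
    (hdiv : ∀ x ∈ G, φ x * D x + φ' x (W x) = φ x * (f x - Q (W x)))
    (hf : IntegrableOn (fun x => φ x * f x) G μ) :
    IntegrableOn (fun x => φ x * Q (W x)) G μ ∧
      ∫ x in G, φ x * Q (W x) ∂μ = ∫ x in G, φ x * f x ∂μ := by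
  have hφc : Continuous φ := continuous_iff_continuousAt.2 fun x => (hφ x).continuousAt
  obtain ⟨w, w', κ, hw', hwC, hw01, hwlim, hwκ, hκ0, hκi, hκlim⟩ :=
    hB.exists_cutoff hG hμ hQ hφc hφ0 hφK hr
  have hmem : ∀ᵐ x ∂μ.restrict G, x ∈ G := ae_restrict_mem hG.measurableSet
  have hWc : ContinuousOn W G := fun x hx => by
    obtain ⟨T, hT, -⟩ := hW x hx
    exact hT.continuousAt.continuousWithinAt
  have hwc : ∀ n, ContinuousOn (w n) G := fun n x hx =>
    (hw' n x hx).continuousAt.continuousWithinAt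
  have hqc : ContinuousOn (fun x => φ x * Q (W x)) G :=
    hφc.continuousOn.mul (hQc.comp_continuousOn hWc)
  have hw'W : ∀ n, AEStronglyMeasurable (fun x => w' n x (W x)) (μ.restrict G) := by
    intro n
    have h1 : AEStronglyMeasurable (fun x => fderiv ℝ (w n) x (W x)) (μ.restrict G) :=
      isBoundedBilinearMap_apply.continuous.comp_aestronglyMeasurable₂
        (g := fun (p : E →L[ℝ] ℝ) (x : E) => p x)
        (measurable_fderiv ℝ (w n)).aestronglyMeasurable
        (hWc.aestronglyMeasurable hG.measurableSet)
    refine h1.congr ?_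
    filter_upwards [hmem] with x hx
    rw [(hw' n x hx).fderiv]
  have hwq : ∀ n, IntegrableOn (fun x => w n x ^ 2 * (φ x * Q (W x))) G μ := by
    intro n
    obtain ⟨C, hC, hCG, hC0⟩ := hwC n
    refine integrableOn_of_forall_notMem_eq_zero hC hCG hG (((hwc n).pow 2).mul hqc)
      fun x hx hxC => ?_
    simp [hC0 x hx hxC]
  have hcb : ∀ n, ∀ x ∈ G, (2 * w n x * (φ x * w' n x (W x))) ^ 2
      ≤ 4 * w n x ^ 2 * (φ x * κ n x) * (φ x * Q (W x)) := by
    intro n x hx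
    calc (2 * w n x * (φ x * w' n x (W x))) ^ 2
        = 4 * w n x ^ 2 * φ x ^ 2 * w' n x (W x) ^ 2 := by ring
      _ ≤ 4 * w n x ^ 2 * φ x ^ 2 * (κ n x * Q (W x)) :=
          mul_le_mul_of_nonneg_left (hwκ n x hx _) (by positivity)
      _ = _ := by ring
  have hcm : ∀ n, AEStronglyMeasurable (fun x => 2 * w n x * (φ x * w' n x (W x)))
      (μ.restrict G) := fun n =>
    (((hwc n).aestronglyMeasurable hG.measurableSet).const_mul 2).mul
      (hφc.aestronglyMeasurable.mul (hw'W n))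
  refine integrable_and_integral_eq_of_cutoff (w := w) (κ := fun n x => φ x * κ n x)
    (c := fun n x => 2 * w n x * (φ x * w' n x (W x)))
    (Eventually.of_forall fun x => mul_nonneg (hφ0 x) (hQ _))
    (hqc.aestronglyMeasurable hG.measurableSet) hf
    (fun n => (hwc n).aestronglyMeasurable hG.measurableSet)
    (fun n => Eventually.of_forall (hw01 n)) (Eventually.of_forall hwlim) hwq hcm
    (fun n => hmem.mono (hcb n)) (fun n => hmem.mono fun x hx => mul_nonneg (hφ0 x) (hκ0 n x hx))
    hκi hκlim fun n => ?_
  obtain ⟨C, hC, hCG, hC0⟩ := hwC n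
  have hT : ∀ x, ∃ T : E →L[ℝ] E, x ∈ G →
      HasFDerivAt (fun y => (w n y ^ 2 * φ y) • W y) T x ∧
      LinearMap.trace ℝ E T.toLinearMap = w n x ^ 2 * (φ x * f x - φ x * Q (W x))
        + 2 * w n x * (φ x * w' n x (W x)) := by
    intro x
    by_cases hx : x ∈ G
    · obtain ⟨T, hT, hTd⟩ := hW x hx
      obtain ⟨S, hS, hSt⟩ := exists_hasFDerivAt_smul_trace (((hw' n x hx).pow 2).mul (hφ x)) hT
      refine ⟨S, fun _ => ⟨hS, ?_⟩⟩
      rw [hSt, hTd]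
      simp only [add_apply, smul_apply, smul_eq_mul]
      have := hdiv x hx
      simp
      linear_combination w n x ^ 2 * this
    · exact ⟨0, fun h => absurd h hx⟩
  choose T hT using hT
  have hwf : IntegrableOn (fun x => w n x ^ 2 * (φ x * f x)) G μ :=
    hf.bdd_mul (((hwc n).pow 2).aestronglyMeasurable hG.measurableSet)
      (c := 1) (Eventually.of_forall fun x => by
        rw [norm_pow, Real.norm_eq_abs, abs_of_nonneg (hw01 n x).1]
        exact pow_le_one₀ (hw01 n x).1 (hw01 n x).2)
  have hci : IntegrableOn (fun x => 2 * w n x * (φ x * w' n x (W x))) G μ := by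
    refine ((hwq n).add (hκi n)).mono' (hcm n) ?_
    filter_upwards [hmem] with x hx
    have h1 := mul_nonneg (hφ0 x) (hκ0 n x hx)
    have h2 := mul_nonneg (hφ0 x) (hQ (W x))
    refine abs_le_of_sq_le_sq ((hcb n x hx).trans ?_)
      (add_nonneg (mul_nonneg (sq_nonneg _) h2) h1)
    have h3 := sq_nonneg (w n x ^ 2 * (φ x * Q (W x)) - φ x * κ n x)
    simp only [Pi.add_apply]
    linarith
  have h0 := setIntegral_trace_fderiv_eq_zero (μ := μ) hG hC hCG (fun x hx => (hT x hx).1)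
    (fun x hx hxC => by simp [hC0 x hx hxC])
    (((hwf.sub (hwq n)).add hci).congr_fun (fun x hx => by
      rw [(hT x hx).2]
      simp only [Pi.add_apply, Pi.sub_apply]
      ring) hG.measurableSet)
  rwa [setIntegral_congr_fun hG.measurableSet (fun x hx => (hT x hx).2)] at h0

end IsBarrier

end Cutoffs

/-! ### The logarithmic barrier of the chamber of ordered eigenvalues -/

section LogBarrier

variable {p : ℕ}

/-- The sum of `1 / (l_k - l_j)` over `j ≠ k`; the term `j = k` is `0⁻¹ = 0`. -/
noncomputable def gapSum (l : Fin p → ℝ) (k : Fin p) : ℝ := ∑ j, (l k - l j)⁻¹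

/-- The logarithm of the product of all `l_k - l_b` with `k < b` and of all `l_k`. -/
noncomputable def logBarrier (l : Fin p → ℝ) : ℝ :=
  ∑ k, (∑ b ∈ Finset.Ioi k, Real.log (l k - l b) + Real.log (l k))

/-- The partial derivatives of `logBarrier`. -/
noncomputable def logBarrierGrad (k : Fin p) (l : Fin p → ℝ) : ℝ := gapSum l k + (l k)⁻¹

lemma sum_gapSum (l : Fin p → ℝ) : ∑ k, gapSum l k = 0 := by
  have h : ∑ k, gapSum l k = -∑ k, gapSum l k := by
    simp only [gapSum]
    conv_lhs => rw [Finset.sum_comm]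
    rw [← Finset.sum_neg_distrib]
    refine Finset.sum_congr rfl fun k _ => ?_
    rw [← Finset.sum_neg_distrib]
    refine Finset.sum_congr rfl fun j _ => ?_
    rw [← inv_neg, neg_sub]
  linarith

lemma sum_mul_gapSum {l : Fin p → ℝ} (hl : Function.Injective l) :
    ∑ k, l k * gapSum l k = p * (p - 1) / 2 := by
  have h1 : ∑ k, l k * gapSum l k = ∑ k, ∑ j, l k * (l k - l j)⁻¹ := by
    simp only [gapSum, Finset.mul_sum]
  have h2 : ∑ k, l k * gapSum l k = ∑ k, ∑ j, l j * (l j - l k)⁻¹ := by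
    rw [h1, Finset.sum_comm]
  have h3 : ∑ k, ∑ j, (l k * (l k - l j)⁻¹ + l j * (l j - l k)⁻¹)
      = ∑ k : Fin p, ∑ j, if k = j then 0 else 1 := by
    refine Finset.sum_congr rfl fun k _ => Finset.sum_congr rfl fun j _ => ?_
    split_ifs with h
    · simp [h]
    · have h4 : l k - l j ≠ 0 := sub_ne_zero.2 (hl.ne h)
      rw [← neg_sub (l k) (l j), inv_neg]
      field_simp
      ring
  simp only [Finset.sum_add_distrib] at h3
  rw [← h1, ← h2] at h3
  have h5 : ∀ k : Fin p, ∑ j, (if k = j then (0 : ℝ) else 1) = p - 1 := by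
    intro k
    have : ∀ j, (if k = j then (0 : ℝ) else 1) = 1 - if k = j then 1 else 0 := by
      intro j; split_ifs <;> simp
    simp [this, Finset.sum_sub_distrib]
  simp only [h5, Finset.sum_const, Finset.card_univ, Fintype.card_fin, nsmul_eq_mul] at h3
  linarith

/-- The identity `∑ a / ((a - b) (a - c)) = 0` over the cyclic permutations of `a, b, c` removes
all terms with three distinct eigenvalues. -/
lemma sum_mul_gapSum_sq {l : Fin p → ℝ} (hl : Function.Injective l) :
    ∑ k, l k * gapSum l k ^ 2 = ∑ k, l k * ∑ j, (l k - l j)⁻¹ ^ 2 := by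
  set F : Fin p → Fin p → Fin p → ℝ := fun k i j =>
    if i = j then 0 else l k * ((l k - l i)⁻¹ * (l k - l j)⁻¹)
  have h1 : ∑ k, l k * gapSum l k ^ 2 - ∑ k, l k * ∑ j, (l k - l j)⁻¹ ^ 2
      = ∑ k, ∑ i, ∑ j, F k i j := by
    rw [← Finset.sum_sub_distrib]
    refine Finset.sum_congr rfl fun k _ => ?_
    rw [gapSum, pow_two, Finset.sum_mul_sum, ← mul_sub, ← Finset.sum_sub_distrib, Finset.mul_sum]
    refine Finset.sum_congr rfl fun i _ => ?_
    have h2 : (l k - l i)⁻¹ ^ 2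
        = ∑ j, if i = j then (l k - l i)⁻¹ * (l k - l j)⁻¹ else 0 := by
      simp [pow_two]
    rw [h2, ← Finset.sum_sub_distrib, Finset.mul_sum]
    refine Finset.sum_congr rfl fun j _ => ?_
    simp only [F]
    split_ifs <;> simp
  have hcyc : ∀ k i j, F k i j + F i j k + F j k i = 0 := by
    intro k i j
    by_cases hki : k = i
    · simp [F, hki]
    by_cases hij : i = j
    · simp [F, hij]
    by_cases hjk : j = k
    · simp [F, hjk]
    have a1 : l k - l i ≠ 0 := sub_ne_zero.2 (hl.ne hki)
    have a2 : l i - l j ≠ 0 := sub_ne_zero.2 (hl.ne hij)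
    have a3 : l j - l k ≠ 0 := sub_ne_zero.2 (hl.ne hjk)
    simp only [F, hki, hij, hjk, if_false]
    rw [← neg_sub (l k) (l i), ← neg_sub (l i) (l j), ← neg_sub (l j) (l k)]
    simp only [inv_neg]
    field_simp
    ring
  have hrot : ∀ H : Fin p → Fin p → Fin p → ℝ,
      ∑ k, ∑ i, ∑ j, H i j k = ∑ k, ∑ i, ∑ j, H k i j := fun H => by
    rw [Finset.sum_comm]
    exact Finset.sum_congr rfl fun i _ => Finset.sum_comm
  have h2 := hrot F
  have h3 := hrot fun a b c => F b c a
  have h4 : ∑ k, ∑ i, ∑ j, (F k i j + F i j k + F j k i) = 0 :=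
    Finset.sum_eq_zero fun k _ => Finset.sum_eq_zero fun i _ => Finset.sum_eq_zero fun j _ =>
      hcyc k i j
  simp only [Finset.sum_add_distrib] at h4
  linarith

/-- The Laplacian of `logBarrier (gramEig Z)`, that is, the divergence of the `invariantField` with
coefficients `2 ∂_k logBarrier`, after cancellation. -/
noncomputable def logBarrierDivergence (m : ℕ) (l : Fin p → ℝ) : ℝ :=
  4 * ((m : ℝ) - p) * ∑ k, (l k)⁻¹ + 4 * ∑ k, l k * gapSum l k ^ 2

lemma partialDeriv_logBarrierGrad {l : Fin p → ℝ} (hl : l ∈ strictlyOrderedPositive p)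
    (k : Fin p) : partialDeriv (fun l => 2 * logBarrierGrad k l) k l
      = -2 * (∑ j, (l k - l j)⁻¹ ^ 2 + (l k)⁻¹ ^ 2) := by
  rw [partialDeriv, lineDeriv]
  let u : ℝ → Fin p → ℝ := fun s => l + s • Pi.single k (1 : ℝ)
  have huk : ∀ s, u s k = l k + s := fun s => by simp [u]
  have hgap : ∀ j, HasDerivAt (fun s : ℝ => (u s k - u s j)⁻¹) (-(l k - l j)⁻¹ ^ 2) 0 := by
    intro j
    by_cases hj : j = k
    · subst hj
      simpa using hasDerivAt_const (0 : ℝ) (0 : ℝ)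
    · have h1 : HasDerivAt (fun s : ℝ => l k + s - l j) 1 0 :=
        ((hasDerivAt_id (0 : ℝ)).const_add (l k)).sub_const (l j)
      have h2 := h1.inv (by simpa using sub_ne_zero.2 (hl.1.injective.ne (Ne.symm hj)))
      have h3 : (fun s : ℝ => (u s k - u s j)⁻¹) = (fun s : ℝ => l k + s - l j)⁻¹ := by
        funext s
        simp [u, Pi.single_eq_of_ne hj]
      rw [h3]
      refine h2.congr_deriv ?_
      simp [neg_div]
  have hinv : HasDerivAt (fun s : ℝ => (u s k)⁻¹)
      (-(l k)⁻¹ ^ 2) 0 := by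
    have h1 : HasDerivAt (fun s : ℝ => l k + s) 1 0 := (hasDerivAt_id (0 : ℝ)).const_add (l k)
    have h2 := h1.inv (by simpa using (hl.2 k).ne')
    have h3 : (fun s : ℝ => (u s k)⁻¹) = (fun s : ℝ => l k + s)⁻¹ := by
      funext s
      rw [huk, Pi.inv_apply]
    rw [h3]
    refine h2.congr_deriv ?_
    simp [neg_div]
  have h :=
    (((HasDerivAt.fun_sum fun j (_ : j ∈ Finset.univ) => hgap j).add hinv).const_mul 2).deriv
  refine Eq.trans h ?_
  rw [Finset.sum_neg_distrib]
  ring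

lemma fieldDivergence_logBarrierGrad (m : ℕ) {l : Fin p → ℝ}
    (hl : l ∈ strictlyOrderedPositive p) :
    fieldDivergence m (fun k l => 2 * logBarrierGrad k l) l = logBarrierDivergence m l := by
  have hinj := hl.1.injective
  rw [fieldDivergence_eq hinj]
  have h1 : ∀ k, ∑ j ∈ Finset.univ.erase k,
      2 * (2 * logBarrierGrad k l) * (l j + l k) / (l k - l j)
      = 4 * logBarrierGrad k l * (2 * l k * gapSum l k - (p - 1)) := by
    intro k
    have h2 : ∀ j ∈ Finset.univ.erase k, 2 * (2 * logBarrierGrad k l) * (l j + l k) / (l k - l j)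
        = 4 * logBarrierGrad k l * (2 * l k * (l k - l j)⁻¹ - 1) := by
      intro j hj
      have : l k - l j ≠ 0 := sub_ne_zero.2 (hinj.ne (Finset.ne_of_mem_erase hj).symm)
      field_simp
      ring
    rw [Finset.sum_congr rfl h2, ← Finset.mul_sum, Finset.sum_sub_distrib, ← Finset.mul_sum,
      Finset.sum_erase _ (by simp)]
    have hp : 1 ≤ p := k.pos
    simp [gapSum, Nat.cast_sub hp]
  have h3 : ∀ k, 4 * logBarrierGrad k l * (2 * l k * gapSum l k - (p - 1))
      + 2 * l k * (-2 * (∑ j, (l k - l j)⁻¹ ^ 2 + (l k)⁻¹ ^ 2))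
      = 8 * (l k * gapSum l k ^ 2) - 4 * (l k * ∑ j, (l k - l j)⁻¹ ^ 2)
        + (12 - 4 * (p : ℝ)) * gapSum l k - 4 * (p : ℝ) * (l k)⁻¹ := by
    intro k
    have := (hl.2 k).ne'
    rw [logBarrierGrad]
    field_simp
    ring
  simp only [h1, partialDeriv_logBarrierGrad hl, h3]
  simp only [Finset.sum_add_distrib, Finset.sum_sub_distrib, ← Finset.mul_sum, logBarrierGrad,
    sum_gapSum, ← sum_mul_gapSum_sq hinj, logBarrierDivergence]
  ring

lemma logBarrierDivergence_nonneg {m : ℕ} (hpm : p ≤ m) {l : Fin p → ℝ}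
    (hl : l ∈ strictlyOrderedPositive p) : 0 ≤ logBarrierDivergence m l := by
  have h : (0 : ℝ) ≤ m - p := sub_nonneg.2 (by exact_mod_cast hpm)
  have h1 : 0 ≤ ∑ k, (l k)⁻¹ := Finset.sum_nonneg fun k _ => (inv_pos.2 (hl.2 k)).le
  have h2 : 0 ≤ ∑ k, l k * gapSum l k ^ 2 :=
    Finset.sum_nonneg fun k _ => mul_nonneg (hl.2 k).le (sq_nonneg _)
  rw [logBarrierDivergence]
  positivity

lemma sum_mul_logBarrierGrad {l : Fin p → ℝ} (hl : l ∈ strictlyOrderedPositive p) :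
    ∑ k, l k * logBarrierGrad k l = p * (p + 1) / 2 := by
  simp only [logBarrierGrad, mul_add, Finset.sum_add_distrib, sum_mul_gapSum hl.1.injective]
  rw [Finset.sum_congr rfl fun k _ => mul_inv_cancel₀ (hl.2 k).ne']
  simp
  ring

lemma differentiableAt_gap_inv {l : Fin p → ℝ} (hl : l ∈ strictlyOrderedPositive p)
    (k j : Fin p) : DifferentiableAt ℝ (fun l : Fin p → ℝ => (l k - l j)⁻¹) l := by
  by_cases hj : j = k
  · subst hj
    simp
  · exact DifferentiableAt.inv (by fun_prop) (sub_ne_zero.2 (hl.1.injective.ne (Ne.symm hj)))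

lemma differentiableAt_gapSum {l : Fin p → ℝ} (hl : l ∈ strictlyOrderedPositive p)
    (k : Fin p) : DifferentiableAt ℝ (fun l => gapSum l k) l :=
  DifferentiableAt.fun_sum fun j _ => differentiableAt_gap_inv hl k j

lemma differentiableAt_apply_inv {l : Fin p → ℝ} (hl : l ∈ strictlyOrderedPositive p)
    (k : Fin p) : DifferentiableAt ℝ (fun l : Fin p → ℝ => (l k)⁻¹) l :=
  DifferentiableAt.inv (by fun_prop) (hl.2 k).ne'

lemma differentiableAt_logBarrierGrad {l : Fin p → ℝ} (hl : l ∈ strictlyOrderedPositive p)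
    (k : Fin p) : DifferentiableAt ℝ (logBarrierGrad k) l :=
  (differentiableAt_gapSum hl k).add (differentiableAt_apply_inv hl k)

lemma continuousOn_logBarrierDivergence (m : ℕ) :
    ContinuousOn (logBarrierDivergence m) (strictlyOrderedPositive p) := by
  intro l hl
  have h1 : ∀ k, ContinuousAt (fun l : Fin p → ℝ => (l k)⁻¹) l := fun k =>
    (differentiableAt_apply_inv hl k).continuousAt
  have h2 : ∀ k, ContinuousAt (fun l => gapSum l k) l := fun k =>
    (differentiableAt_gapSum hl k).continuousAt
  refine ContinuousAt.continuousWithinAt ?_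
  unfold logBarrierDivergence
  refine ContinuousAt.add (continuousAt_const.mul (tendsto_finsetSum _ fun k _ => h1 k))
    (continuousAt_const.mul (tendsto_finsetSum _ fun k _ => ?_))
  exact (continuous_apply k).continuousAt.mul ((h2 k).pow 2)

lemma hasFDerivAt_logBarrier {l : Fin p → ℝ} (hl : l ∈ strictlyOrderedPositive p) :
    ∃ T : (Fin p → ℝ) →L[ℝ] ℝ, HasFDerivAt logBarrier T l ∧
      ∀ v, T v = ∑ k, logBarrierGrad k l * v k := by
  have hproj : ∀ k : Fin p, HasFDerivAt (fun l : Fin p → ℝ => l k)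
      (ContinuousLinearMap.proj (R := ℝ) (φ := fun _ : Fin p => ℝ) k) l := fun k =>
    hasFDerivAt_apply k l
  refine ⟨_, HasFDerivAt.fun_sum fun k _ => (HasFDerivAt.fun_sum fun b hb =>
    ((hproj k).sub (hproj b)).log (sub_ne_zero.2 (hl.1.injective.ne
      (Finset.mem_Ioi.1 hb).ne))).add ((hproj k).log (hl.2 k).ne'), fun v => ?_⟩
  have h1 : ∑ k, gapSum l k * v k = ∑ k, ∑ b ∈ Finset.Ioi k, (l k - l b)⁻¹ * (v k - v b) := by
    have h2 := sum_sum_erase_eq fun k j => (l k - l j)⁻¹ * v k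
    have h3 : ∀ k, ∑ j ∈ Finset.univ.erase k, (l k - l j)⁻¹ * v k = gapSum l k * v k := by
      intro k
      rw [Finset.sum_erase _ (by simp), gapSum, Finset.sum_mul]
    simp only [h3] at h2
    rw [h2]
    refine Finset.sum_congr rfl fun k _ => Finset.sum_congr rfl fun b _ => ?_
    rw [← neg_sub (l k) (l b), inv_neg]
    ring
  simp only [logBarrierGrad, add_mul, Finset.sum_add_distrib, h1]
  simp

/-- The exponential of the barrier, a polynomial that vanishes on the boundary of the chamber. -/
lemma exp_logBarrier {l : Fin p → ℝ} (hl : l ∈ strictlyOrderedPositive p) :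
    Real.exp (logBarrier l) = ∏ k, ((∏ b ∈ Finset.Ioi k, (l k - l b)) * l k) := by
  rw [logBarrier, Real.exp_sum]
  refine Finset.prod_congr rfl fun k _ => ?_
  rw [Real.exp_add, Real.exp_sum, Real.exp_log (hl.2 k)]
  congr 1
  exact Finset.prod_congr rfl fun b hb =>
    Real.exp_log (sub_pos.2 (hl.1 (Finset.mem_Ioi.1 hb)))

end LogBarrier

/-! ### The barrier on the set of regular matrices -/

section RegularBarrier

variable {m p : ℕ}

lemma reInner_eq_sum (X Y : Matrix (Fin m) (Fin p) ℂ) :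
    reInner X Y = ∑ ij : Fin m × Fin p, (star (X ij.1 ij.2) * Y ij.1 ij.2).re := by
  rw [reInner, Matrix.trace, Complex.re_sum, Fintype.sum_prod_type_right]
  refine Finset.sum_congr rfl fun j _ => ?_
  rw [Matrix.diag_apply, Matrix.mul_apply, Complex.re_sum]
  rfl

lemma reInner_self_eq_sum (X : Matrix (Fin m) (Fin p) ℂ) :
    reInner X X = ∑ ij : Fin m × Fin p, ‖X ij.1 ij.2‖ ^ 2 := by
  rw [reInner_eq_sum]
  refine Finset.sum_congr rfl fun ij _ => ?_
  rw [Complex.sq_norm, Complex.normSq_apply]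
  simp

lemma reInner_self_nonneg (X : Matrix (Fin m) (Fin p) ℂ) : 0 ≤ reInner X X := by
  rw [reInner_self_eq_sum]
  positivity

lemma reInner_sq_le (X Y : Matrix (Fin m) (Fin p) ℂ) :
    reInner X Y ^ 2 ≤ reInner X X * reInner Y Y := by
  rw [reInner_self_eq_sum, reInner_self_eq_sum]
  refine le_trans ?_ (Finset.sum_mul_sq_le_sq_mul_sq _ _ _)
  rw [sq_le_sq, reInner_eq_sum]
  refine le_trans ?_ (le_abs_self _)
  refine (Finset.abs_sum_le_sum_abs _ _).trans (Finset.sum_le_sum fun ij _ => ?_)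
  refine (Complex.abs_re_le_norm _).trans_eq ?_
  rw [norm_mul, norm_star]

lemma continuous_reInner_self :
    Continuous fun X : Matrix (Fin m) (Fin p) ℂ => reInner X X := by
  simp only [reInner_self_eq_sum]
  fun_prop

lemma isCompact_setOf_reInner_self_le (M : ℝ) :
    IsCompact {X : Matrix (Fin m) (Fin p) ℂ | reInner X X ≤ M} := by
  refine Metric.isCompact_of_isClosed_isBounded
    (isClosed_le continuous_reInner_self continuous_const)
    ((Metric.isBounded_closedBall (x := (0 : Matrix (Fin m) (Fin p) ℂ))
      (r := Real.sqrt M)).subset fun X hX => ?_)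
  rw [mem_closedBall_zero_iff, Matrix.norm_le_iff (Real.sqrt_nonneg _)]
  intro i j
  refine Real.le_sqrt_of_sq_le ?_
  refine le_trans ?_ (hX : reInner X X ≤ M)
  rw [reInner_self_eq_sum]
  exact Finset.single_le_sum (f := fun ij : Fin m × Fin p => ‖X ij.1 ij.2‖ ^ 2)
    (fun _ _ => by positivity) (Finset.mem_univ (i, j))

lemma sum_gramEig (Z : Matrix (Fin m) (Fin p) ℂ) : ∑ k, gramEig Z k = reInner Z Z := by
  have h := trace_gram_pow Z 1
  simp only [pow_one] at h
  rw [reInner, h, Complex.re_sum]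
  simp

lemma exists_hasFDerivAt_comp_pi {ι E : Type*} [Fintype ι] [NormedAddCommGroup E] [NormedSpace ℝ E]
    {g : (ι → ℝ) → ℝ} {f : E → ι → ℝ} {T : (ι → ℝ) →L[ℝ] ℝ} {f' : ι → E →L[ℝ] ℝ} {x : E}
    (hg : HasFDerivAt g T (f x)) (hf : HasFDerivAt f (ContinuousLinearMap.pi f') x) :
    ∃ S : E →L[ℝ] ℝ, HasFDerivAt (fun y => g (f y)) S x ∧ ∀ X, S X = T fun k => f' k X :=
  ⟨_, hg.comp x hf, fun _ => rfl⟩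

lemma exists_hasFDerivAt_logBarrier_gramEig {Z : Matrix (Fin m) (Fin p) ℂ}
    (hZ : Z ∈ regularSet m p) : ∃ T : Matrix (Fin m) (Fin p) ℂ →L[ℝ] ℝ,
      HasFDerivAt (fun Z => logBarrier (gramEig Z)) T Z ∧
      ∀ X, T X = ∑ k, logBarrierGrad k (gramEig Z) * gramEigDeriv Z k X := by
  obtain ⟨T, hT, hT'⟩ := hasFDerivAt_logBarrier hZ
  obtain ⟨S, hS, hS'⟩ := exists_hasFDerivAt_comp_pi hT (hasFDerivAt_gramEig hZ)
  exact ⟨S, hS, fun X => (hS' X).trans (hT' _)⟩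

lemma exists_hasFDerivAt_sum_gramEig {Z : Matrix (Fin m) (Fin p) ℂ}
    (hZ : Z ∈ regularSet m p) : ∃ T : Matrix (Fin m) (Fin p) ℂ →L[ℝ] ℝ,
      HasFDerivAt (fun Z => ∑ k, gramEig Z k) T Z ∧
      ∀ X, T X = ∑ k, gramEigDeriv Z k X := by
  obtain ⟨S, hS, hS'⟩ := exists_hasFDerivAt_comp_pi
    (HasFDerivAt.fun_sum fun k (_ : k ∈ Finset.univ) =>
      hasFDerivAt_apply (𝕜 := ℝ) k (gramEig Z)) (hasFDerivAt_gramEig hZ)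
  exact ⟨S, hS, fun X => (hS' X).trans (clm_sum_apply _ _ _)⟩

/-- On `r ≤ M`, `t ≥ -M` the polynomial `exp t` of the eigenvalues is at least `exp (-M)`; its zeros
are the matrices that are not regular. -/
lemma exists_isCompact_subset_regularSet (M : ℝ) :
    ∃ C, IsCompact C ∧ C ⊆ regularSet m p ∧ ∀ Z ∈ regularSet m p, ∑ k, gramEig Z k ≤ M →
      -M ≤ logBarrier (gramEig Z) → Z ∈ C := by
  have hc : Continuous fun Z : Matrix (Fin m) (Fin p) ℂ =>
      ∏ k, ((∏ b ∈ Finset.Ioi k, (gramEig Z k - gramEig Z b)) * gramEig Z k) := by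
    have h : ∀ k, Continuous fun Z : Matrix (Fin m) (Fin p) ℂ => gramEig Z k := fun k =>
      (continuous_apply k).comp continuous_gramEig
    exact continuous_finsetProd _ fun k _ =>
      (continuous_finsetProd _ fun b _ => (h k).sub (h b)).mul (h k)
  refine ⟨{Z | reInner Z Z ≤ M} ∩ {Z | Real.exp (-M)
      ≤ ∏ k, ((∏ b ∈ Finset.Ioi k, (gramEig Z k - gramEig Z b)) * gramEig Z k)},
    (isCompact_setOf_reInner_self_le M).inter_right (isClosed_le continuous_const hc),
    fun Z hZ => ?_, fun Z hZ h1 h2 => ⟨?_, ?_⟩⟩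
  · have h1 := ((Real.exp_pos _).trans_le hZ.2).ne'
    simp only [Finset.prod_ne_zero_iff, mul_ne_zero_iff, Finset.mem_univ, true_implies,
      Finset.mem_Ioi] at h1
    refine mem_regularSet_iff.2 ⟨?_, fun k => (h1 k).2⟩
    have h2 : ∀ k b, k < b → gramEig Z k ≠ gramEig Z b := fun k b hkb =>
      sub_ne_zero.1 ((h1 k).1 b hkb)
    intro k b hkb
    by_contra hne
    rcases lt_or_gt_of_ne hne with h | h
    · exact h2 k b h hkb
    · exact h2 b k h hkb.symm
  · change reInner Z Z ≤ M
    rwa [← sum_gramEig]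
  · change Real.exp (-M) ≤ _
    rw [← exp_logBarrier hZ]
    exact Real.exp_le_exp.2 h2

/-- The squared length of the gradient of `logBarrier (gramEig Z)`. -/
noncomputable def logBarrierEnergy (l : Fin p → ℝ) : ℝ := ∑ k, l k * (2 * logBarrierGrad k l) ^ 2

/-- The function `t = logBarrier (gramEig Z)`, together with `r = ∑ l_k = |Z|²`, is a barrier on the
set of regular matrices. The hypothesis `p ≤ m` makes `t` subharmonic. -/
theorem exists_isBarrier_regularSet (hpm : p ≤ m) :
    ∃ r' t' : Matrix (Fin m) (Fin p) ℂ → Matrix (Fin m) (Fin p) ℂ →L[ℝ] ℝ,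
      IsBarrier (regularSet m p) (fun X => reInner X X) (fun Z => ∑ k, gramEig Z k)
        (fun Z => logBarrier (gramEig Z)) r' t'
        (invariantField fun k l => 2 * logBarrierGrad k l)
        (fun Z => logBarrierEnergy (gramEig Z)) (fun Z => logBarrierDivergence m (gramEig Z))
        (2 * p * (p + 1)) := by
  have hr := fun (Z : Matrix (Fin m) (Fin p) ℂ) (hZ : Z ∈ regularSet m p) =>
    exists_hasFDerivAt_sum_gramEig hZ
  have ht := fun (Z : Matrix (Fin m) (Fin p) ℂ) (hZ : Z ∈ regularSet m p) =>
    exists_hasFDerivAt_logBarrier_gramEig hZ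
  choose! r' hr hr' using hr
  choose! t' ht ht' using ht
  refine ⟨r', t', ?_⟩
  exact
  { exists_isCompact := exists_isCompact_subset_regularSet
    hasFDerivAt_r := hr
    hasFDerivAt_t := ht
    hasFDerivAt_V := fun Z hZ => by
      rw [← fieldDivergence_logBarrierGrad m hZ]
      exact exists_hasFDerivAt_invariantField_trace hZ fun k =>
        (differentiableAt_logBarrierGrad hZ k).const_mul 2
    deriv_r_V := fun Z hZ => by
      refine (hr' Z hZ _).trans ?_
      simp only [gramEigDeriv_invariantField]
      have h := sum_mul_logBarrierGrad hZ
      have h2 : ∀ k, 2 * gramEig Z k * (2 * logBarrierGrad k (gramEig Z))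
          = 4 * (gramEig Z k * logBarrierGrad k (gramEig Z)) := fun k => by ring
      simp only [h2, ← Finset.mul_sum, h]
      ring
    deriv_t_V := fun Z hZ => by
      refine (ht' Z hZ _).trans ?_
      simp only [gramEigDeriv_invariantField, logBarrierEnergy]
      exact Finset.sum_congr rfl fun k _ => by ring
    nonneg_r := fun Z _ => Finset.sum_nonneg fun k _ => gramEig_nonneg Z k
    nonneg_a := by positivity
    nonneg_e := fun Z _ =>
      Finset.sum_nonneg fun k _ => mul_nonneg (gramEig_nonneg Z k) (sq_nonneg _)
    nonneg_d := fun Z hZ => logBarrierDivergence_nonneg hpm hZ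
    continuous_r :=
      continuous_finsetSum _ fun k _ => (continuous_apply k).comp continuous_gramEig
    continuousOn_e := by
      refine ContinuousOn.comp (g := logBarrierEnergy) (t := strictlyOrderedPositive p)
        (fun l hl => ContinuousAt.continuousWithinAt ?_) continuous_gramEig.continuousOn
        fun Z hZ => hZ
      exact tendsto_finsetSum _ fun k _ => (continuous_apply k).continuousAt.mul
        ((continuousAt_const.mul (differentiableAt_logBarrierGrad hl k).continuousAt).pow 2)
    continuousOn_d := (continuousOn_logBarrierDivergence m).comp continuous_gramEig.continuousOn
      fun Z hZ => hZ
    sq_deriv_r_le := fun Z hZ X => by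
      have h1 := reInner_sq_le (invariantField (fun _ _ => 2) Z) X
      rw [reInner_invariantField_self, reInner_invariantField] at h1
      simp only [mul_div_cancel₀ _ (two_ne_zero' ℝ), ← Finset.sum_mul] at h1
      refine le_trans (le_of_eq ?_) (h1.trans (le_of_eq ?_))
      · exact (congrArg (· ^ 2) (hr' Z hZ X)).trans (by simp)
      · ring
    sq_deriv_t_le := fun Z hZ X => by
      have h1 := reInner_sq_le (invariantField (fun k l => 2 * logBarrierGrad k l) Z) X
      rw [reInner_invariantField_self, reInner_invariantField] at h1
      refine le_trans (le_of_eq ?_) h1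
      refine (congrArg (· ^ 2) (ht' Z hZ X)).trans ?_
      congr 1
      exact Finset.sum_congr rfl fun k _ => by ring }

end RegularBarrier

/-! ### Integration by parts for the Gaussian weight -/

section Gaussian

variable {m p : ℕ}

lemma exists_hasFDerivAt_gaussian {E : Type*} [NormedAddCommGroup E] [NormedSpace ℝ E]
    (B : E →L[ℝ] E →L[ℝ] ℝ) (hB : ∀ x y, B x y = B y x) (ξ : E) (c : ℝ) (x : E) :
    ∃ T : E →L[ℝ] ℝ, HasFDerivAt (fun x => c * Real.exp (-B (x - ξ) (x - ξ))) T x ∧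
      ∀ X, T X = -2 * (c * Real.exp (-B (x - ξ) (x - ξ))) * B (x - ξ) X := by
  have h1 : HasFDerivAt (fun x => x - ξ) (ContinuousLinearMap.id ℝ E) x :=
    (hasFDerivAt_id x).sub_const ξ
  obtain ⟨T, hT, hT'⟩ := exists_hasFDerivAt_bilinear B h1 h1
  refine ⟨_, (hT.neg.exp).const_mul c, fun X => ?_⟩
  have h2 := hT' X
  simp only [ContinuousLinearMap.id_apply] at h2
  simp only [smul_apply, neg_apply, smul_eq_mul, h2, hB X, Pi.neg_apply]
  ring

/-- The divergence of `x ↦ x - ξ + V x`. -/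
lemma exists_hasFDerivAt_sub_add_trace {E : Type*} [NormedAddCommGroup E] [NormedSpace ℝ E]
    [FiniteDimensional ℝ E] {V : E → E} {T : E →L[ℝ] E} {x : E} (hV : HasFDerivAt V T x) (ξ : E) :
    ∃ S : E →L[ℝ] E, HasFDerivAt (fun x => x - ξ + V x) S x ∧
      LinearMap.trace ℝ E S.toLinearMap
        = Module.finrank ℝ E + LinearMap.trace ℝ E T.toLinearMap := by
  refine ⟨_, ((hasFDerivAt_id x).sub_const ξ).add hV, ?_⟩
  have : (ContinuousLinearMap.id ℝ E + T).toLinearMap = LinearMap.id + T.toLinearMap := rfl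
  rw [this, map_add, LinearMap.trace_id]

/-- The real inner product of matrices as a continuous bilinear map. -/
noncomputable def reInnerCLM (m p : ℕ) :
    Matrix (Fin m) (Fin p) ℂ →L[ℝ] Matrix (Fin m) (Fin p) ℂ →L[ℝ] ℝ :=
  LinearMap.toContinuousBilinearMap (LinearMap.mk₂ ℝ reInner
    (fun X Y Z => by
      simp [reInner, Matrix.conjTranspose_add, Matrix.add_mul])
    (fun c X Y => by simp [reInner, Matrix.conjTranspose_smul])
    (fun X Y Z => by simp [reInner, Matrix.mul_add])
    fun c X Y => by simp [reInner])

lemma reInner_comm (X Y : Matrix (Fin m) (Fin p) ℂ) : reInner X Y = reInner Y X := by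
  rw [reInner_eq_sum, reInner_eq_sum]
  refine Finset.sum_congr rfl fun ij _ => ?_
  simp
  ring

lemma reInner_add_right (X Y Z : Matrix (Fin m) (Fin p) ℂ) :
    reInner X (Y + Z) = reInner X Y + reInner X Z := by
  simp [reInner, Matrix.mul_add]

lemma reInner_add_self (X Y : Matrix (Fin m) (Fin p) ℂ) :
    reInner (X + Y) (X + Y) = reInner X X + 2 * reInner X Y + reInner Y Y := by
  rw [reInner_add_right, reInner_comm _ X, reInner_comm _ Y, reInner_add_right, reInner_add_right,
    reInner_comm Y X]
  ring

/-- The density of `ℂN(Ξ, I ⊗ I)`. -/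
noncomputable def gaussianWeight (Ξ Z : Matrix (Fin m) (Fin p) ℂ) : ℝ :=
  Real.pi⁻¹ ^ (m * p) * Real.exp (-reInner (Z - Ξ) (Z - Ξ))

lemma gaussianWeight_nonneg (Ξ Z : Matrix (Fin m) (Fin p) ℂ) : 0 ≤ gaussianWeight Ξ Z := by
  have := Real.pi_pos
  unfold gaussianWeight
  positivity

lemma gaussianWeight_le (Ξ Z : Matrix (Fin m) (Fin p) ℂ) :
    gaussianWeight Ξ Z ≤ Real.pi⁻¹ ^ (m * p) := by
  have := Real.pi_pos
  refine mul_le_of_le_one_right (by positivity) (Real.exp_le_one_iff.2 ?_)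
  exact neg_nonpos.2 (reInner_self_nonneg _)

lemma exists_hasFDerivAt_gaussianWeight (Ξ Z : Matrix (Fin m) (Fin p) ℂ) :
    ∃ T : Matrix (Fin m) (Fin p) ℂ →L[ℝ] ℝ, HasFDerivAt (gaussianWeight Ξ) T Z ∧
      ∀ X, T X = -2 * gaussianWeight Ξ Z * reInner (Z - Ξ) X :=
  exists_hasFDerivAt_gaussian (reInnerCLM m p) reInner_comm Ξ _ Z

lemma finrank_real_matrix : (Module.finrank ℝ (Matrix (Fin m) (Fin p) ℂ) : ℝ) = 2 * m * p := by
  rw [Module.finrank_matrix, Complex.finrank_real_complex, Fintype.card_fin, Fintype.card_fin]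
  push_cast
  ring

/-- The error `Z (I + U H(L) U*) - Ξ` of the estimate. -/
noncomputable def estimationError (h : Fin p → (Fin p → ℝ) → ℝ) (Ξ Z : Matrix (Fin m) (Fin p) ℂ) :
    Matrix (Fin m) (Fin p) ℂ := Z - Ξ + invariantField h Z

lemma riskIntegrand_eq (m : ℕ) (h : Fin p → (Fin p → ℝ) → ℝ) (l : Fin p → ℝ) :
    riskIntegrand m h l = fieldDivergence m h l + ∑ k, l k * h k l ^ 2 := by
  rw [riskIntegrand, fieldDivergence, ← Finset.sum_add_distrib]

lemma exists_hasFDerivAt_estimationError {h : Fin p → (Fin p → ℝ) → ℝ}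
    (hh : ∀ k, DifferentiableOn ℝ (h k) (strictlyOrderedPositive p))
    (Ξ : Matrix (Fin m) (Fin p) ℂ) {Z : Matrix (Fin m) (Fin p) ℂ} (hZ : Z ∈ regularSet m p) :
    ∃ T : Matrix (Fin m) (Fin p) ℂ →L[ℝ] Matrix (Fin m) (Fin p) ℂ,
      HasFDerivAt (estimationError h Ξ) T Z ∧ LinearMap.trace ℝ _ T.toLinearMap
        = 2 * m * p + fieldDivergence m h (gramEig Z) := by
  obtain ⟨T, hT, hTt⟩ := exists_hasFDerivAt_invariantField_trace hZ fun k =>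
    (hh k).differentiableAt (isOpen_strictlyOrderedPositive.mem_nhds hZ)
  obtain ⟨S, hS, hSt⟩ := exists_hasFDerivAt_sub_add_trace hT Ξ
  exact ⟨S, hS, hSt.trans (congrArg₂ (· + ·) finrank_real_matrix hTt)⟩

-- The topology is given explicitly: the Borel sets are to be those of the norm topology, which is
-- only definitionally the product topology on matrices.
lemma ae_mem_regularSet (hpm : p ≤ m)
    [MeasurableSpace (Matrix (Fin m) (Fin p) ℂ)]
    [@BorelSpace (Matrix (Fin m) (Fin p) ℂ) PseudoMetricSpace.toUniformSpace.toTopologicalSpace _]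
    (μ : Measure (Matrix (Fin m) (Fin p) ℂ))
    [@Measure.IsAddHaarMeasure (Matrix (Fin m) (Fin p) ℂ) _
      PseudoMetricSpace.toUniformSpace.toTopologicalSpace _ μ] :
    ∀ᵐ X ∂μ, X ∈ regularSet m p := by
  obtain ⟨Z₀, h₀⟩ := exists_mem_regularSet (m := m) (p := p) hpm
  exact ae_mem_of_finite_line μ isOpen_regularSet Z₀ (finite_setOf_add_smul_notMem_regularSet h₀)

/-- If `2 m p + B - |Z - Ξ|²`, where `B` is the risk integrand, is integrable for the Gaussian weight,
then so is the squared error, and the two integrals agree. -/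
theorem integral_gaussianWeight_mul_reInner_estimationError
    [MeasurableSpace (Matrix (Fin m) (Fin p) ℂ)]
    [@BorelSpace (Matrix (Fin m) (Fin p) ℂ) PseudoMetricSpace.toUniformSpace.toTopologicalSpace _]
    (μ : Measure (Matrix (Fin m) (Fin p) ℂ))
    [@Measure.IsAddHaarMeasure (Matrix (Fin m) (Fin p) ℂ) _
      PseudoMetricSpace.toUniformSpace.toTopologicalSpace _ μ] (hpm : p ≤ m)
    {h : Fin p → (Fin p → ℝ) → ℝ}
    (hh : ∀ k, DifferentiableOn ℝ (h k) (strictlyOrderedPositive p))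
    (Ξ : Matrix (Fin m) (Fin p) ℂ)
    (hr : Integrable (fun Z => gaussianWeight Ξ Z * reInner Z Z) μ)
    (hf : Integrable (fun Z => gaussianWeight Ξ Z * (2 * m * p + riskIntegrand m h (gramEig Z)
      - reInner (Z - Ξ) (Z - Ξ))) μ) :
    Integrable (fun Z => gaussianWeight Ξ Z
        * reInner (estimationError h Ξ Z) (estimationError h Ξ Z)) μ ∧
      ∫ Z, gaussianWeight Ξ Z * reInner (estimationError h Ξ Z) (estimationError h Ξ Z) ∂μ
        = ∫ Z, gaussianWeight Ξ Z * (2 * m * p + riskIntegrand m h (gramEig Z)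
          - reInner (Z - Ξ) (Z - Ξ)) ∂μ := by
  have hrestrict : μ.restrict (regularSet m p) = μ :=
    Measure.restrict_eq_self_of_ae_mem (ae_mem_regularSet hpm μ)
  obtain ⟨r', t', hB⟩ := exists_isBarrier_regularSet (m := m) (p := p) hpm
  have hφ := exists_hasFDerivAt_gaussianWeight Ξ
  choose φ' hφ hφ' using hφ
  have hfin : ∀ M : ℝ, μ {Z | ∑ k, gramEig Z k ≤ M} < ⊤ := by
    intro M
    simp only [sum_gramEig]
    exact @IsCompact.measure_lt_top _ _ PseudoMetricSpace.toUniformSpace.toTopologicalSpace μ _ _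
      (isCompact_setOf_reInner_self_le M)
  have hdiv : ∀ Z ∈ regularSet m p,
      gaussianWeight Ξ Z * (2 * m * p + fieldDivergence m h (gramEig Z))
        + φ' Z (estimationError h Ξ Z)
      = gaussianWeight Ξ Z * ((2 * m * p + riskIntegrand m h (gramEig Z)
        - reInner (Z - Ξ) (Z - Ξ)) - reInner (estimationError h Ξ Z) (estimationError h Ξ Z)) := by
    intro Z _
    refine (congrArg _ (hφ' Z _)).trans ?_
    rw [estimationError, reInner_add_self, reInner_add_right, reInner_invariantField_self,
      riskIntegrand_eq]
    ring
  have hmain := hB.integral_eq_of_divergence_eq (μ := μ) isOpen_regularSet hfin reInner_self_nonneg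
    continuous_reInner_self hφ (gaussianWeight_nonneg Ξ) (gaussianWeight_le Ξ)
    (by simp only [sum_gramEig]; exact hr.integrableOn)
    (fun Z hZ => exists_hasFDerivAt_estimationError hh Ξ hZ) hdiv hf.integrableOn
  rwa [IntegrableOn, hrestrict] at hmain

end Gaussian

/-! ### The law of a complex normal matrix -/

section Law

lemma pi_withDensity_ofReal {ι : Type*} [Fintype ι] {α : ι → Type*} [∀ i, MeasurableSpace (α i)]
    (μ : ∀ i, Measure (α i)) [∀ i, SigmaFinite (μ i)] {g : ∀ i, α i → ℝ}
    (hg : ∀ i, Integrable (g i) (μ i)) (h0 : ∀ i x, 0 ≤ g i x) :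
    Measure.pi (fun i => (μ i).withDensity fun x => ENNReal.ofReal (g i x))
      = (Measure.pi μ).withDensity fun x => ENNReal.ofReal (∏ i, g i (x i)) := by
  have hfin : ∀ i, IsFiniteMeasure ((μ i).withDensity fun x => ENNReal.ofReal (g i x)) := fun i =>
    isFiniteMeasure_withDensity_ofReal (hg i).2
  refine Measure.pi_eq fun s hs => ?_
  rw [withDensity_apply _ (MeasurableSet.univ_pi hs), Measure.restrict_pi_pi,
    ← ofReal_integral_eq_lintegral_ofReal
      (Integrable.fintype_prod_dep fun i => (hg i).restrict (s := s i))
      (Filter.Eventually.of_forall fun x => Finset.prod_nonneg fun i _ => h0 i _),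
    integral_fintype_prod_eq_prod,
    ENNReal.ofReal_prod_of_nonneg fun i _ => integral_nonneg fun x => h0 i x]
  refine Finset.prod_congr rfl fun i _ => ?_
  rw [withDensity_apply _ (hs i), ofReal_integral_eq_lintegral_ofReal (hg i).restrict
    (Filter.Eventually.of_forall (h0 i))]

/-- The image of a measure with density `φ ∘ f` under `f` has density `φ`. -/
lemma hasLaw_comp_withDensity {Ω E F : Type*} [MeasurableSpace Ω] [MeasurableSpace E]
    [MeasurableSpace F] {P : Measure Ω} {ν : Measure E} {X : Ω → E} {f : E → F} {φ : F → ENNReal}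
    (hf : Measurable f) (hφ : Measurable φ) (hX : HasLaw X (ν.withDensity fun x => φ (f x)) P) :
    HasLaw (fun ω => f (X ω)) ((ν.map f).withDensity φ) P := by
  have h : HasLaw f ((ν.map f).withDensity φ) (ν.withDensity fun x => φ (f x)) := by
    refine ⟨hf.aemeasurable, ?_⟩
    ext s hs
    rw [Measure.map_apply hf hs, withDensity_apply _ hs, withDensity_apply _ (hf hs),
      setLIntegral_map hs hφ hf]
  exact h.fun_comp hX

lemma integrable_sq_norm_mul_exp : Integrable fun z : ℂ => ‖z‖ ^ 2 * Real.exp (-‖z‖ ^ 2) := by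
  have h := Complex.integral_rpow_mul_exp_neg_rpow (p := 2) (q := 2) one_le_two (by norm_num)
  simp only [Real.rpow_two] at h
  -- The integral is not zero, hence not the default value at a function that is not integrable.
  refine not_imp_comm.1 integral_undef ?_
  rw [h]
  have := Real.Gamma_pos_of_pos (s := (2 + 2) / 2) (by norm_num)
  have := Real.pi_pos
  positivity

lemma integral_sq_norm_mul_exp : ∫ z : ℂ, ‖z‖ ^ 2 * Real.exp (-‖z‖ ^ 2) = Real.pi := by
  have h := Complex.integral_rpow_mul_exp_neg_rpow (p := 2) (q := 2) one_le_two (by norm_num)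
  simp only [Real.rpow_two] at h
  rw [h]
  norm_num

lemma integrable_exp_neg_sq_norm : Integrable fun z : ℂ => Real.exp (-‖z‖ ^ 2) := by
  have h := Complex.integral_exp_neg_rpow (p := 2) one_le_two
  simp only [Real.rpow_two] at h
  refine not_imp_comm.1 integral_undef ?_
  rw [h]
  have := Real.Gamma_pos_of_pos (s := 2 / 2 + 1) (by norm_num)
  have := Real.pi_pos
  positivity

lemma complexNormal_one (ξ : ℂ) : complexNormal ξ 1
    = volume.withDensity fun z => ENNReal.ofReal (Real.pi⁻¹ * Real.exp (-‖z - ξ‖ ^ 2)) := by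
  simp [complexNormal]

lemma integrable_complexNormal_iff (ξ : ℂ) (g : ℂ → ℝ) : Integrable g (complexNormal ξ 1)
    ↔ Integrable (fun z => Real.pi⁻¹ * Real.exp (-‖z - ξ‖ ^ 2) * g z) := by
  have := Real.pi_pos
  rw [complexNormal_one, integrable_withDensity_iff_integrable_smul' (by fun_prop)
    (Filter.Eventually.of_forall fun _ => ENNReal.ofReal_lt_top)]
  refine integrable_congr (Filter.Eventually.of_forall fun z => ?_)
  simp only [smul_eq_mul]
  rw [ENNReal.toReal_ofReal (by positivity)]

lemma integrable_sq_norm_complexNormal (ξ : ℂ) :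
    Integrable (fun z => ‖z - ξ‖ ^ 2) (complexNormal ξ 1) := by
  rw [integrable_complexNormal_iff]
  refine ((integrable_sq_norm_mul_exp.comp_sub_right ξ).const_mul Real.pi⁻¹).congr
    (Filter.Eventually.of_forall fun z => ?_)
  ring

lemma integral_sq_norm_complexNormal (ξ : ℂ) :
    ∫ z, ‖z - ξ‖ ^ 2 ∂complexNormal ξ 1 = 1 := by
  have hpi := Real.pi_pos
  rw [complexNormal_one, integral_withDensity_eq_integral_toReal_smul (by fun_prop)
    (Filter.Eventually.of_forall fun _ => ENNReal.ofReal_lt_top)]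
  have h : ∀ z : ℂ, (ENNReal.ofReal (Real.pi⁻¹ * Real.exp (-‖z - ξ‖ ^ 2))).toReal • ‖z - ξ‖ ^ 2
      = Real.pi⁻¹ * (‖z - ξ‖ ^ 2 * Real.exp (-‖z - ξ‖ ^ 2)) := by
    intro z
    rw [ENNReal.toReal_ofReal (by positivity), smul_eq_mul]
    ring
  simp only [h]
  rw [integral_const_mul,
    integral_sub_right_eq_self (fun z : ℂ => ‖z‖ ^ 2 * Real.exp (-‖z‖ ^ 2)) ξ,
    integral_sq_norm_mul_exp, inv_mul_cancel₀ hpi.ne']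

variable {Ω : Type*} [MeasurableSpace Ω] {P : Measure Ω} {m p : ℕ}
  {Ξ : Matrix (Fin m) (Fin p) ℂ} {Z : Ω → Matrix (Fin m) (Fin p) ℂ}

lemma IsStdComplexNormalMatrix.integrable_sq_norm (hZ : IsStdComplexNormalMatrix Z Ξ P)
    (i : Fin m) (j : Fin p) : Integrable (fun ω => ‖Z ω i j - Ξ i j‖ ^ 2) P := by
  have h := integrable_sq_norm_complexNormal (Ξ i j)
  rw [← (hZ.hasLaw i j).map_eq] at h
  exact h.comp_aemeasurable (hZ.hasLaw i j).aemeasurable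

lemma IsStdComplexNormalMatrix.integrable_reInner (hZ : IsStdComplexNormalMatrix Z Ξ P) :
    Integrable (fun ω => reInner (Z ω - Ξ) (Z ω - Ξ)) P := by
  simp only [reInner_self_eq_sum]
  exact integrable_finsetSum _ fun ij _ => hZ.integrable_sq_norm ij.1 ij.2

lemma IsStdComplexNormalMatrix.integral_reInner (hZ : IsStdComplexNormalMatrix Z Ξ P) :
    ∫ ω, reInner (Z ω - Ξ) (Z ω - Ξ) ∂P = m * p := by
  simp only [reInner_self_eq_sum]
  rw [integral_finsetSum _ fun ij _ => hZ.integrable_sq_norm ij.1 ij.2]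
  have h : ∀ ij : Fin m × Fin p, ∫ ω, ‖(Z ω - Ξ) ij.1 ij.2‖ ^ 2 ∂P = 1 := by
    intro ij
    have h1 := (hZ.hasLaw ij.1 ij.2).integral_comp (f := fun z => ‖z - Ξ ij.1 ij.2‖ ^ 2)
      (integrable_sq_norm_complexNormal _).1
    rw [integral_sq_norm_complexNormal] at h1
    exact h1
  rw [Finset.sum_congr rfl fun ij _ => h ij]
  simp

/-- The reshaping of vectors indexed by pairs into matrices. -/
noncomputable def ofPairs (m p : ℕ) : (Fin m × Fin p → ℂ) ≃L[ℝ] Matrix (Fin m) (Fin p) ℂ :=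
  LinearEquiv.toContinuousLinearEquiv
    { toFun := fun z => Matrix.of fun i j => z (i, j)
      invFun := fun X ij => X ij.1 ij.2
      map_add' := fun _ _ => rfl
      map_smul' := fun _ _ => rfl
      left_inv := fun _ => rfl
      right_inv := fun _ => rfl }

lemma ofPairs_apply (z : Fin m × Fin p → ℂ) (i : Fin m) (j : Fin p) :
    ofPairs m p z i j = z (i, j) := rfl

lemma gaussianWeight_ofPairs (Ξ : Matrix (Fin m) (Fin p) ℂ) (z : Fin m × Fin p → ℂ) :
    gaussianWeight Ξ (ofPairs m p z)
      = ∏ ij : Fin m × Fin p, Real.pi⁻¹ * Real.exp (-‖z ij - Ξ ij.1 ij.2‖ ^ 2) := by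
  rw [Finset.prod_mul_distrib, ← Real.exp_sum, gaussianWeight, reInner_self_eq_sum,
    Finset.sum_neg_distrib]
  simp [ofPairs_apply]

lemma continuous_gaussianWeight (Ξ : Matrix (Fin m) (Fin p) ℂ) :
    Continuous (gaussianWeight Ξ) := by
  refine continuous_iff_continuousAt.2 fun Z => ?_
  obtain ⟨T, hT, -⟩ := exists_hasFDerivAt_gaussianWeight Ξ Z
  exact hT.continuousAt

/-- A vector of independent complex normal variables, carried to `E` by a linear equivalence, has a
density with respect to a Haar measure of `E`. -/
lemma exists_isAddHaarMeasure_hasLaw_of_equiv {ι E : Type*} [Fintype ι] [NormedAddCommGroup E]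
    [NormedSpace ℝ E] [MeasurableSpace E] [BorelSpace E]
    (e : (ι → ℂ) ≃L[ℝ] E) {ξ : ι → ℂ} {φ : E → ℝ} (hφ : Continuous φ)
    (he : ∀ z, φ (e z) = ∏ i, Real.pi⁻¹ * Real.exp (-‖z i - ξ i‖ ^ 2)) {X : ι → Ω → ℂ}
    (hX : ∀ i, HasLaw (X i) (complexNormal (ξ i) 1) P) (hind : iIndepFun X P) :
    ∃ μ : Measure E, μ.IsAddHaarMeasure ∧
      HasLaw (fun ω => e fun i => X i ω) (μ.withDensity fun x => ENNReal.ofReal (φ x)) P := by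
  have := Real.pi_pos
  refine ⟨(volume : Measure (ι → ℂ)).map e, inferInstance,
    hasLaw_comp_withDensity e.continuous.measurable hφ.measurable.ennreal_ofReal ?_⟩
  have h := hind.hasLaw_pi hX
  simp only [complexNormal_one] at h
  rw [pi_withDensity_ofReal (fun _ => volume)
    (fun i => (integrable_exp_neg_sq_norm.comp_sub_right (ξ i)).const_mul _)
    fun i x => by positivity] at h
  simp only [he]
  exact h

lemma IsStdComplexNormalMatrix.exists_hasLaw
    [MeasurableSpace (Matrix (Fin m) (Fin p) ℂ)]
    [@BorelSpace (Matrix (Fin m) (Fin p) ℂ) PseudoMetricSpace.toUniformSpace.toTopologicalSpace _]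
    (hZ : IsStdComplexNormalMatrix Z Ξ P) :
    ∃ μ : Measure (Matrix (Fin m) (Fin p) ℂ),
      @Measure.IsAddHaarMeasure (Matrix (Fin m) (Fin p) ℂ) _
        PseudoMetricSpace.toUniformSpace.toTopologicalSpace _ μ ∧
      HasLaw Z (μ.withDensity fun X => ENNReal.ofReal (gaussianWeight Ξ X)) P :=
  exists_isAddHaarMeasure_hasLaw_of_equiv (ofPairs m p) (continuous_gaussianWeight Ξ)
    (gaussianWeight_ofPairs Ξ) (fun ij => hZ.hasLaw ij.1 ij.2) hZ.indep

lemma aemeasurable_riskIntegrand (m : ℕ) (ρ : Measure (Fin p → ℝ)) {h : Fin p → (Fin p → ℝ) → ℝ}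
    (hh : ∀ k, DifferentiableOn ℝ (h k) (strictlyOrderedPositive p)) :
    AEMeasurable (riskIntegrand m h) (ρ.restrict (strictlyOrderedPositive p)) := by
  have hS := isOpen_strictlyOrderedPositive (p := p)
  have h1 : ∀ k, AEMeasurable (h k) (ρ.restrict (strictlyOrderedPositive p)) := fun k =>
    (hh k).continuousOn.aemeasurable hS.measurableSet
  have h2 : ∀ k, AEMeasurable (fun l => partialDeriv (h k) k l)
      (ρ.restrict (strictlyOrderedPositive p)) := fun k => by
    refine (measurable_fderiv_apply_const ℝ (h k) (Pi.single k 1)).aemeasurable.congr ?_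
    filter_upwards [ae_restrict_mem hS.measurableSet] with l hl
    rw [partialDeriv, ((hh k).differentiableAt (hS.mem_nhds hl)).lineDeriv_eq_fderiv]
  have h3 : ∀ k, AEMeasurable (fun l : Fin p → ℝ => l k)
      (ρ.restrict (strictlyOrderedPositive p)) := fun k => (measurable_pi_apply k).aemeasurable
  refine Finset.aemeasurable_fun_sum _ fun k _ => ?_
  refine ((((h1 k).const_mul _).add (((h3 k).const_mul 2).mul (h2 k))).add
    (AEMeasurable.const_mul (Finset.aemeasurable_fun_sum _ fun b _ => ?_) 4)).add
    ((h3 k).mul ((h1 k).pow_const 2))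
  exact (((h3 k).mul (h1 k)).sub ((h3 b).mul (h1 b))).div ((h3 k).sub (h3 b))

/-- Expectations of functions of a random variable with density `φ`. -/
lemma integrable_comp_iff_of_hasLaw_withDensity {E : Type*} [MeasurableSpace E] {X : Ω → E}
    {μ : Measure E} {φ : E → ℝ} (hφ : Measurable φ) (h0 : ∀ x, 0 ≤ φ x)
    (hX : HasLaw X (μ.withDensity fun x => ENNReal.ofReal (φ x)) P) {F : E → ℝ}
    (hF : AEStronglyMeasurable F μ) :
    (Integrable (fun ω => F (X ω)) P ↔ Integrable (fun x => φ x * F x) μ) ∧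
      ∫ ω, F (X ω) ∂P = ∫ x, φ x * F x ∂μ := by
  have hF' : AEStronglyMeasurable F (μ.withDensity fun x => ENNReal.ofReal (φ x)) :=
    hF.mono_ac (withDensity_absolutelyContinuous _ _)
  have hsmul : (fun x => (ENNReal.ofReal (φ x)).toReal • F x) = fun x => φ x * F x := by
    funext x
    rw [ENNReal.toReal_ofReal (h0 x), smul_eq_mul]
  constructor
  · rw [← hsmul, ← integrable_withDensity_iff_integrable_smul' hφ.ennreal_ofReal
      (Filter.Eventually.of_forall fun _ => ENNReal.ofReal_lt_top), ← hX.map_eq]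
    rw [← hX.map_eq] at hF'
    exact (integrable_map_measure hF' hX.aemeasurable).symm
  · rw [← hsmul, ← integral_withDensity_eq_integral_toReal_smul hφ.ennreal_ofReal
      (Filter.Eventually.of_forall fun _ => ENNReal.ofReal_lt_top)]
    exact hX.integral_comp hF'

end Law

/-! ### The risk of the estimate -/

section Risk

variable {Ω : Type*} [MeasurableSpace Ω] {P : Measure Ω} {m p : ℕ}
  {Ξ : Matrix (Fin m) (Fin p) ℂ} {Z : Ω → Matrix (Fin m) (Fin p) ℂ}

lemma IsStdComplexNormalMatrix.ae_mem_regularSet (hZ : IsStdComplexNormalMatrix Z Ξ P)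
    (hpm : p ≤ m) : ∀ᵐ ω ∂P, Z ω ∈ regularSet m p := by
  let _ : MeasurableSpace (Matrix (Fin m) (Fin p) ℂ) :=
    @borel _ PseudoMetricSpace.toUniformSpace.toTopologicalSpace
  have : @BorelSpace (Matrix (Fin m) (Fin p) ℂ)
    PseudoMetricSpace.toUniformSpace.toTopologicalSpace _ := ⟨rfl⟩
  -- The same fact for the product topology on matrices, which is definitionally the norm topology.
  have : @BorelSpace (Matrix (Fin m) (Fin p) ℂ) instTopologicalSpaceMatrix _ := ⟨rfl⟩
  obtain ⟨μ, hμ, hlaw⟩ := hZ.exists_hasLaw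
  have h := (withDensity_absolutelyContinuous μ fun X =>
    ENNReal.ofReal (gaussianWeight Ξ X)).ae_le (_root_.ae_mem_regularSet hpm μ)
  rw [← hlaw.map_eq] at h
  exact ae_of_ae_map hlaw.aemeasurable h

/-- The risk identity in terms of the matrix `Z` alone. -/
theorem IsStdComplexNormalMatrix.integral_reInner_estimationError [IsProbabilityMeasure P]
    (hZ : IsStdComplexNormalMatrix Z Ξ P) (hpm : p ≤ m) {h : Fin p → (Fin p → ℝ) → ℝ}
    (hh : ∀ k, DifferentiableOn ℝ (h k) (strictlyOrderedPositive p))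
    (hint : Integrable (fun ω => riskIntegrand m h (gramEig (Z ω))) P) :
    Integrable (fun ω => reInner (estimationError h Ξ (Z ω)) (estimationError h Ξ (Z ω))) P ∧
      ∫ ω, reInner (estimationError h Ξ (Z ω)) (estimationError h Ξ (Z ω)) ∂P
        = m * p + ∫ ω, riskIntegrand m h (gramEig (Z ω)) ∂P := by
  let _ : MeasurableSpace (Matrix (Fin m) (Fin p) ℂ) :=
    @borel _ PseudoMetricSpace.toUniformSpace.toTopologicalSpace
  have : @BorelSpace (Matrix (Fin m) (Fin p) ℂ)
    PseudoMetricSpace.toUniformSpace.toTopologicalSpace _ := ⟨rfl⟩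
  -- The same fact for the product topology on matrices, which is definitionally the norm topology.
  have : @BorelSpace (Matrix (Fin m) (Fin p) ℂ) instTopologicalSpaceMatrix _ := ⟨rfl⟩
  obtain ⟨μ, hμ, hlaw⟩ := hZ.exists_hasLaw
  have hrestrict : μ.restrict (regularSet m p) = μ :=
    Measure.restrict_eq_self_of_ae_mem (_root_.ae_mem_regularSet hpm μ)
  have hφm : Measurable (gaussianWeight Ξ) := (continuous_gaussianWeight Ξ).measurable
  have hcomp := fun (F : Matrix (Fin m) (Fin p) ℂ → ℝ) (hF : AEStronglyMeasurable F μ) =>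
    integrable_comp_iff_of_hasLaw_withDensity hφm (gaussianWeight_nonneg Ξ) hlaw hF
  have hGm : Measurable (gramEig : Matrix (Fin m) (Fin p) ℂ → Fin p → ℝ) :=
    continuous_gramEig.measurable
  have hrisk : AEStronglyMeasurable (fun X : Matrix (Fin m) (Fin p) ℂ =>
      riskIntegrand m h (gramEig X)) μ := by
    have h1 := aemeasurable_riskIntegrand m (μ.map gramEig) hh
    rw [Measure.restrict_map hGm isOpen_strictlyOrderedPositive.measurableSet] at h1
    have h2 := h1.comp_measurable hGm
    change AEMeasurable _ (μ.restrict (regularSet m p)) at h2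
    rw [hrestrict] at h2
    exact h2.aestronglyMeasurable
  have hsub : Continuous fun X : Matrix (Fin m) (Fin p) ℂ => reInner (X - Ξ) (X - Ξ) :=
    continuous_reInner_self.comp (continuous_sub_right Ξ)
  have hloss : AEStronglyMeasurable (fun X : Matrix (Fin m) (Fin p) ℂ =>
      reInner (estimationError h Ξ X) (estimationError h Ξ X)) μ := by
    have h1 : ContinuousOn (fun X : Matrix (Fin m) (Fin p) ℂ =>
        reInner (estimationError h Ξ X) (estimationError h Ξ X)) (regularSet m p) :=
      continuous_reInner_self.comp_continuousOn fun X hX => by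
        obtain ⟨T, hT, -⟩ := exists_hasFDerivAt_estimationError hh Ξ hX
        exact hT.continuousAt.continuousWithinAt
    have h2 := h1.aemeasurable (μ := μ) isOpen_regularSet.measurableSet
    rw [hrestrict] at h2
    exact h2.aestronglyMeasurable
  have hr : Integrable (fun ω => reInner (Z ω) (Z ω)) P := by
    have hm : AEStronglyMeasurable (fun ω => reInner (Z ω) (Z ω)) P :=
      (continuous_reInner_self.measurable.comp_aemeasurable hlaw.aemeasurable).aestronglyMeasurable
    refine ((hZ.integrable_reInner.const_mul 2).add (integrable_const (2 * reInner Ξ Ξ))).mono' hm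
      (Filter.Eventually.of_forall fun ω => ?_)
    rw [Real.norm_eq_abs, abs_of_nonneg (reInner_self_nonneg _)]
    have h1 := reInner_add_self (Z ω - Ξ) Ξ
    have h2 := reInner_add_self (Z ω - Ξ) (-Ξ)
    have h3 := reInner_self_nonneg (Z ω - Ξ + -Ξ)
    have h4 : reInner (Z ω - Ξ) (-Ξ) = -reInner (Z ω - Ξ) Ξ := by simp [reInner]
    have h5 : reInner (-Ξ) (-Ξ) = reInner Ξ Ξ := by simp [reInner]
    rw [sub_add_cancel] at h1
    simp only [Pi.add_apply]
    linarith
  have hconst : Integrable (fun _ : Ω => 2 * (m : ℝ) * p) P := integrable_const _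
  have hfint := (hconst.add hint).sub hZ.integrable_reInner
  have hf := hcomp (fun X => 2 * m * p + riskIntegrand m h (gramEig X) - reInner (X - Ξ) (X - Ξ))
    ((hrisk.const_add _).sub hsub.measurable.aestronglyMeasurable)
  have hmain := integral_gaussianWeight_mul_reInner_estimationError μ hpm hh Ξ
    ((hcomp (fun X => reInner X X) continuous_reInner_self.measurable.aestronglyMeasurable).1.1 hr)
    (hf.1.1 hfint)
  refine ⟨(hcomp _ hloss).1.2 hmain.1, ?_⟩
  rw [(hcomp _ hloss).2, hmain.2, ← hf.2]
  have e1 := integral_sub (hconst.add hint) hZ.integrable_reInner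
  have e2 := integral_add hconst hint
  simp only [Pi.add_apply] at e1
  rw [e1, e2, hZ.integral_reInner, integral_const]
  simp only [probReal_univ, one_smul]
  ring

lemma invariantEstimate_sub_eq {h : Fin p → (Fin p → ℝ) → ℝ} {Z : Matrix (Fin m) (Fin p) ℂ}
    {U : Matrix (Fin p) (Fin p) ℂ} {l : Fin p → ℝ}
    (hU : IsOrderedEigendecomposition (Zᴴ * Z) U l) (hZ : Z ∈ regularSet m p)
    (Ξ : Matrix (Fin m) (Fin p) ℂ) :
    invariantEstimate h Z U l - Ξ = estimationError h Ξ Z := by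
  have hl : gramEig Z = l := hU.eigVal_eq
  have hP : ∀ k, eigenProj U k = gramProj Z k := fun k => by
    exact congrFun ((gram_isOrderedEigendecomposition Z).eigenProj_eq (hl ▸ hU) hZ.1.injective) k
  rw [invariantEstimate, mul_realDiag_mul_conjTranspose, estimationError, invariantField, hl,
    spectralSum, Matrix.mul_add, Matrix.mul_one]
  simp only [hP]
  abel

end Risk

theorem mainTheorem5 {Ω : Type*} [MeasurableSpace Ω] (P : Measure Ω) [IsProbabilityMeasure P]
    (m p : ℕ) (hpm : p ≤ m)
    (Ξ : Matrix (Fin m) (Fin p) ℂ) (Z : Ω → Matrix (Fin m) (Fin p) ℂ)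
    (hZ : IsStdComplexNormalMatrix Z Ξ P)
    (U : Ω → Matrix (Fin p) (Fin p) ℂ) (L : Ω → Fin p → ℝ)
    (hUL : ∀ᵐ ω ∂P, IsOrderedEigendecomposition ((Z ω)ᴴ * Z ω) (U ω) (L ω))
    (h : Fin p → (Fin p → ℝ) → ℝ)
    (hdiff : ∀ k, DifferentiableOn ℝ (h k) (strictlyOrderedPositive p))
    (hint : Integrable (fun ω => riskIntegrand m h (L ω)) P) :
    Integrable (fun ω => traceLoss (invariantEstimate h (Z ω) (U ω) (L ω)) Ξ) P ∧
      traceRisk P (fun ω => invariantEstimate h (Z ω) (U ω) (L ω)) Ξ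
        = (m : ℝ) * p + ∫ ω, riskIntegrand m h (L ω) ∂P := by
  have hloss : (fun ω => reInner (estimationError h Ξ (Z ω)) (estimationError h Ξ (Z ω)))
      =ᵐ[P] fun ω => traceLoss (invariantEstimate h (Z ω) (U ω) (L ω)) Ξ := by
    filter_upwards [hUL, hZ.ae_mem_regularSet hpm] with ω hω hreg
    rw [traceLoss, invariantEstimate_sub_eq hω hreg, reInner]
  have hrisk : (fun ω => riskIntegrand m h (L ω))
      =ᵐ[P] fun ω => riskIntegrand m h (gramEig (Z ω)) := by
    filter_upwards [hUL] with ω hω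
    rw [gramEig, hω.eigVal_eq]
  obtain ⟨h1, h2⟩ := hZ.integral_reInner_estimationError hpm hdiff (hint.congr hrisk)
  refine ⟨h1.congr hloss, ?_⟩
  rw [traceRisk, ← integral_congr_ae hloss, h2, integral_congr_ae hrisk]
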